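/- Let $F, F'$ be non-Archimedean local fields with rings of integers $\mathcal O,\mathcal O'$, maximal ideals $\wp,\wp'$, and fixed uniformizers $\pi,\pi'$. Put $\mathcal O_\ell=\mathcal O/\wp^\ell$, $\mathcal O'_\ell=\mathcal O'/\wp'^\ell$, and let $\phi:\mathcal O_1\to\mathcal O_1'$ be a fixed isomorphism of the (finite) residue fields; write $k=\mathcal O_1$ and identify $\mathcal O'_1$ with $k$ through $\phi$. Let $n\ge 0$. For a group $G$ let $\mathrm{Irr}(G)$ be the set of isomorphism classes of its finite dimensional irreducible complex representations. For $A\in M_n(k)$ let $Z(A)$ be its centralizer in $\mathrm{GL}_n(k)$, and let $T(A)\subseteq \mathrm{GL}_n(\mathcal O_2)$ and $T'(A)\subseteq\mathrm{GL}_n(\mathcal O'_2)$ be the inverse images of $Z(A)$. For a nontrivial additive character $\psi:k\to\mathbb C^*$, let $\psi_A$ be the character $1+\pi X\mapsto\psi(\mathrm{Tr}(AX))$ of $K=\ker(\mathrm{GL}_n(\mathcal O_2)\to\mathrm{GL}_n(k))$, whose stabilizer is $T(A)$, and similarly (with $\pi'$) for $K'=\ker(\mathrm{GL}_n(\mathcal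 O'_2)\to\mathrm{GL}_n(k))$. **Matched extensions.** Let $\chi,\chi'$ be characters of $T(A),T'(A)$. Call $(\chi,\chi')$ a *basic pair* if it arises as follows, for some choice of the data. Let $E/k$ be a finite extension over which $A$ splits, $\psi_E$ an additive character of $E$ extending $\psi$, and $g\in \mathrm{GL}_n(E)$ such that $J=g^{-1}Ag$ is in Jordan canonical form. Let $S,S'$ be the unramified extensions of $\mathcal O_2,\mathcal O'_2$ with residue field $E$, and $s,s'$ the multiplicative sections of their residue maps. For each eigenvalue $e$ let $\eta_e:S^*\to\mathbb C^*$ be a character with $\eta_e(1+\pi x)=\psi_E(ex)$, and let $\eta'_e$ be the character of $S'^*$ corresponding to it under the isomorphism $S^*\cong S'^*$, $s(u)(1+\pi x)\mapsto s'(u)(1+\pi' x)$. Let $\chi_S$ be the character of the inverse image in $\mathrm{GL}_n(S)$ of the centralizer of $J$ in $\mathrm{GL}_n(E)$ that is $1+\pi X\mapsto\psi_E(\mathrm{Tr}(JX))$ on the kernel of reduction and $z\mapsto\prod_e\eta_e(\det z_e)$ on the centralizer of $s(J)$ ($s$ applied entrywise), where $z_e$ is the diagonal block of $z$ belonging to $e$.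 Then $\chi(t)=\chi_S(h^{-1}th)$ for every lift $h\in\mathrm{GL}_n(S)$ of $g$; and $\chi'$ is obtained in the same way from $S',s',\eta'_e$. Call $(\chi,\chi')$ *matched* if it is obtained from a basic pair by multiplying both members by (the inflations of) one and the same character of $Z(A)$. **Theorem.** 1. (Parametrisation.) Let $\psi$ be a nontrivial additive character of $k$. Every $\psi_A$ extends to a character of $T(A)$. Choose a representative $A$ of each similarity class in $M_n(k)$ and for each of them any extension $\chi_A$ of $\psi_A$ to $T(A)$. Then $\sigma\mapsto\mathrm{Ind}_{T(A)}^{\mathrm{GL}_n(\mathcal O_2)}(\chi_A\otimes\sigma)$ gives a bijection from $\coprod_A\mathrm{Irr}(Z(A))$ onto $\mathrm{Irr}(\mathrm{GL}_n(\mathcal O_2))$, and it multiplies dimensions by $[\mathrm{GL}_n(k):Z(A)]$. 2. (Canonical extension.) For every nontrivial $\psi$, every $A\in M_n(k)$ and every extension $\chi$ of $\psi_A$ to $T(A)$ there is exactly one character $\chi'$ of $T'(A)$ such that $(\chi,\chi')$ is matched, and $\chi'$ extends the character $\psi_A$ of $K'$. 3. (Canonical bijection.) There is a dimension preserving bijection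 $\Phi:\mathrm{Irr}(\mathrm{GL}_n(\mathcal O_2))\to\mathrm{Irr}(\mathrm{GL}_n(\mathcal O'_2))$ with $$\Phi\bigl(\mathrm{Ind}_{T(A)}^{\mathrm{GL}_n(\mathcal O_2)}(\chi\otimes\sigma)\bigr)=\mathrm{Ind}_{T'(A)}^{\mathrm{GL}_n(\mathcal O'_2)}(\chi'\otimes\sigma)$$ for every nontrivial $\psi$, every $A\in M_n(k)$, every matched pair $(\chi,\chi')$ of extensions of $\psi_A$ and every $\sigma\in\mathrm{Irr}(Z(A))$; and $\Phi$ is the only bijection with this property. -/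

import Mathlib

open scoped ValuativeRel

noncomputable section

universe u v w

/-! ### Irreducible complex representations -/

/-- A finite dimensional irreducible complex representation of `G`, on a coordinate space. -/
structure IrrRep (G : Type u) [Group G] where
  /-- the dimension -/
  dim : ℕ
  /-- the action -/
  ρ : Representation ℂ G (Fin dim → ℂ)
  irreducible : ρ.IsIrreducible

/-- Isomorphism of representations, as an equivalence relation. -/
instance IrrRep.setoid (G : Type u) [Group G] : Setoid (IrrRep G) where
  r a b := Nonempty (a.ρ.Equiv b.ρ)
  iseqv :=
    { refl := fun a => ⟨Representation.Equiv.refl a.ρ⟩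
      symm := fun ⟨e⟩ => ⟨e.symm⟩
      trans := fun ⟨e⟩ ⟨f⟩ => ⟨e.trans f⟩ }

/-- `Irr G`: isomorphism classes of finite dimensional irreducible complex representations. -/
def Irr (G : Type u) [Group G] : Type u := Quotient (IrrRep.setoid G)

/-- The dimension of an isomorphism class. -/
def Irr.dim {G : Type u} [Group G] (c : Irr G) : ℕ :=
  Quotient.lift (fun a : IrrRep G => a.dim) (fun a b h => by
    obtain ⟨e⟩ := h
    simpa using e.toLinearEquiv.finrank_eq) c

/-- `c.IsClassOf ρ`: the representation `ρ` is irreducible and `c` is its isomorphism class. -/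
def Irr.IsClassOf {G : Type u} [Group G] {V : Type w} [AddCommGroup V] [Module ℂ V]
    (c : Irr G) (ρ : Representation ℂ G V) : Prop :=
  ∃ a : IrrRep G, Quotient.mk (IrrRep.setoid G) a = c ∧ Nonempty (a.ρ.Equiv ρ)

/-! ### Rings of length two -/

/-- `𝒪₂ = 𝒪 / ℘²`. -/
abbrev O₂ (F : Type u) [Field F] [ValuativeRel F] : Type u := 𝒪[F] ⧸ (𝓂[F] ^ 2)

/-- The reduction map `𝒪₂ → 𝒪₁ = 𝒪 / ℘`. -/
def O₂.res (F : Type u) [Field F] [ValuativeRel F] : O₂ F →+* 𝓀[F] :=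
  Ideal.Quotient.lift (𝓂[F] ^ 2) (IsLocalRing.residue 𝒪[F]) fun x hx =>
    (IsLocalRing.residue_eq_zero_iff x).2 (Ideal.pow_le_self two_ne_zero hx)

/-- `S` is a (local, principal ideal) ring of length two with uniformizer `π` and residue map
`res : S → E`: the map `res` is onto, and both its kernel and the annihilator of `π` are `π S`. -/
structure IsLengthTwo {S : Type u} {E : Type v} [CommRing S] [Field E] (π : S) (res : S →+* E) :
    Prop where
  surjective : Function.Surjective res
  res_eq_zero_iff : ∀ x, res x = 0 ↔ ∃ y, x = π * y
  mul_eq_zero_iff : ∀ x, π * x = 0 ↔ res x = 0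

/-- An unramified extension `S` of the length two ring `(R, π, res : R → k)` with residue field
the extension `E` of `k` (so the image of `π` is still a uniformizer), together with
the multiplicative section `s` of the residue map. Rings of this kind are finite when `E` is, so
nothing is lost by taking them in the lowest universe. -/
structure UnramifiedExt {R : Type u} {k : Type v} [CommRing R] [Field k] (π : R) (res : R →+* k)
    (E : Type) [Field E] [Algebra k E] where
  S : Type
  [commRing : CommRing S]
  /-- the structure map `R → S` -/
  ι : R →+* S
  /-- the residue map of `S` -/
  resS : S →+* E
  isLengthTwo : IsLengthTwo (ι π) resS
  resS_ι : ∀ x, resS (ι x) = algebraMap k E (res x)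
  /-- the multiplicative section -/
  s : E →*₀ S
  resS_s : ∀ x, resS (s x) = x

attribute [instance] UnramifiedExt.commRing

/-! ### Centralizers, stabilizers and extensions of characters -/

section
variable {R : Type u} {k : Type v} [CommRing R] [Field k] {n : ℕ}

/-- The centralizer of the matrix `A` in `GL_n(k)`. -/
def matCentralizer (A : Matrix (Fin n) (Fin n) k) : Subgroup (GL (Fin n) k) where
  carrier := {g | (g : Matrix (Fin n) (Fin n) k) * A = A * (g : Matrix (Fin n) (Fin n) k)}
  mul_mem' {a b} ha hb := by
    simp only [Set.mem_ofPred_eq, Matrix.GeneralLinearGroup.coe_mul] at *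
    rw [Matrix.mul_assoc, hb, ← Matrix.mul_assoc, ha, Matrix.mul_assoc]
  one_mem' := by simp
  inv_mem' {a} ha := by
    have h : Commute (a : Matrix (Fin n) (Fin n) k) A := ha
    exact h.units_inv_left

/-- `T(ψ_A)`, the stabilizer in `GL_n(R)` of the character `ψ_A` of the kernel of
`GL_n(R) → GL_n(k)`: the inverse image of the centralizer of `A`. -/
def stab (res : R →+* k) (A : Matrix (Fin n) (Fin n) k) : Subgroup (GL (Fin n) R) :=
  (matCentralizer A).comap (Matrix.GeneralLinearGroup.map res)

/-- The reduction map from `T(ψ_A)` to the centralizer of `A`. -/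
def stabRed (res : R →+* k) (A : Matrix (Fin n) (Fin n) k) : stab res A →* matCentralizer A :=
  (Matrix.GeneralLinearGroup.map res).subgroupComap (matCentralizer A)

/-- The character `χ` of `T(ψ_A)` extends `ψ_A : 1 + π X ↦ ψ (Tr (A X))`. -/
def IsExtension (π : R) (res : R →+* k) (ψ : AddChar k ℂ) (A : Matrix (Fin n) (Fin n) k)
    (χ : stab res A →* ℂˣ) : Prop :=
  ∀ (t : stab res A) (X : Matrix (Fin n) (Fin n) R),
    ((t : GL (Fin n) R) : Matrix (Fin n) (Fin n) R) = 1 + π • X →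
      (χ t : ℂ) = ψ (Matrix.trace (A * X.map res))

/-- The representation `χ ⊗ σ` of `T(ψ_A)`, for a representation `σ` of the centralizer of `A`. -/
def twistRep (res : R →+* k) (A : Matrix (Fin n) (Fin n) k) (χ : stab res A →* ℂˣ)
    {V : Type w} [AddCommGroup V] [Module ℂ V] (σ : Representation ℂ (matCentralizer A) V) :
    Representation ℂ (stab res A) V where
  toFun t := (χ t : ℂ) • σ (stabRed res A t)
  map_one' := by simp
  map_mul' a b := by
    simp only [map_mul, Units.val_mul, smul_mul_smul_comm]

/-- `c` is the class of the (irreducible) representation `Ind (χ ⊗ σ)` of `GL_n(R)`, induced from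
`T(ψ_A)`. -/
def IsInduced (res : R →+* k) (A : Matrix (Fin n) (Fin n) k) (χ : stab res A →* ℂˣ)
    (σ : Irr (matCentralizer A)) (c : Irr (GL (Fin n) R)) : Prop :=
  ∃ a : IrrRep (matCentralizer A), Quotient.mk (IrrRep.setoid _) a = σ ∧
    c.IsClassOf (Representation.ind (stab res A).subtype (twistRep res A χ a.ρ))

end

/-! ### Matching extensions over two rings with the same residue field -/

section
variable {k : Type u} [Field k] {n : ℕ}

/-- `J` is in Jordan canonical form with diagonal `a`. -/
def IsJordanForm {E : Type v} [Field E] (J : Matrix (Fin n) (Fin n) E) (a : Fin n → E) : Prop :=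
  (∀ i, J i i = a i) ∧
  (∀ i j : Fin n, (j : ℕ) = i + 1 → J i j = 0 ∨ (J i j = 1 ∧ a i = a j)) ∧
  (∀ i j : Fin n, j ≠ i → (j : ℕ) ≠ i + 1 → J i j = 0)

/-- A finite extension `E` of `k` over which `A` splits, with an extension `ψE` of `ψ` to `E`,
a Jordan canonical form `J` of `A` over `E`, and `g` in `GL_n(E)` with `g⁻¹ A g = J`. -/
structure SplitDatum (ψ : AddChar k ℂ) (A : Matrix (Fin n) (Fin n) k) where
  E : Type
  [field : Field E]
  [finite : Finite E]
  [algebra : Algebra k E]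
  ψE : AddChar E ℂ
  ψE_algebraMap : ∀ x, ψE (algebraMap k E x) = ψ x
  J : Matrix (Fin n) (Fin n) E
  /-- the eigenvalues -/
  a : Fin n → E
  isJordanForm : IsJordanForm J a
  g : GL (Fin n) E
  map_mul_g : A.map (algebraMap k E) * (g : Matrix (Fin n) (Fin n) E)
    = (g : Matrix (Fin n) (Fin n) E) * J

attribute [instance] SplitDatum.field SplitDatum.finite SplitDatum.algebra

open Classical in
/-- Given characters `η e` of `Sˣ` for the eigenvalues `e` (extended by zero to `S`), the character
`χ` of `T(ψ_A)` is obtained as follows. Let `χS` be the character of the stabilizer over `S` of the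
character attached to `J` which extends that character and is
`z ↦ ∏ₑ η e (det zₑ)` on the centralizer of `s(J)`, where `zₑ` is the diagonal block of `z` that
belongs to `e`; transport `χS` along conjugation by a lift of `g`, and restrict to `T(ψ_A)`. -/
def IsConstructed {R : Type v} [CommRing R] (π : R) (res : R →+* k) {ψ : AddChar k ℂ}
    {A : Matrix (Fin n) (Fin n) k} (D : SplitDatum ψ A) (L : UnramifiedExt π res D.E)
    (η : D.E → MulChar L.S ℂ) (χ : stab res A →* ℂˣ) : Prop :=
  ∃ χS : stab L.resS D.J →* ℂˣ,
    IsExtension (L.ι π) L.resS D.ψE D.J χS ∧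
    (∀ z : stab L.resS D.J,
      ((z : GL (Fin n) L.S) : Matrix (Fin n) (Fin n) L.S) * D.J.map L.s
        = D.J.map L.s * ((z : GL (Fin n) L.S) : Matrix (Fin n) (Fin n) L.S) →
      (χS z : ℂ) = ∏ e ∈ Finset.univ.image D.a, η e
        (Matrix.det
          (Matrix.toSquareBlock ((z : GL (Fin n) L.S) : Matrix (Fin n) (Fin n) L.S) D.a e))) ∧
    (∀ (t : stab res A) (h : GL (Fin n) L.S) (z : stab L.resS D.J),
      Matrix.GeneralLinearGroup.map L.resS h = D.g →
      Matrix.GeneralLinearGroup.map L.ι (t : GL (Fin n) R) * h = h * (z : GL (Fin n) L.S) →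
      χ t = χS z)

/-- The extensions `χ` and `χ'` of `ψ_A` over two length two rings with the same residue field `k`
are built from the same Jordan form, using characters `η e`, `η' e` of the unit
groups that restrict to `1 + π x ↦ ψE (e x)` and that correspond to each other under the canonical
isomorphism `s(u) (1 + π x) ↦ s'(u) (1 + π' x)` between these groups. -/
def IsBasicMatch {R : Type v} {R' : Type w} [CommRing R] [CommRing R'] (π : R) (res : R →+* k)
    (π' : R') (res' : R' →+* k) (ψ : AddChar k ℂ) (A : Matrix (Fin n) (Fin n) k)
    (χ : stab res A →* ℂˣ) (χ' : stab res' A →* ℂˣ) : Prop :=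
  ∃ (D : SplitDatum ψ A) (L : UnramifiedExt π res D.E) (L' : UnramifiedExt π' res' D.E)
    (η : D.E → MulChar L.S ℂ) (η' : D.E → MulChar L'.S ℂ),
    (∀ e x, η e (1 + L.ι π * x) = D.ψE (e * L.resS x)) ∧
    (∀ e u x x', L.resS x = L'.resS x' →
      η e (L.s u * (1 + L.ι π * x)) = η' e (L'.s u * (1 + L'.ι π' * x'))) ∧
    IsConstructed π res D L η χ ∧ IsConstructed π' res' D L' η' χ'

/-- The correspondence between extensions of `ψ_A` over two length two rings with the same residue
field `k`: any two extensions differ by a character `μ` of the centralizer of `A` in `GL_n(k)`, and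
twisting by the same `μ` on both sides is allowed. -/
def IsMatched {R : Type v} {R' : Type w} [CommRing R] [CommRing R'] (π : R) (res : R →+* k)
    (π' : R') (res' : R' →+* k) (ψ : AddChar k ℂ) (A : Matrix (Fin n) (Fin n) k)
    (χ : stab res A →* ℂˣ) (χ' : stab res' A →* ℂˣ) : Prop :=
  ∃ (χ₀ : stab res A →* ℂˣ) (χ₀' : stab res' A →* ℂˣ) (μ : matCentralizer A →* ℂˣ),
    IsBasicMatch π res π' res' ψ A χ₀ χ₀' ∧
    χ = χ₀ * μ.comp (stabRed res A) ∧ χ' = χ₀' * μ.comp (stabRed res' A)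

/-- The bijection `Φ` is compatible with the two constructions of representations by
induction: it sends `Ind (χ ⊗ σ)` to `Ind (χ' ⊗ σ)`, for all choices of a nontrivial `ψ`, of `A`,
of corresponding extensions `χ`, `χ'` of `ψ_A`, and of `σ`. -/
def IsCanonical {R : Type v} {R' : Type w} [CommRing R] [CommRing R'] (n : ℕ) (π : R)
    (res : R →+* k) (π' : R') (res' : R' →+* k)
    (Φ : Irr (GL (Fin n) R) ≃ Irr (GL (Fin n) R')) : Prop :=
  ∀ (ψ : AddChar k ℂ), ψ ≠ 1 → ∀ (A : Matrix (Fin n) (Fin n) k)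
    (χ : stab res A →* ℂˣ) (χ' : stab res' A →* ℂˣ), IsMatched π res π' res' ψ A χ χ' →
    ∀ (σ : Irr (matCentralizer A)) (c : Irr (GL (Fin n) R)) (c' : Irr (GL (Fin n) R')),
      IsInduced res A χ σ c → IsInduced res' A χ' σ c' → Φ c = c'

end

end

/-! The heart of the matter is a canonical homomorphism `stabLog` from T(A) to k, defined over every
finite ring of length two, that extends 1 + πX ↦ Tr(A X̄). The multiplicative section s splits the
units as s(u)(1 + πx), so that s(u)(1 + πx) ↦ x̄ is a logarithm on them. For a Jordan form J, the
stabilizer T(J) is the product of the centralizer of s(J) and the kernel of reduction. The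
prescriptions Σ e·log det z_e on the first factor and Tr(J X̄) on the second agree on the overlap,
because the nilpotent part of J contributes no trace (`trace_mul_of_commute`); the result is
`jordanLog` (`jordanLog_eq`, `jordanLog_mul`).

Applying s entrywise turns intertwiners of Jordan forms into intertwiners of their lifts, although s
is not additive (`map_intertwiner`). This makes the logarithm equivariant under conjugation
(`jordanLog_conj`). Embeddings of residue fields lift to unramified extensions (`exists_lift`),
which makes it natural (`jordanLog_map`). Hence it does not depend on J, g or the lift of g, it is
Galois invariant, and it descends to k (`exists_stabLog`).

Now ψ ∘ `stabLog` extends ψ_A, and any constructed extension is this one times a character of Z(A)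
built from the values η_e(s(u)) (`apply_eq_of_isConstructed`). In a basic pair these values
coincide, so two characters are matched exactly when they differ from the canonical extensions by
the same character of Z(A) (`isMatched_iff`). Existence and uniqueness of χ' follow.

The parametrisation is Clifford theory for the abelian kernel of reduction, identified with M_n(k),
whose characters ψ_A are permuted through conjugation of A. It is carried out with explicit
projectors. The ψ_A-isotypic part of an irreducible representation, if nonzero, has the form χ ⊗ σ,
and Frobenius reciprocity recovers the representation from it.

For a fixed ψ₀ and the canonical extensions, both sides are parametrised by the same set, and this
defines Φ. Any other nontrivial ψ is x ↦ ψ₀(bx), and `stabLog_conj` trades (ψ, A) for (ψ₀, bA) by a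
recipe that involves only k. So Φ is compatible with every choice. -/

noncomputable section

/-! ### Rings of length two: division by the uniformizer and logarithms -/

section LengthTwo

variable {S E : Type*} [CommRing S] [Field E]

open Classical in
/-- The residue class of `x`, for an element `y = π x`. -/
def divUnif (π : S) (res : S →+* E) (y : S) : E :=
  if h : ∃ x, y = π * x then res h.choose else 0

/-- The residue class of `x`, for a unit `y = s u * (1 + π x)`. -/
def unitLog (π : S) (res : S →+* E) (s : E →*₀ S) (y : S) : E :=
  -- If y = s(u) + πx, the second factor of y is 1 + π x/s(u), whence the division. For a non-unit
  -- the quotient by 0 gives 0.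
  divUnif π res (y - s (res y)) / res y

namespace IsLengthTwo

variable {π : S} {res : S →+* E} (h : IsLengthTwo π res)
include h

theorem res_unif : res π = 0 := (h.res_eq_zero_iff π).2 ⟨1, by simp⟩

theorem unif_mul_unif : π * π = 0 := (h.mul_eq_zero_iff π).2 h.res_unif

theorem unif_mul_eq_iff {x y : S} : π * x = π * y ↔ res x = res y := by
  rw [← sub_eq_zero, ← mul_sub, h.mul_eq_zero_iff, map_sub, sub_eq_zero]

theorem exists_eq_add {x y : S} (hxy : res x = res y) : ∃ c, x = y + π * c := by
  obtain ⟨c, hc⟩ := (h.res_eq_zero_iff (x - y)).1 (by rw [map_sub, hxy, sub_self])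
  exact ⟨c, by rw [← hc]; ring⟩

/-- The chosen quotient is determined up to the annihilator of π, which is the kernel of `res`. -/
theorem divUnif_mul (x : S) : divUnif π res (π * x) = res x := by
  have hx : ∃ y, π * x = π * y := ⟨x, rfl⟩
  rw [divUnif, dif_pos hx]
  exact (h.unif_mul_eq_iff.1 hx.choose_spec).symm

theorem isUnit_iff (y : S) : IsUnit y ↔ res y ≠ 0 := by
  refine ⟨fun hy => (hy.map res).ne_zero, fun hy => ?_⟩
  obtain ⟨z, hz⟩ := h.surjective (res y)⁻¹
  obtain ⟨c, hc⟩ := h.exists_eq_add (x := y * z) (y := 1) (by simp [hz, hy])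
  -- Here yz = 1 + πc, whose inverse is 1 - πc because π² = 0.
  refine IsUnit.of_mul_eq_one (z * (1 - π * c)) ?_
  linear_combination (1 - π * c) * hc - c * c * h.unif_mul_unif

omit h in
theorem pow_sub_pow_eq (p : ℕ) (y z : S) :
    y ^ p - z ^ p = (∑ i ∈ Finset.range p, y ^ i * z ^ (p - 1 - i)) * (y - z) :=
  ((Commute.all y z).geom_sum₂_mul p).symm

/-- In y^p - z^p = (Σ y^i z^(p-1-i))(y - z) both factors are multiples of π, since the sum reduces
to p z̄^(p-1) = 0; and π² = 0. -/
theorem pow_char_eq (p : ℕ) [CharP E p] {y z : S} (hyz : res y = res z) : y ^ p = z ^ p := by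
  rw [← sub_eq_zero, pow_sub_pow_eq]
  obtain ⟨c, hc⟩ := h.exists_eq_add hyz
  have h0 : res (∑ i ∈ Finset.range p, y ^ i * z ^ (p - 1 - i)) = 0 := by
    rw [map_sum, Finset.sum_congr rfl (g := fun _ => res z ^ (p - 1))]
    · simp
    · intro i hi
      rw [map_mul, map_pow, map_pow, hyz, ← pow_add]
      congr 1
      have := Finset.mem_range.1 hi
      omega
  obtain ⟨d, hd⟩ := (h.res_eq_zero_iff _).1 h0
  rw [hd, hc]
  linear_combination d * c * h.unif_mul_unif

theorem pow_card_eq [Finite E] {y z : S} (hyz : res y = res z) :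
    y ^ Nat.card E = z ^ Nat.card E := by
  have := Fintype.ofFinite E
  obtain ⟨p, hp⟩ := CharP.exists E
  obtain ⟨n, hp', hn⟩ := FiniteField.card E p
  obtain ⟨m, hm⟩ := Nat.exists_eq_succ_of_ne_zero n.ne_zero
  rw [Nat.card_eq_fintype_card, hn, hm, pow_succ', pow_mul, pow_mul, h.pow_char_eq p hyz]

/-- The multiplicative section of the residue map. -/
theorem exists_section [Finite E] : ∃ s : E →*₀ S, ∀ x, res (s x) = x := by
  have := Fintype.ofFinite E
  choose l hl using h.surjective
  -- The Teichmüller lift: with q the order of E, the q-th power of a lift does not depend on the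
  -- lift, and is therefore multiplicative.
  refine ⟨{ toFun := fun x => l x ^ Nat.card E, map_zero' := ?_, map_one' := ?_, map_mul' := ?_ },
    fun x => ?_⟩
  · rw [h.pow_card_eq (z := 0) (by rw [hl, map_zero]), zero_pow Nat.card_pos.ne']
  · rw [h.pow_card_eq (z := 1) (by rw [hl, map_one]), one_pow]
  · intro x y
    rw [h.pow_card_eq (z := l x * l y) (by rw [map_mul, hl, hl, hl]), mul_pow]
  · simp only [MonoidWithZeroHom.coe_mk, ZeroHom.coe_mk, map_pow, hl]
    rw [Nat.card_eq_fintype_card, FiniteField.pow_card]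

/-- Since u^q = u, also s(u) = s(u)^q, and q-th powers depend on residues only. So there is just one
multiplicative section, and ring homomorphisms must respect it. -/
theorem section_eq_of_res_eq [Finite E] {s : E →*₀ S} (hs : ∀ x, res (s x) = x) {u : E} {y : S}
    (hy : res y = u) : s u = y ^ Nat.card E := by
  have := Fintype.ofFinite E
  rw [h.pow_card_eq (z := s u) (by rw [hs, hy]), ← map_pow, Nat.card_eq_fintype_card,
    FiniteField.pow_card]

section
variable {s : E →*₀ S} (hs : ∀ x, res (s x) = x)
include hs

theorem exists_eq_section_add (y : S) : ∃ x, y = s (res y) + π * x :=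
  h.exists_eq_add (hs _).symm

theorem exists_eq_section_mul {y : S} (hy : res y ≠ 0) : ∃ x, y = s (res y) * (1 + π * x) := by
  obtain ⟨x, hx⟩ := h.exists_eq_section_add hs y
  refine ⟨s (res y)⁻¹ * x, ?_⟩
  have h1 : s (res y) * s (res y)⁻¹ = 1 := by rw [← map_mul, mul_inv_cancel₀ hy, map_one]
  nth_rw 1 [hx]
  linear_combination -(π * x) * h1

/-- For u = 0 both sides are quotients by 0. This is why `map_unitLog` can be stated for all y. -/
theorem unitLog_section_add (u : E) (x : S) :
    unitLog π res s (s u + π * x) = res x / u := by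
  have h0 : res (s u + π * x) = u := by simp [hs, h.res_unif]
  rw [unitLog, h0, add_sub_cancel_left, h.divUnif_mul]

theorem unitLog_section_mul {u : E} (hu : u ≠ 0) (x : S) :
    unitLog π res s (s u * (1 + π * x)) = res x := by
  have : s u * (1 + π * x) = s u + π * (s u * x) := by ring
  rw [this, h.unitLog_section_add hs, map_mul, hs, mul_div_cancel_left₀ _ hu]

theorem unitLog_section (u : E) : unitLog π res s (s u) = 0 := by
  simpa using h.unitLog_section_add hs u 0

theorem unitLog_one_add (x : S) : unitLog π res s (1 + π * x) = res x := by
  simpa using h.unitLog_section_mul hs one_ne_zero x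

theorem unitLog_mul {y z : S} (hy : res y ≠ 0) (hz : res z ≠ 0) :
    unitLog π res s (y * z) = unitLog π res s y + unitLog π res s z := by
  obtain ⟨a, ha⟩ := h.exists_eq_section_mul hs hy
  obtain ⟨b, hb⟩ := h.exists_eq_section_mul hs hz
  have hab : y * z = s (res y * res z) * (1 + π * (a + b)) := by
    rw [map_mul]
    nth_rw 1 [ha, hb]
    linear_combination s (res y) * s (res z) * a * b * h.unif_mul_unif
  rw [hab, h.unitLog_section_mul hs (mul_ne_zero hy hz), ha, hb, h.unitLog_section_mul hs hy,
    h.unitLog_section_mul hs hz, map_add]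

end

end IsLengthTwo

/-! ### Functoriality of unramified extensions -/

variable {S' E' : Type*} [CommRing S'] [Field E'] {π : S} {res : S →+* E} {π' : S'}
  {res' : S' →+* E'}

/-- The defect of additivity of the section `s`. -/
def addDefect (π : S) (res : S →+* E) (s : E →*₀ S) (a b : E) : E :=
  divUnif π res (s a + s b - s (a + b))

namespace IsLengthTwo

theorem section_add_section (h : IsLengthTwo π res) {s : E →*₀ S} (hs : ∀ x, res (s x) = x)
    (a b : E) (c : S) (hc : res c = addDefect π res s a b) :
    s a + s b = s (a + b) + π * c := by
  obtain ⟨d, hd⟩ := h.exists_eq_add (x := s a + s b) (y := s (a + b)) (by simp [hs])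
  rw [hd, add_right_inj, h.unif_mul_eq_iff, hc, addDefect, hd, add_sub_cancel_left, h.divUnif_mul]

/-- As p-th powers depend on residues only, s(a^p + b^p) = (s a + s b)^p. The binomial theorem then
gives the defect as a universal integral polynomial in a and b times the residue of d = p/π, the
only datum of the ring that enters. -/
theorem addDefect_pow (h : IsLengthTwo π res) {s : E →*₀ S} (hs : ∀ x, res (s x) = x)
    {p : ℕ} (hp : p.Prime) [CharP E p] {d : S} (hd : (p : S) = π * d) (a b : E) :
    addDefect π res s (a ^ p) (b ^ p) =
      - (res d * (a * b * ∑ k ∈ Finset.Ioo 0 p, a ^ (k - 1) * b ^ (p - k - 1) * ↑(p.choose k / p))) := by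
  have := Fact.mk hp
  have h1 : s (a ^ p + b ^ p) = (s a + s b) ^ p := by
    rw [← add_pow_char, map_pow]
    exact h.pow_char_eq p (by simp [hs])
  have h2 : s (a ^ p) + s (b ^ p) - s (a ^ p + b ^ p) =
      π * -(d * (s a * s b * ∑ k ∈ Finset.Ioo 0 p, s a ^ (k - 1) * s b ^ (p - k - 1) * ↑(p.choose k / p))) := by
    rw [h1, add_pow_prime_eq hp, hd, map_pow, map_pow]
    ring
  rw [addDefect, h2, h.divUnif_mul]
  simp [hs]

variable {R k : Type*} [CommRing R] [Field k] {ϖ : R} {resR : R →+* k}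

/-- A finite field is perfect, so a and b are p-th powers and `addDefect_pow` applies. The quotient
p/π can be taken in the base ring, so τ fixes its residue. -/
theorem map_addDefect (hR : IsLengthTwo ϖ resR) [Algebra k E] [Algebra k E'] [Finite E]
    {ι : R →+* S} {ι' : R →+* S'}
    (h : IsLengthTwo (ι ϖ) res) (h' : IsLengthTwo (ι' ϖ) res')
    {s : E →*₀ S} (hs : ∀ x, res (s x) = x) {s' : E' →*₀ S'} (hs' : ∀ x, res' (s' x) = x)
    (hι : ∀ x, res (ι x) = algebraMap k E (resR x))
    (hι' : ∀ x, res' (ι' x) = algebraMap k E' (resR x)) (τ : E →ₐ[k] E') (a b : E) :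
    τ (addDefect (ι ϖ) res s a b) = addDefect (ι' ϖ) res' s' (τ a) (τ b) := by
  obtain ⟨p, hp⟩ := CharP.exists E
  have hpp : p.Prime := (CharP.char_is_prime_or_zero E p).resolve_right
    (CharP.char_ne_zero_of_finite E p)
  have := Fact.mk hpp
  have : CharP E' p := charP_of_injective_ringHom τ.toRingHom.injective p
  have hk : resR (p : R) = 0 := by
    apply (algebraMap k E).injective
    simp
  obtain ⟨d, hd⟩ := (hR.res_eq_zero_iff _).1 hk
  obtain ⟨a, rfl⟩ := (frobeniusEquiv E p).surjective a
  obtain ⟨b, rfl⟩ := (frobeniusEquiv E p).surjective b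
  simp only [frobeniusEquiv_apply, frobenius_def]
  rw [map_pow, map_pow, h.addDefect_pow hs hpp (d := ι d) (by rw [← map_mul, ← hd, map_natCast]),
    h'.addDefect_pow hs' hpp (d := ι' d) (by rw [← map_mul, ← hd, map_natCast])]
  simp [hι, hι']

theorem map_section {sR : k →*₀ R} (hsR : ∀ x, resR (sR x) = x)
    [Algebra k E] [Finite E] {ι : R →+* S} (h : IsLengthTwo (ι ϖ) res) {s : E →*₀ S}
    (hs : ∀ x, res (s x) = x) (hι : ∀ x, res (ι x) = algebraMap k E (resR x)) (u : k) :
    ι (sR u) = s (algebraMap k E u) := by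
  have := Fintype.ofFinite E
  rw [h.section_eq_of_res_eq hs (y := ι (sR u)) (by rw [hι, hsR]), ← map_pow, ← map_pow]
  congr 2
  apply (algebraMap k E).injective
  rw [map_pow, Nat.card_eq_fintype_card, FiniteField.pow_card]

/-- An embedding of residue fields lifts to a homomorphism of unramified extensions. -/
theorem exists_lift (hR : IsLengthTwo ϖ resR) [Algebra k E] [Algebra k E'] [Finite E] [Finite E']
    {ι : R →+* S} {ι' : R →+* S'}
    (h : IsLengthTwo (ι ϖ) res) (h' : IsLengthTwo (ι' ϖ) res')
    {s : E →*₀ S} (hs : ∀ x, res (s x) = x) {s' : E' →*₀ S'} (hs' : ∀ x, res' (s' x) = x)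
    (hι : ∀ x, res (ι x) = algebraMap k E (resR x))
    (hι' : ∀ x, res' (ι' x) = algebraMap k E' (resR x)) (τ : E →ₐ[k] E') :
    ∃ θ : S →+* S', (∀ r, θ (ι r) = ι' r) ∧ (∀ x, res' (θ x) = τ (res x)) ∧
      ∀ u, θ (s u) = s' (τ u) := by
  have : Finite k := Finite.of_injective _ (algebraMap k E).injective
  -- The lift is forced: s(u) + πx must go to s'(τ u) + πx' with x' above τ(x̄). Any such x' gives
  -- the same element; s' provides one.
  let F : S → S' := fun y => s' (τ (res y)) + ι' ϖ * s' (τ (divUnif (ι ϖ) res (y - s (res y))))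
  have hF : ∀ u x x', res' x' = τ (res x) → F (s u + ι ϖ * x) = s' (τ u) + ι' ϖ * x' := by
    intro u x x' hx
    have h0 : res (s u + ι ϖ * x) = u := by simp [hs, h.res_unif]
    simp only [F, h0, add_sub_cancel_left, h.divUnif_mul]
    rw [add_right_inj, h'.unif_mul_eq_iff, hs', hx]
  have hFs : ∀ u, F (s u) = s' (τ u) := fun u => by simpa using hF u 0 0 (by simp)
  have hFι : ∀ r, F (ι r) = ι' r := by
    obtain ⟨sR, hsR⟩ := hR.exists_section
    intro r
    obtain ⟨x, hx⟩ := hR.exists_eq_section_add hsR r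
    rw [hx, map_add, map_mul, h.map_section hsR hs hι, hF _ _ (ι' x) (by rw [hι, hι', τ.commutes]),
      map_add, map_mul, h'.map_section hsR hs' hι', τ.commutes]
  have hadd : ∀ y z, F (y + z) = F y + F z := by
    intro y z
    obtain ⟨a, ha⟩ := h.exists_eq_section_add hs y
    obtain ⟨b, hb⟩ := h.exists_eq_section_add hs z
    obtain ⟨a', ha'⟩ := h'.surjective (τ (res a))
    obtain ⟨b', hb'⟩ := h'.surjective (τ (res b))
    obtain ⟨c, hc⟩ := h.surjective (addDefect (ι ϖ) res s (res y) (res z))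
    obtain ⟨c', hc'⟩ := h'.surjective (τ (res c))
    have h1 : y + z = s (res y + res z) + ι ϖ * (a + b + c) := by
      linear_combination ha + hb + h.section_add_section hs _ _ c hc
    rw [h1, hF _ _ (a' + b' + c') (by simp [ha', hb', hc']), ha, hF _ _ a' ha', hb, hF _ _ b' hb',
      ← ha, ← hb, map_add]
    -- Additivity comes down to τ preserving the additive defects of the two sections.
    have h2 := h'.section_add_section hs' (τ (res y)) (τ (res z)) c' (by
      rw [hc', hc, hR.map_addDefect h h' hs hs' hι hι'])
    linear_combination -h2
  have hmul : ∀ y z, F (y * z) = F y * F z := by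
    intro y z
    obtain ⟨a, ha⟩ := h.exists_eq_section_add hs y
    obtain ⟨b, hb⟩ := h.exists_eq_section_add hs z
    obtain ⟨a', ha'⟩ := h'.surjective (τ (res a))
    obtain ⟨b', hb'⟩ := h'.surjective (τ (res b))
    have h1 : y * z = s (res y * res z) + ι ϖ * (s (res y) * b + s (res z) * a) := by
      rw [map_mul]
      nth_rw 1 [ha, hb]
      linear_combination a * b * h.unif_mul_unif
    rw [h1, hF _ _ (s' (τ (res y)) * b' + s' (τ (res z)) * a') (by simp [ha', hb', hs, hs']),
      ha, hF _ _ a' ha', hb, hF _ _ b' hb', ← ha, ← hb, map_mul, map_mul]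
    linear_combination -a' * b' * h'.unif_mul_unif
  refine ⟨{ toFun := F, map_one' := ?_, map_zero' := ?_, map_add' := hadd, map_mul' := hmul },
    hFι, ?_, hFs⟩
  · simpa using hFs 1
  · simpa using hFs 0
  · intro x
    obtain ⟨a, ha⟩ := h.exists_eq_section_add hs x
    obtain ⟨a', ha'⟩ := h'.surjective (τ (res a))
    simp only [RingHom.coe_mk, MonoidHom.coe_mk, OneHom.coe_mk]
    rw [ha, hF _ _ a' ha', ← ha]
    simp [hs', h'.res_unif]

theorem map_unitLog {θ : S →+* S'} {τ : E →+* E'} (h : IsLengthTwo π res)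
    (h' : IsLengthTwo (θ π) res') {s : E →*₀ S} (hs : ∀ x, res (s x) = x) {s' : E' →*₀ S'}
    (hs' : ∀ x, res' (s' x) = x) (hθ : ∀ x, res' (θ x) = τ (res x))
    (hθs : ∀ u, θ (s u) = s' (τ u)) (y : S) :
    unitLog (θ π) res' s' (θ y) = τ (unitLog π res s y) := by
  obtain ⟨x, hx⟩ := h.exists_eq_section_add hs y
  rw [hx, map_add, map_mul, hθs, h'.unitLog_section_add hs', h.unitLog_section_add hs, hθ,
    map_div₀]

end IsLengthTwo

end LengthTwo

end

noncomputable section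

/-! ### Existence of unramified extensions -/

section Unramified

open Polynomial

variable {R k : Type*} [CommRing R] [Field k] {π : R} {res : R →+* k}

namespace IsLengthTwo

theorem exists_eq_C_mul (h : IsLengthTwo π res) {P : R[X]} (hP : P.map res = 0) :
    ∃ Q, P = C π * Q := by
  have h1 : ∀ i, ∃ y, P.coeff i = π * y := fun i =>
    (h.res_eq_zero_iff _).1 (by rw [← coeff_map, hP, coeff_zero])
  have h2 : P ∈ Ideal.map (C : R →+* R[X]) (Ideal.span {π}) :=
    Ideal.mem_map_C_iff.2 fun i => Ideal.mem_span_singleton'.2 (by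
      obtain ⟨y, hy⟩ := h1 i
      exact ⟨y, by rw [hy, mul_comm]⟩)
  rw [Ideal.map_span, Set.image_singleton] at h2
  obtain ⟨Q, hQ⟩ := Ideal.mem_span_singleton'.1 h2
  exact ⟨Q, by rw [← hQ, mul_comm]⟩

theorem C_mul_eq_zero_iff (h : IsLengthTwo π res) (P : R[X]) : C π * P = 0 ↔ P.map res = 0 := by
  simp only [Polynomial.ext_iff, coeff_C_mul, coeff_zero, coeff_map, h.mul_eq_zero_iff]

/-- If `f` is a monic lift of the minimal polynomial of a primitive element, `R[X] / (f)` is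
a ring of length two. -/
theorem adjoinRoot (h : IsLengthTwo π res) {E : Type*} [Field E] [Algebra k E]
    {α : E} (hα : Algebra.adjoin k {α} = ⊤) {f : R[X]} (hf : f.Monic)
    (hfm : f.map res = minpoly k α) (h0 : f.eval₂ ((algebraMap k E).comp res) α = 0) :
    IsLengthTwo (AdjoinRoot.of f π) (AdjoinRoot.lift ((algebraMap k E).comp res) α h0) := by
  have hlift : ∀ P : R[X], AdjoinRoot.lift ((algebraMap k E).comp res) α h0 (AdjoinRoot.mk f P) =
      aeval α (P.map res) := fun P => by
    rw [AdjoinRoot.lift_mk, ← eval₂_map, aeval_def]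
  have hnt : Nontrivial R := h.surjective.nontrivial
  refine ⟨fun x => ?_, fun x => ?_, fun x => ?_⟩
  · have hx : x ∈ Algebra.adjoin k {α} := hα ▸ trivial
    obtain ⟨p, rfl⟩ := Algebra.adjoin_singleton_eq_range_aeval k α ▸ hx
    obtain ⟨P, rfl⟩ := map_surjective res h.surjective p
    exact ⟨AdjoinRoot.mk f P, hlift P⟩
  · obtain ⟨P, rfl⟩ := AdjoinRoot.mk_surjective x
    rw [hlift]
    constructor
    · intro hP
      obtain ⟨q, hq⟩ := (minpoly.dvd k α hP)
      obtain ⟨Q, rfl⟩ := map_surjective res h.surjective q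
      obtain ⟨T, hT⟩ := h.exists_eq_C_mul (P := P - f * Q) (by
        rw [Polynomial.map_sub, Polynomial.map_mul, hfm, hq, sub_self])
      refine ⟨AdjoinRoot.mk f T, ?_⟩
      have := congrArg (AdjoinRoot.mk f) hT
      rwa [map_sub, map_mul, AdjoinRoot.mk_self, zero_mul, sub_zero, map_mul,
        AdjoinRoot.mk_C] at this
    · rintro ⟨y, hy⟩
      obtain ⟨Q, rfl⟩ := AdjoinRoot.mk_surjective y
      rw [← hlift, hy, map_mul, AdjoinRoot.lift_of, RingHom.comp_apply, h.res_unif, map_zero,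
        zero_mul]
  · constructor
    · obtain ⟨P, rfl⟩ := AdjoinRoot.mk_surjective x
      have hmod : AdjoinRoot.mk f P = AdjoinRoot.mk f (P %ₘ f) := by
        rw [AdjoinRoot.mk_eq_mk]
        exact ⟨P /ₘ f, by rw [sub_eq_iff_eq_add', modByMonic_add_div]⟩
      rw [hmod, hlift, ← AdjoinRoot.mk_C, ← map_mul, AdjoinRoot.mk_eq_zero]
      intro hd
      -- A nonzero multiple of the monic f cannot have smaller degree than f.
      have hz : C π * (P %ₘ f) = 0 := by
        by_contra hne
        refine hf.not_dvd_of_degree_lt hne ?_ hd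
        rw [← smul_eq_C_mul]
        exact (degree_smul_le _ _).trans_lt (degree_modByMonic_lt P hf)
      rw [(h.C_mul_eq_zero_iff _).1 hz, map_zero]
    · obtain ⟨P, rfl⟩ := AdjoinRoot.mk_surjective x
      rw [hlift]
      intro hP
      obtain ⟨q, hq⟩ := (minpoly.dvd k α hP)
      obtain ⟨Q, rfl⟩ := map_surjective res h.surjective q
      have h1 : C π * (P - f * Q) = 0 := (h.C_mul_eq_zero_iff _).2 (by
        rw [Polynomial.map_sub, Polynomial.map_mul, hfm, hq, sub_self])
      have := congrArg (AdjoinRoot.mk f) h1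
      rwa [map_mul, map_sub, map_mul, AdjoinRoot.mk_self, zero_mul, sub_zero, map_zero,
        AdjoinRoot.mk_C] at this

theorem map_equiv {S E : Type*} [CommRing S] [Field E] {π : S} {res : S →+* E}
    (h : IsLengthTwo π res) {T : Type*} [CommRing T] (e : S ≃+* T) :
    IsLengthTwo (e π) (res.comp e.symm.toRingHom) where
  surjective := h.surjective.comp e.symm.surjective
  res_eq_zero_iff x := by
    refine (h.res_eq_zero_iff (e.symm x)).trans ⟨fun ⟨y, hy⟩ => ⟨e y, ?_⟩, fun ⟨y, hy⟩ => ⟨e.symm y, ?_⟩⟩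
    · rw [← map_mul, ← hy, e.apply_symm_apply]
    · rw [hy, map_mul, e.symm_apply_apply]
  mul_eq_zero_iff x := by
    refine Iff.trans ?_ (h.mul_eq_zero_iff (e.symm x))
    rw [← e.symm.map_eq_zero_iff, map_mul, e.symm_apply_apply]

theorem nonempty_unramifiedExt (h : IsLengthTwo π res) [Finite R] (E : Type) [Field E] [Finite E]
    [Algebra k E] : Nonempty (UnramifiedExt π res E) := by
  have : Finite k := Finite.of_surjective _ h.surjective
  obtain ⟨α, hα⟩ := Field.exists_primitive_element k E
  have hint : IsIntegral k α := Algebra.IsIntegral.isIntegral α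
  have hα' : Algebra.adjoin k {α} = ⊤ := by
    have := IntermediateField.adjoin_simple_toSubalgebra_of_isAlgebraic hint.isAlgebraic
    rw [← this, hα]
    rfl
  obtain ⟨f, hfm, -, hf⟩ := lifts_and_natDegree_eq_and_monic (f := res) (p := minpoly k α) (by
    rw [lifts_iff_coeff_lifts]
    exact fun i => h.surjective _) (minpoly.monic hint)
  have h0 : f.eval₂ ((algebraMap k E).comp res) α = 0 := by
    rw [← eval₂_map, hfm, ← aeval_def, minpoly.aeval]
  have hS := h.adjoinRoot hα' hf hfm h0
  have : Module.Finite R (AdjoinRoot f) := hf.finite_adjoinRoot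
  have : Finite (AdjoinRoot f) := Module.finite_of_finite R
  -- `UnramifiedExt` asks for a ring in the lowest universe; the finite ring R[X]/(f) has a copy
  -- there.
  let e := (Shrink.ringEquiv.{0} (AdjoinRoot f)).symm
  have hT := hS.map_equiv e
  obtain ⟨s, hs⟩ := hT.exists_section
  exact ⟨{  S := Shrink.{0} (AdjoinRoot f)
            ι := e.toRingHom.comp (AdjoinRoot.of f)
            resS := _
            isLengthTwo := hT
            resS_ι := fun x => by simp
            s := s
            resS_s := hs }⟩

end IsLengthTwo

end Unramified

end

noncomputable section

open Matrix

/-! ### Intertwiners of Jordan forms -/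

section Jordan

variable {n : ℕ} {E : Type*} [Field E] {T : Type*} [CommRing T]

namespace IsJordanForm

variable {J J₁ J₂ : Matrix (Fin n) (Fin n) E} {a a₁ a₂ : Fin n → E}

theorem eq_of_ne_zero (hJ : IsJordanForm J a) {i k : Fin n} (hik : i ≠ k) (h : J i k ≠ 0) :
    (k : ℕ) = i + 1 ∧ a i = a k := by
  have h1 : (k : ℕ) = i + 1 := by
    by_contra h1
    exact h (hJ.2.2 i k hik.symm h1)
  exact ⟨h1, ((hJ.2.1 i k h1).resolve_left h).2⟩

/-- An intertwiner of two Jordan forms is block diagonal. -/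
theorem intertwiner_apply_eq_zero (h₁ : IsJordanForm J₁ a₁) (h₂ : IsJordanForm J₂ a₂)
    {s : E →*₀ T} (hs : ∀ x y, x ≠ y → IsUnit (s x - s y)) {b : E} {w : Matrix (Fin n) (Fin n) T}
    (hw : J₂.map s * w = s b • (w * J₁.map s)) (i j : Fin n) (hij : a₂ i ≠ b * a₁ j) :
    w i j = 0 := by
  -- Entry (i, j) of the relation expresses (s(a₂ i) - s(b a₁ j)) w i j through w (i+1) j and w i
  -- (j-1). Both have smaller measure, and a nonzero superdiagonal coefficient forces the same
  -- eigenvalue, so the induction hypothesis kills them. The difference in front is a unit.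
  induction hm : (j : ℕ) + (n - i) using Nat.strong_induction_on generalizing i j with
  | _ m ih =>
    have e := congrFun (congrFun hw i) j
    rw [Matrix.smul_apply, mul_apply, mul_apply, Finset.sum_eq_single i, Finset.sum_eq_single j] at e
    · rw [map_apply, map_apply, h₁.1, h₂.1, smul_eq_mul] at e
      have e' : (s (a₂ i) - s (b * a₁ j)) * w i j = 0 := by
        rw [map_mul]
        linear_combination e
      exact ((hs _ _ hij).mul_right_eq_zero).1 e'
    · intro k _ hk
      rw [map_apply]
      by_cases h0 : J₁ k j = 0
      · simp [h0]
      · obtain ⟨h3, h4⟩ := h₁.eq_of_ne_zero hk h0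
        rw [ih _ (by omega) i k (h4 ▸ hij) rfl, zero_mul]
    · simp
    · intro k _ hk
      rw [map_apply]
      by_cases h0 : J₂ i k = 0
      · simp [h0]
      · obtain ⟨h3, h4⟩ := h₂.eq_of_ne_zero hk.symm h0
        rw [ih _ (by omega) k j (h4 ▸ hij) rfl, mul_zero]
    · simp

theorem apply_eq_zero_of_intertwiner (h₁ : IsJordanForm J₁ a₁) (h₂ : IsJordanForm J₂ a₂)
    {b : E} {w : Matrix (Fin n) (Fin n) E} (hw : J₂ * w = b • (w * J₁)) (i j : Fin n)
    (hij : a₂ i ≠ b * a₁ j) : w i j = 0 :=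
  h₁.intertwiner_apply_eq_zero h₂ (s := MonoidWithZeroHom.id E)
    (fun _ _ hxy => (sub_ne_zero.2 hxy).isUnit) hw i j hij

/-- The section s is not additive, but it respects sums with at most one nonzero term, and Jordan
forms produce no others once the diagonal terms are cancelled. -/
theorem map_sum_of_subsingleton (s : E →*₀ T) {ι : Type*} (t : Finset ι) (f : ι → E)
    (hf : ∀ k ∈ t, ∀ l ∈ t, f k ≠ 0 → f l ≠ 0 → k = l) :
    s (∑ k ∈ t, f k) = ∑ k ∈ t, s (f k) := by
  by_cases h : ∃ k ∈ t, f k ≠ 0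
  · obtain ⟨k, hk, hk0⟩ := h
    have h0 : ∀ l ∈ t, l ≠ k → f l = 0 := fun l hl hlk => by
      by_contra h
      exact hlk (hf l hl k hk h hk0)
    rw [Finset.sum_eq_single_of_mem k hk h0, Finset.sum_eq_single_of_mem k hk]
    intro l hl hlk
    rw [h0 l hl hlk, map_zero]
  · push Not at h
    rw [Finset.sum_eq_zero h, Finset.sum_eq_zero, map_zero]
    intro k hk
    rw [h k hk, map_zero]

/-- The entrywise lift of an intertwiner of Jordan forms by a multiplicative section is an
intertwiner of the lifted Jordan forms. -/
theorem map_intertwiner (h₁ : IsJordanForm J₁ a₁) (h₂ : IsJordanForm J₂ a₂)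
    (s : E →*₀ T) {b : E} {w : Matrix (Fin n) (Fin n) E} (hw : J₂ * w = b • (w * J₁)) :
    J₂.map s * w.map s = s b • (w.map s * J₁.map s) := by
  have hd := h₁.apply_eq_zero_of_intertwiner h₂ hw
  ext i j
  have e := congrFun (congrFun hw i) j
  -- The diagonal terms agree on both sides and can be removed. What is left has at most one nonzero
  -- term on each side (k = i + 1, respectively k = j - 1), so s passes through the sums.
  have hdiag : J₂ i i * w i j = b * (w i j * J₁ j j) := by
    rw [h₁.1, h₂.1]
    by_cases hij : a₂ i = b * a₁ j
    · rw [hij]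
      ring
    · rw [hd i j hij]
      ring
  simp only [Matrix.smul_apply, mul_apply, map_apply, smul_eq_mul, Finset.mul_sum] at e ⊢
  rw [← Finset.add_sum_erase _ _ (Finset.mem_univ i),
    ← Finset.add_sum_erase (a := j) _ _ (Finset.mem_univ j), hdiag, add_right_inj] at e
  rw [← Finset.add_sum_erase _ _ (Finset.mem_univ i),
    ← Finset.add_sum_erase (a := j) _ _ (Finset.mem_univ j)]
  simp only [← map_mul]
  rw [hdiag, add_right_inj, ← map_sum_of_subsingleton, ← map_sum_of_subsingleton, e]
  · intro k hk l hl hk0 hl0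
    have h1 := h₁.eq_of_ne_zero (Finset.ne_of_mem_erase hk)
      (right_ne_zero_of_mul (right_ne_zero_of_mul hk0))
    have h2 := h₁.eq_of_ne_zero (Finset.ne_of_mem_erase hl)
      (right_ne_zero_of_mul (right_ne_zero_of_mul hl0))
    exact Fin.ext (by omega)
  · intro k hk l hl hk0 hl0
    have h1 := h₂.eq_of_ne_zero (Finset.ne_of_mem_erase hk).symm (left_ne_zero_of_mul hk0)
    have h2 := h₂.eq_of_ne_zero (Finset.ne_of_mem_erase hl).symm (left_ne_zero_of_mul hl0)
    exact Fin.ext (by omega)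

theorem map_commute (h : IsJordanForm J a) (s : E →*₀ T) {w : Matrix (Fin n) (Fin n) E}
    (hw : w * J = J * w) : w.map s * J.map s = J.map s * w.map s := by
  simpa using (h.map_intertwiner h s (b := 1) (w := w) (by rw [one_smul, hw])).symm

theorem map {E' : Type*} [Field E'] (h : IsJordanForm J a) (τ : E →+* E') :
    IsJordanForm (J.map τ) (τ ∘ a) := by
  refine ⟨fun i => by simp [h.1], fun i j hij => ?_, fun i j hij hij' => by simp [h.2.2 i j hij hij']⟩
  rcases h.2.1 i j hij with h' | ⟨h', h''⟩ <;> simp [*]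

end IsJordanForm

end Jordan

/-! ### Block determinants -/

section BlockDet

variable {n : ℕ} {E : Type*} {T : Type*} [CommRing T]

open Classical in
/-- The projection to the coordinates with `a i = e`. -/
def eigProj (T : Type*) [CommRing T] (a : Fin n → E) (e : E) : Matrix (Fin n) (Fin n) T :=
  Matrix.diagonal fun i => if a i = e then 1 else 0

/-- The determinant of the diagonal block of `z` with index set `{i | a i = e}`. -/
def blockDet (a : Fin n → E) (e : E) (z : Matrix (Fin n) (Fin n) T) : T :=
  -- Completing the block by the identity keeps the index type, so that products and conjugation are
  -- plain matrix algebra.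
  (z * eigProj T a e + (1 - eigProj T a e)).det

variable {a a₁ a₂ : Fin n → E}

theorem eigProj_mul_self (e : E) : eigProj T a e * eigProj T a e = eigProj T a e := by
  rw [eigProj, diagonal_mul_diagonal]
  congr 1
  ext i
  split_ifs <;> simp

theorem eigProj_mul_intertwiner [Field E] {b : E} (hb : b ≠ 0) {w : Matrix (Fin n) (Fin n) T}
    (hw : ∀ i j, a₂ i ≠ b * a₁ j → w i j = 0) (e : E) :
    eigProj T a₂ (b * e) * w = w * eigProj T a₁ e := by
  ext i j
  rw [eigProj, eigProj, diagonal_mul, mul_diagonal]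
  by_cases hij : a₂ i = b * a₁ j
  · by_cases he : a₁ j = e
    · rw [if_pos he, if_pos (by rw [hij, he]), one_mul, mul_one]
    · rw [if_neg he, if_neg (by rwa [hij, mul_right_inj' hb]), zero_mul, mul_zero]
  · simp [hw i j hij]

/-- Let P be the projection. When z commutes with P, one has PzP = zP, and yzP + (1 - P) factors as
(yP + (1 - P))(zP + (1 - P)). -/
theorem blockDet_mul {e : E} {y z : Matrix (Fin n) (Fin n) T}
    (hz : eigProj T a e * z = z * eigProj T a e) :
    blockDet a e (y * z) = blockDet a e y * blockDet a e z := by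
  rw [blockDet, blockDet, blockDet, ← det_mul]
  congr 1
  have h := eigProj_mul_self (T := T) (a := a) e
  generalize eigProj T a e = P at *
  calc y * z * P + (1 - P) = y * z * P + (1 - P) - 0 - 0 + 0 := by simp
    _ = y * z * (P * P) + y * (z * P) - y * (z * (P * P)) + (P * z - P * (z * P))
        + (1 - P - P + P * P) := by
      have h3 : P * (z * P) = z * P := by rw [← mul_assoc, hz, mul_assoc, h]
      rw [h3, hz, h]
      noncomm_ring
    _ = (y * P + (1 - P)) * (z * P + (1 - P)) := by
      have h3 : P * (z * P) = z * P := by rw [← mul_assoc, hz, mul_assoc, h]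
      have h4 : (y * P + (1 - P)) * (z * P + (1 - P)) =
        y * (P * (z * P)) + y * P - y * (P * P) + z * P + 1 - P - P * (z * P) - P + P * P := by
          noncomm_ring
      rw [h4, h3, h, hz]
      noncomm_ring

theorem blockDet_one (e : E) : blockDet a e (1 : Matrix (Fin n) (Fin n) T) = 1 := by
  simp [blockDet]

/-- Because π² = 0, det(1 + πM) = 1 + π Tr M. -/
theorem blockDet_one_add {π : T} (hπ : π * π = 0) (e : E) (Y : Matrix (Fin n) (Fin n) T) :
    blockDet a e (1 + π • Y) = 1 + π * trace (Y * eigProj T a e) := by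
  have : (1 + π • Y) * eigProj T a e + (1 - eigProj T a e) = 1 + π • (Y * eigProj T a e) := by
    rw [add_mul, one_mul, smul_mul_assoc]
    abel
  rw [blockDet, this, det_one_add_smul, pow_two, hπ]
  ring

theorem blockDet_map {T' : Type*} [CommRing T'] (f : T →+* T') (e : E)
    (z : Matrix (Fin n) (Fin n) T) : blockDet a e (z.map f) = f (blockDet a e z) := by
  have : (eigProj T a e).map f = eigProj T' a e := by
    rw [eigProj, eigProj, diagonal_map (map_zero f)]
    congr 1
    ext i
    simp [apply_ite f]
  rw [blockDet, blockDet, f.map_det]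
  congr 1
  simp only [RingHom.mapMatrix_apply, Matrix.map_add _ (map_add f), Matrix.map_mul,
    Matrix.map_sub _ (map_sub f), Matrix.map_one _ (map_zero f) (map_one f), this]

theorem eigProj_comp [Field E] {E' : Type*} [Field E'] (τ : E →+* E') (e : E) :
    eigProj T (τ ∘ a) (τ e) = eigProj T a e := by
  rw [eigProj, eigProj]
  congr 1
  ext i
  by_cases h : a i = e
  · simp [h]
  · exact (if_neg fun h' => h (τ.injective h')).trans (if_neg h).symm

theorem blockDet_comp [Field E] {E' : Type*} [Field E'] (τ : E →+* E') (e : E)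
    (z : Matrix (Fin n) (Fin n) T) : blockDet (τ ∘ a) (τ e) z = blockDet a e z := by
  rw [blockDet, blockDet, eigProj_comp]

theorem blockDet_eq_one {e : E} (he : ∀ i, a i ≠ e) (z : Matrix (Fin n) (Fin n) T) :
    blockDet a e z = 1 := by
  have : eigProj T a e = 0 := by
    ext i j
    simp [eigProj, he, diagonal_apply]
  simp [blockDet, this]

/-- The matrix w carries the projection for e to the projection for be, so the whole matrix under
the determinant is conjugated by w. -/
theorem blockDet_conj [Field E] {b : E} (hb : b ≠ 0) {w w' : Matrix (Fin n) (Fin n) T}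
    (hw : ∀ i j, a₂ i ≠ b * a₁ j → w i j = 0) (hww' : w * w' = 1) (e : E)
    (z : Matrix (Fin n) (Fin n) T) :
    blockDet a₂ (b * e) (w * z * w') = blockDet a₁ e z := by
  have h1 := eigProj_mul_intertwiner hb hw e
  have h2 : w' * w = 1 := mul_eq_one_comm.1 hww'
  have h3 : w' * eigProj T a₂ (b * e) = eigProj T a₁ e * w' := by
    calc _ = w' * (eigProj T a₂ (b * e) * w) * w' := by
            rw [mul_assoc w', mul_assoc (eigProj _ _ _), hww', mul_one]
      _ = _ := by rw [h1, ← mul_assoc, h2, one_mul]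
  have h4 : w * z * w' * eigProj T a₂ (b * e) + (1 - eigProj T a₂ (b * e)) =
      w * (z * eigProj T a₁ e + (1 - eigProj T a₁ e)) * w' := by
    have h5 : w * (eigProj T a₁ e) * w' = eigProj T a₂ (b * e) := by
      rw [← h1, mul_assoc, hww', mul_one]
    rw [mul_assoc _ w', h3, mul_add, add_mul, mul_sub, sub_mul, h5, mul_one, hww']
    simp only [mul_assoc]
  rw [blockDet, h4, det_mul, det_mul, mul_right_comm, ← det_mul, hww', det_one, one_mul, blockDet]

-- Links the projection form to the submatrices used in `IsConstructed`: zP + (1 - P) is block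
-- triangular with diagonal blocks z_e and 1.
open Classical in
theorem blockDet_eq_det_toSquareBlock {e : E} {z : Matrix (Fin n) (Fin n) T}
    (hz : eigProj T a e * z = z * eigProj T a e) :
    blockDet a e z = (z.toSquareBlock a e).det := by
  have h0 : ∀ i j, a i ≠ e → a j = e → z i j = 0 := by
    intro i j hi hj
    have := congrFun (congrFun hz i) j
    simpa [eigProj, diagonal_mul, mul_diagonal, hi, hj] using this.symm
  rw [blockDet, twoBlockTriangular_det _ (fun i => a i = e)]
  · have h1 : toSquareBlockProp (z * eigProj T a e + (1 - eigProj T a e)) (fun i => ¬ a i = e) = 1 := by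
      ext ⟨i, hi⟩ ⟨j, hj⟩
      simp [toSquareBlockProp, eigProj, hi, hj, mul_diagonal, diagonal_apply, one_apply]
    have h2 : toSquareBlockProp (z * eigProj T a e + (1 - eigProj T a e)) (fun i => a i = e)
        = z.toSquareBlock a e := by
      ext ⟨i, hi⟩ ⟨j, hj⟩
      simp [toSquareBlockProp, toSquareBlock, eigProj, hi, hj, mul_diagonal, diagonal_apply,
        one_apply]
    rw [h1, h2, det_one, mul_one]
  · intro i hi j hj
    have hij : i ≠ j := by
      rintro rfl
      exact hi hj
    simp [eigProj, hj, hij, mul_diagonal, h0 i j hi hj, one_apply]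

-- X is block diagonal, so it commutes with the diagonal part of J and hence with the nilpotent
-- part. The product of the nilpotent part with X is nilpotent and has trace 0.
open Classical in
theorem trace_mul_of_commute [Field E] {J X : Matrix (Fin n) (Fin n) E} (hJ : IsJordanForm J a)
    (hX : X * J = J * X) :
    trace (J * X) = ∑ e ∈ Finset.univ.image a, e * trace (X * eigProj E a e) := by
  have hd := hJ.apply_eq_zero_of_intertwiner hJ (b := 1) (w := X) (by rw [one_smul, hX])
  have hcD : diagonal a * X = X * diagonal a := by
    ext i j
    rw [diagonal_mul, mul_diagonal]
    by_cases hij : a i = 1 * a j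
    · rw [hij]
      ring
    · rw [hd i j hij]
      ring
  have hN : IsNilpotent (J - diagonal a) := by
    refine ⟨n, ?_⟩
    have h1 : (J - diagonal a).charpoly = Polynomial.X ^ n := by
      rw [charpoly_of_isUpperTriangular]
      · simp [hJ.1]
      · intro i j hij
        have hij' : (j : ℕ) < i := hij
        have : i ≠ j := fun h => by simp [h] at hij'
        rw [Matrix.sub_apply, diagonal_apply_ne _ this, sub_zero]
        exact hJ.2.2 i j this.symm (by omega)
    have h2 := aeval_self_charpoly (J - diagonal a)
    rwa [h1, map_pow, Polynomial.aeval_X] at h2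
  have hNX : Commute (J - diagonal a) X := by
    rw [Commute, SemiconjBy, sub_mul, mul_sub, hX, hcD]
  have htr : trace ((J - diagonal a) * X) = 0 :=
    (isNilpotent_trace_of_isNilpotent (hNX.isNilpotent_mul_right hN)).eq_zero
  rw [sub_mul, trace_sub, sub_eq_zero] at htr
  rw [htr]
  simp only [trace, diag_apply, eigProj, diagonal_mul, mul_diagonal, Finset.mul_sum]
  rw [Finset.sum_comm]
  refine Finset.sum_congr rfl fun i _ => ?_
  rw [Finset.sum_eq_single_of_mem (a i) (Finset.mem_image_of_mem a (Finset.mem_univ i))]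
  · simp
  · intro e _ he
    simp [he.symm]

end BlockDet

end

noncomputable section

open Matrix

/-! ### The logarithm on the stabilizer of a Jordan form -/

section JordanLog

variable {n : ℕ} {S E : Type*} [CommRing S] [Field E]

open Classical in
/-- The value of the logarithm on the centralizer of the lift of a Jordan form with diagonal `a`. -/
def blockLog (π : S) (res : S →+* E) (s : E →*₀ S) (a : Fin n → E)
    (z : Matrix (Fin n) (Fin n) S) : E :=
  ∑ e ∈ Finset.univ.image a, e * unitLog π res s (blockDet a e z)

/-- The logarithm on the stabilizer of a Jordan form `J` with diagonal `a`: the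
homomorphism that maps `1 + π X` to `Tr (J X)` and is `blockLog` on the centralizer of the lift
of `J`. -/
def jordanLog (π : S) (res : S →+* E) (s : E →*₀ S) (J : Matrix (Fin n) (Fin n) E)
    (a : Fin n → E) (t : Matrix (Fin n) (Fin n) S) : E :=
  -- The entrywise lift t₀ of t̄ serves as the representative in the centralizer of s(J). Writing t
  -- = t₀(1 + πX), one finds X̄ = t̄⁻¹ · (t - t₀)/π.
  trace (J * ((t.map res)⁻¹ * (t - (t.map res).map s).map (divUnif π res))) +
    blockLog π res s a ((t.map res).map s)

variable {π : S} {res : S →+* E} {s : E →*₀ S} {J : Matrix (Fin n) (Fin n) E} {a : Fin n → E}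

theorem map_section_map (hs : ∀ x, res (s x) = x) (w : Matrix (Fin n) (Fin n) E) :
    (w.map s).map res = w := by
  ext i j
  simp [hs]

namespace IsLengthTwo

variable (h : IsLengthTwo π res)
include h

theorem smul_matrix_eq_iff {X Y : Matrix (Fin n) (Fin n) S} :
    π • X = π • Y ↔ X.map res = Y.map res := by
  simp only [← Matrix.ext_iff, Matrix.smul_apply, smul_eq_mul, h.unif_mul_eq_iff, map_apply]

theorem map_one_add (X : Matrix (Fin n) (Fin n) S) : (1 + π • X).map res = 1 := by
  ext i j
  simp [h.res_unif, one_apply, apply_ite res]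

theorem matrix_exists_eq_add {x y : Matrix (Fin n) (Fin n) S} (hxy : x.map res = y.map res) :
    ∃ c, x = y + π • c := by
  choose c hc using fun i j => h.exists_eq_add (x := x i j) (y := y i j)
    (congrFun (congrFun hxy i) j)
  refine ⟨Matrix.of c, ?_⟩
  ext i j
  simp [hc i j]

theorem matrix_isUnit_iff (z : Matrix (Fin n) (Fin n) S) : IsUnit z ↔ IsUnit (z.map res) := by
  rw [isUnit_iff_isUnit_det, isUnit_iff_isUnit_det, h.isUnit_iff, ← RingHom.mapMatrix_apply,
    ← RingHom.map_det, isUnit_iff_ne_zero]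

theorem isUnit_one_add (X : Matrix (Fin n) (Fin n) S) : IsUnit (1 + π • X) := by
  rw [h.matrix_isUnit_iff, h.map_one_add]
  exact isUnit_one

theorem one_add_mul_one_add (X Y : Matrix (Fin n) (Fin n) S) :
    (1 + π • X) * (1 + π • Y) = 1 + π • (X + Y) := by
  have : (π • X) * (π • Y) = 0 := by
    rw [smul_mul_assoc, mul_smul_comm, smul_smul, h.unif_mul_unif, zero_smul]
  rw [add_mul, mul_add, mul_add, this, smul_add]
  simp only [one_mul, mul_one, add_zero]
  abel

theorem matrix_exists_eq_mul {x y : Matrix (Fin n) (Fin n) S} (hxy : x.map res = y.map res)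
    (hy : IsUnit y) : ∃ X, x = y * (1 + π • X) := by
  obtain ⟨c, hc⟩ := h.matrix_exists_eq_add hxy
  refine ⟨y⁻¹ * c, ?_⟩
  rw [mul_add, mul_one, mul_smul_comm, ← mul_assoc,
    mul_nonsing_inv _ ((isUnit_iff_isUnit_det _).1 hy), one_mul, hc]

theorem isUnit_section_sub_section (hs : ∀ x, res (s x) = x) (x y : E) (hxy : x ≠ y) :
    IsUnit (s x - s y) := by
  rw [h.isUnit_iff, map_sub, hs, hs, sub_ne_zero]
  exact hxy

theorem eigProj_comm (hs : ∀ x, res (s x) = x) (hJ : IsJordanForm J a)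
    {z : Matrix (Fin n) (Fin n) S} (hz : z * J.map s = J.map s * z) (e : E) :
    eigProj S a e * z = z * eigProj S a e := by
  have hd := hJ.intertwiner_apply_eq_zero hJ (h.isUnit_section_sub_section hs) (b := 1) (w := z)
    (by rw [map_one, one_smul, hz])
  simpa using eigProj_mul_intertwiner one_ne_zero hd e

omit h in
theorem map_comm_of_comm (hs : ∀ x, res (s x) = x) {z : Matrix (Fin n) (Fin n) S}
    (hz : z * J.map s = J.map s * z) : z.map res * J = J * z.map res := by
  have := congrArg (fun M => M.map res) hz
  simpa only [Matrix.map_mul, map_section_map hs] using this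

/-- The inverse of z also centralizes s(J), so the block determinants of z and z⁻¹ are inverse to
each other. -/
theorem res_blockDet_ne_zero (hs : ∀ x, res (s x) = x) (hJ : IsJordanForm J a)
    {z : Matrix (Fin n) (Fin n) S} (hu : IsUnit z) (hz : z * J.map s = J.map s * z) (e : E) :
    res (blockDet a e z) ≠ 0 := by
  rw [← h.isUnit_iff]
  have h1 := (isUnit_iff_isUnit_det _).1 hu
  have hz' : z⁻¹ * J.map s = J.map s * z⁻¹ := by
    have : Commute z (J.map s) := hz
    obtain ⟨u, rfl⟩ := hu
    rw [← coe_units_inv]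
    exact this.units_inv_left
  have := blockDet_mul (y := z) (h.eigProj_comm hs hJ hz' e)
  rw [mul_nonsing_inv _ h1, blockDet_one] at this
  exact IsUnit.of_mul_eq_one _ this.symm

theorem blockLog_mul (hs : ∀ x, res (s x) = x) (hJ : IsJordanForm J a)
    {y z : Matrix (Fin n) (Fin n) S} (huy : IsUnit y) (hy : y * J.map s = J.map s * y)
    (hu : IsUnit z) (hz : z * J.map s = J.map s * z) :
    blockLog π res s a (y * z) = blockLog π res s a y + blockLog π res s a z := by
  rw [blockLog, blockLog, blockLog, ← Finset.sum_add_distrib]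
  refine Finset.sum_congr rfl fun e _ => ?_
  rw [blockDet_mul (h.eigProj_comm hs hJ hz e), h.unitLog_mul hs
    (h.res_blockDet_ne_zero hs hJ huy hy e) (h.res_blockDet_ne_zero hs hJ hu hz e), mul_add]

/-- The two prescriptions agree where the centralizer meets the kernel of reduction, by
`trace_mul_of_commute`. -/
theorem blockLog_one_add (hs : ∀ x, res (s x) = x) (hJ : IsJordanForm J a)
    {X : Matrix (Fin n) (Fin n) S} (hX : X.map res * J = J * X.map res) :
    blockLog π res s a (1 + π • X) = trace (J * X.map res) := by
  classical
  rw [trace_mul_of_commute hJ hX, blockLog]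
  refine Finset.sum_congr (by congr!) fun e _ => ?_
  rw [blockDet_one_add h.unif_mul_unif, h.unitLog_one_add hs, ← AddMonoidHom.coe_coe res,
    AddMonoidHom.map_trace, AddMonoidHom.coe_coe, Matrix.map_mul]
  congr 3
  ext i j
  by_cases hij : i = j <;> by_cases hi : a j = e <;> simp [eigProj, hij, hi]

/-- The definition uses one particular factorization of t; any other one gives the same value. If z
= z₀(1 + πY) with z₀ the entrywise lift, then Ȳ commutes with J and `blockLog_one_add` moves Tr(J Ȳ)
from one summand to the other. -/
theorem jordanLog_eq (hs : ∀ x, res (s x) = x) (hJ : IsJordanForm J a)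
    {z : Matrix (Fin n) (Fin n) S} (hu : IsUnit z) (hz : z * J.map s = J.map s * z)
    (X : Matrix (Fin n) (Fin n) S) :
    jordanLog π res s J a (z * (1 + π • X)) = trace (J * X.map res) + blockLog π res s a z := by
  have hzJ := map_comm_of_comm hs hz
  have huz := (h.matrix_isUnit_iff z).1 hu
  have h0 := hJ.map_commute s hzJ
  have hu0 : IsUnit ((z.map res).map s) := by
    rw [h.matrix_isUnit_iff, map_section_map hs]
    exact huz
  obtain ⟨Y, hY⟩ := h.matrix_exists_eq_mul (x := z) (y := (z.map res).map s)
    (by rw [map_section_map hs]) hu0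
  have hred : (z * (1 + π • X)).map res = z.map res := by
    rw [Matrix.map_mul, h.map_one_add, mul_one]
  -- Both z and z₀ centralize s(J). Cancelling z₀ leaves π(Y s(J) - s(J) Y) = 0, that is,
  -- commutation modulo π.
  have hYJ : Y.map res * J = J * Y.map res := by
    have h1 : (z.map res).map s * (π • (Y * J.map s)) = (z.map res).map s * (π • (J.map s * Y)) := by
      have h2 := hz
      rw [hY, mul_assoc, add_mul, one_mul, mul_add, ← mul_assoc (J.map s), ← h0, mul_assoc _ (J.map s),
        mul_add, mul_one, mul_add, add_right_inj] at h2
      simpa only [smul_mul_assoc, mul_smul_comm] using h2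
    have h3 := h.smul_matrix_eq_iff.1 (hu0.mul_right_injective h1)
    simpa only [Matrix.map_mul, map_section_map hs] using h3
  have hdiff : z * (1 + π • X) - (z.map res).map s = π • ((z.map res).map s * (Y + X)) := by
    nth_rw 1 [hY]
    rw [mul_assoc, h.one_add_mul_one_add, mul_add, mul_one, add_sub_cancel_left, mul_smul_comm]
  have hdiv : ∀ M : Matrix (Fin n) (Fin n) S, (π • M).map (divUnif π res) = M.map res := fun M => by
    ext i j
    simp [h.divUnif_mul]
  rw [jordanLog, hred, hdiff, hdiv, Matrix.map_mul, map_section_map hs, ← mul_assoc _ (z.map res),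
    nonsing_inv_mul _ ((isUnit_iff_isUnit_det _).1 huz), one_mul, Matrix.map_add _ (map_add res),
    mul_add, trace_add]
  nth_rw 2 [hY]
  rw [h.blockLog_mul hs hJ hu0 h0 (h.isUnit_one_add Y), h.blockLog_one_add hs hJ hYJ]
  · ring
  · have := hu0.mul_right_injective (a₁ := (1 + π • Y) * J.map s) (a₂ := J.map s * (1 + π • Y)) (by
      simp only
      rw [← mul_assoc, ← hY, ← mul_assoc, h0, mul_assoc (J.map s), ← hY, hz])
    exact this

theorem jordanLog_of_comm (hs : ∀ x, res (s x) = x) (hJ : IsJordanForm J a)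
    {z : Matrix (Fin n) (Fin n) S} (hu : IsUnit z) (hz : z * J.map s = J.map s * z) :
    jordanLog π res s J a z = blockLog π res s a z := by
  simpa using h.jordanLog_eq hs hJ hu hz 0

theorem jordanLog_one_add (hs : ∀ x, res (s x) = x) (hJ : IsJordanForm J a)
    (X : Matrix (Fin n) (Fin n) S) :
    jordanLog π res s J a (1 + π • X) = trace (J * X.map res) := by
  have h1 := h.jordanLog_eq hs hJ isUnit_one (by rw [one_mul, mul_one]) X
  have h2 : blockLog π res s a 1 = 0 := by
    have := h.blockLog_one_add hs hJ (X := 0) (by simp)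
    simpa using this
  rwa [one_mul, h2, add_zero] at h1

/-- T(J) is the product of the centralizer of s(J) and the kernel of reduction, because the
entrywise lift of t̄ still commutes with s(J) (`map_commute`). -/
theorem exists_eq_mul_of_comm (hs : ∀ x, res (s x) = x) (hJ : IsJordanForm J a)
    {t : Matrix (Fin n) (Fin n) S} (hu : IsUnit t) (ht : t.map res * J = J * t.map res) :
    IsUnit ((t.map res).map s) ∧ (t.map res).map s * J.map s = J.map s * (t.map res).map s ∧
      ∃ X, t = (t.map res).map s * (1 + π • X) := by
  have hu0 : IsUnit ((t.map res).map s) := by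
    rw [h.matrix_isUnit_iff, map_section_map hs]
    exact (h.matrix_isUnit_iff _).1 hu
  exact ⟨hu0, hJ.map_commute s ht, h.matrix_exists_eq_mul (by rw [map_section_map hs]) hu0⟩

/-- Moving 1 + πX₁ past z₂ conjugates X₁ by z₂. The residue of z₂ commutes with J, so Tr(J X̄₁) is
unchanged. -/
theorem jordanLog_mul (hs : ∀ x, res (s x) = x) (hJ : IsJordanForm J a)
    {t₁ t₂ : Matrix (Fin n) (Fin n) S} (hu₁ : IsUnit t₁) (hu₂ : IsUnit t₂)
    (h₁ : t₁.map res * J = J * t₁.map res) (h₂ : t₂.map res * J = J * t₂.map res) :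
    jordanLog π res s J a (t₁ * t₂) = jordanLog π res s J a t₁ + jordanLog π res s J a t₂ := by
  obtain ⟨hv₁, hc₁, X₁, hX₁⟩ := h.exists_eq_mul_of_comm hs hJ hu₁ h₁
  obtain ⟨hv₂, hc₂, X₂, hX₂⟩ := h.exists_eq_mul_of_comm hs hJ hu₂ h₂
  have hr₂ : ((t₂.map res).map s).map res = t₂.map res := map_section_map hs _
  set z₁ := (t₁.map res).map s
  set z₂ := (t₂.map res).map s
  have hd₂ := (isUnit_iff_isUnit_det _).1 hv₂
  have hprod : t₁ * t₂ = z₁ * z₂ * (1 + π • (z₂⁻¹ * X₁ * z₂ + X₂)) := by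
    rw [← h.one_add_mul_one_add, hX₁, hX₂]
    simp only [← mul_assoc]
    congr 1
    rw [mul_add, mul_add, mul_one, mul_one, add_mul, mul_smul_comm, mul_smul_comm, smul_mul_assoc]
    congr 2
    simp only [mul_assoc]
    rw [mul_nonsing_inv_cancel_left _ _ hd₂]
  have hinv : (z₂⁻¹).map res * z₂.map res = 1 := by
    rw [← Matrix.map_mul, nonsing_inv_mul _ hd₂, Matrix.map_one _ (map_zero res) (map_one res)]
  rw [hprod, h.jordanLog_eq hs hJ (hv₁.mul hv₂) (by rw [mul_assoc, hc₂, ← mul_assoc, hc₁, mul_assoc]),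
    h.blockLog_mul hs hJ hv₁ hc₁ hv₂ hc₂, hX₁, hX₂, h.jordanLog_eq hs hJ hv₁ hc₁,
    h.jordanLog_eq hs hJ hv₂ hc₂, Matrix.map_add _ (map_add res), mul_add, trace_add]
  have htr : trace (J * (z₂⁻¹ * X₁ * z₂).map res) = trace (J * X₁.map res) := by
    rw [Matrix.map_mul, Matrix.map_mul, ← mul_assoc, trace_mul_comm, ← mul_assoc, ← mul_assoc,
      hr₂, h₂, ← hr₂, mul_assoc J, mul_eq_one_comm.1 hinv, mul_one]
  rw [htr]
  ring

end IsLengthTwo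

variable {J₁ J₂ : Matrix (Fin n) (Fin n) E} {a₁ a₂ : Fin n → E}

/-- A scalar that is no eigenvalue has block determinant 1 and contributes log 1 = 0. So the sums
for two spectra can be taken over a common index set. -/
theorem blockLog_eq_sum_of_subset (h : IsLengthTwo π res) (hs : ∀ x, res (s x) = x)
    (z : Matrix (Fin n) (Fin n) S) {U : Finset E} (hU : ∀ i, a i ∈ U) :
    blockLog π res s a z = ∑ e ∈ U, e * unitLog π res s (blockDet a e z) := by
  classical
  refine Finset.sum_subset (fun e he => ?_) fun e _ he => ?_
  · obtain ⟨i, -, rfl⟩ := Finset.mem_image.1 he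
    exact hU i
  · rw [blockDet_eq_one, ← map_one s, h.unitLog_section hs, mul_zero]
    intro i hi
    exact he (Finset.mem_image.2 ⟨i, Finset.mem_univ i, hi⟩)

theorem blockLog_conj (h : IsLengthTwo π res) (hs : ∀ x, res (s x) = x) {b : E} (hb : b ≠ 0)
    {w w' : Matrix (Fin n) (Fin n) S} (hw : ∀ i j, a₂ i ≠ b * a₁ j → w i j = 0)
    (hww' : w * w' = 1) (z : Matrix (Fin n) (Fin n) S) :
    blockLog π res s a₂ (w * z * w') = b * blockLog π res s a₁ z := by
  classical
  let U : Finset E := Finset.univ.image a₁ ∪ Finset.univ.image fun i => b⁻¹ * a₂ i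
  rw [blockLog_eq_sum_of_subset h hs (U := U.image (b * ·)),
    blockLog_eq_sum_of_subset h hs (a := a₁) (U := U), Finset.mul_sum,
    Finset.sum_image fun x _ y _ hxy => mul_left_cancel₀ hb hxy]
  · refine Finset.sum_congr rfl fun e _ => ?_
    rw [blockDet_conj hb hw hww', mul_assoc]
  · intro i
    exact Finset.mem_union_left _ (Finset.mem_image_of_mem _ (Finset.mem_univ i))
  · intro i
    refine Finset.mem_image.2 ⟨b⁻¹ * a₂ i, Finset.mem_union_right _
      (Finset.mem_image_of_mem _ (Finset.mem_univ i)), ?_⟩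
    simp [hb]

/-- The logarithm is compatible with conjugation by lifts of intertwiners. -/
theorem jordanLog_conj (h : IsLengthTwo π res) (hs : ∀ x, res (s x) = x)
    (h₁ : IsJordanForm J₁ a₁) (h₂ : IsJordanForm J₂ a₂) {b : E} (hb : b ≠ 0)
    {v v' t : Matrix (Fin n) (Fin n) S} (hv : J₂ * v.map res = b • (v.map res * J₁))
    (hvv' : v * v' = 1) (hu : IsUnit t) (ht : t.map res * J₁ = J₁ * t.map res) :
    jordanLog π res s J₂ a₂ (v * t * v') = b * jordanLog π res s J₁ a₁ t := by
  have huv : IsUnit v := IsUnit.of_mul_eq_one _ hvv'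
  -- Split v = w(1 + πY): the factor w intertwines the lifted Jordan forms exactly, the other one
  -- lies in T(J₁).
  set w := (v.map res).map s with hw_def
  have hu0 : IsUnit w := by
    rw [h.matrix_isUnit_iff, map_section_map hs]
    exact (h.matrix_isUnit_iff _).1 huv
  have hdw := (isUnit_iff_isUnit_det _).1 hu0
  obtain ⟨Y, hY⟩ := h.matrix_exists_eq_mul (x := v) (y := w) (by rw [map_section_map hs]) hu0
  have hwJ := h₁.map_intertwiner h₂ s hv
  rw [← hw_def] at hwJ
  have hwd := h₁.intertwiner_apply_eq_zero h₂ (h.isUnit_section_sub_section hs) hwJ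
  have hww' : w * w⁻¹ = 1 := mul_nonsing_inv _ hdw
  have hv' : v' = (1 + π • (-Y)) * w⁻¹ := by
    refine huv.mul_right_injective ?_
    simp only
    rw [hvv', hY, mul_assoc, ← mul_assoc (1 + _), h.one_add_mul_one_add, add_neg_cancel, smul_zero,
      add_zero, one_mul, hww']
  set t' := (1 + π • Y) * t * (1 + π • (-Y)) with ht'_def
  have hY1 : ∀ Y : Matrix (Fin n) (Fin n) S,
      (1 + π • Y).map res * J₁ = J₁ * (1 + π • Y).map res := fun Y => by
    rw [h.map_one_add, one_mul, mul_one]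
  have ht'1 : t'.map res = t.map res := by
    rw [ht'_def, Matrix.map_mul, Matrix.map_mul, h.map_one_add, h.map_one_add, one_mul, mul_one]
  -- On T(J₁) the logarithm is a homomorphism to a commutative group, so conjugation by 1 + πY is
  -- invisible.
  have ht' : jordanLog π res s J₁ a₁ t' = jordanLog π res s J₁ a₁ t := by
    rw [ht'_def, h.jordanLog_mul hs h₁ ((h.isUnit_one_add Y).mul hu) (h.isUnit_one_add _) _ (hY1 _),
      h.jordanLog_mul hs h₁ (h.isUnit_one_add Y) hu (hY1 _) ht, h.jordanLog_one_add hs h₁,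
      h.jordanLog_one_add hs h₁]
    · have : (-Y).map res = -Y.map res := by
        ext i j
        simp
      rw [this, mul_neg, trace_neg]
      ring
    · rw [Matrix.map_mul, h.map_one_add, one_mul, ht]
  have hvt : v * t * v' = w * t' * w⁻¹ := by
    rw [hY, hv', ht'_def]
    simp only [mul_assoc]
  obtain ⟨hz, hc, X, hX⟩ := h.exists_eq_mul_of_comm hs h₁ (t := t')
    (((h.isUnit_one_add Y).mul hu).mul (h.isUnit_one_add _)) (by rw [ht'1, ht])
  set z := (t'.map res).map s
  have hw'w : w⁻¹ * w = 1 := nonsing_inv_mul _ hdw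
  -- Conjugation by w preserves the shape of the factorization, so `jordanLog_eq` applies to both
  -- sides. The block part is scaled by b through the eigenvalues, the trace part through J₂ w̄ = b
  -- w̄ J₁.
  have hconj : w * (z * (1 + π • X)) * w⁻¹ = (w * z * w⁻¹) * (1 + π • (w * X * w⁻¹)) := by
    simp only [mul_add, mul_one, add_mul, mul_smul_comm, smul_mul_assoc, mul_assoc]
    rw [nonsing_inv_mul_cancel_left _ _ hdw]
  have hw'J : w⁻¹ * J₂.map s = s b • (J₁.map s * w⁻¹) := by
    calc w⁻¹ * J₂.map s = w⁻¹ * (J₂.map s * w) * w⁻¹ := by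
          rw [mul_assoc, mul_assoc, hww', mul_one]
      _ = _ := by
          rw [hwJ, mul_smul_comm, smul_mul_assoc, ← mul_assoc, hw'w, one_mul]
  have hcomm : w * z * w⁻¹ * J₂.map s = J₂.map s * (w * z * w⁻¹) := by
    calc w * z * w⁻¹ * J₂.map s = s b • (w * (z * J₁.map s) * w⁻¹) := by
          rw [mul_assoc _ w⁻¹, hw'J, mul_smul_comm]
          simp only [mul_assoc]
      _ = s b • (w * J₁.map s) * z * w⁻¹ := by
          rw [hc]
          simp only [mul_assoc, smul_mul_assoc]
      _ = _ := by
          rw [← hwJ]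
          simp only [mul_assoc]
  have huw' : IsUnit w⁻¹ := IsUnit.of_mul_eq_one _ hw'w
  rw [hvt, ← ht', hX, hconj, h.jordanLog_eq hs h₂ ((hu0.mul hz).mul huw') hcomm,
    h.jordanLog_eq hs h₁ hz hc, blockLog_conj h hs hb hwd hww', mul_add]
  congr 1
  have hwr : w.map res = v.map res := map_section_map hs _
  have hw'r : (w⁻¹).map res * w.map res = 1 := by
    rw [← Matrix.map_mul, hw'w, Matrix.map_one _ (map_zero res) (map_one res)]
  rw [Matrix.map_mul, Matrix.map_mul, ← mul_assoc, ← mul_assoc, trace_mul_comm, ← mul_assoc,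
    hwr, mul_assoc (w⁻¹.map res), hv, ← hwr, smul_mul_assoc, mul_smul_comm, mul_assoc (w.map res),
    ← mul_assoc, hw'r, one_mul, trace_smul, smul_eq_mul]

/-- θ carries a factorization t = z(1 + πX) to one for the Jordan form τ(J), and `jordanLog_eq`
computes both values. -/
theorem jordanLog_map {S' E' : Type*} [CommRing S'] [Field E'] {res' : S' →+* E'}
    {θ : S →+* S'} {τ : E →+* E'} (h : IsLengthTwo π res)
    (h' : IsLengthTwo (θ π) res') (hs : ∀ x, res (s x) = x) {s' : E' →*₀ S'}
    (hs' : ∀ x, res' (s' x) = x) (hθ : ∀ x, res' (θ x) = τ (res x))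
    (hθs : ∀ u, θ (s u) = s' (τ u)) (hJ : IsJordanForm J a) {t : Matrix (Fin n) (Fin n) S}
    (hu : IsUnit t) (ht : t.map res * J = J * t.map res) :
    jordanLog (θ π) res' s' (J.map τ) (τ ∘ a) (t.map θ) = τ (jordanLog π res s J a t) := by
  classical
  obtain ⟨hz, hc, X, hX⟩ := h.exists_eq_mul_of_comm hs hJ hu ht
  set z := (t.map res).map s
  have hmap : ∀ M : Matrix (Fin n) (Fin n) S, (M.map θ).map res' = (M.map res).map τ := fun M => by
    ext i j
    simp [hθ]
  have hmaps : ∀ M : Matrix (Fin n) (Fin n) E, (M.map s).map θ = (M.map τ).map s' := fun M => by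
    ext i j
    simp [hθs]
  have h1 : (z * (1 + π • X)).map θ = z.map θ * (1 + θ π • X.map θ) := by
    rw [Matrix.map_mul, Matrix.map_add _ (map_add θ), Matrix.map_one _ (map_zero θ) (map_one θ)]
    congr 2
    ext i j
    simp
  have hz' : IsUnit (z.map θ) := by
    simpa using hz.map θ.mapMatrix
  have hc' : z.map θ * (J.map τ).map s' = (J.map τ).map s' * z.map θ := by
    rw [← hmaps, ← Matrix.map_mul, hc, Matrix.map_mul]
  rw [hX, h1, h'.jordanLog_eq hs' (hJ.map τ) hz' hc', h.jordanLog_eq hs hJ hz hc, hmap,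
    ← Matrix.map_mul, map_add]
  congr 1
  · rw [← AddMonoidHom.coe_coe τ, AddMonoidHom.map_trace]
  · rw [blockLog, blockLog, ← Finset.image_image, Finset.sum_image fun x _ y _ hxy => τ.injective hxy,
      map_sum]
    refine Finset.sum_congr rfl fun e _ => ?_
    rw [blockDet_comp, blockDet_map, h.map_unitLog h' hs hs' hθ hθs, map_mul]

end JordanLog

end

noncomputable section

open Polynomial Module

/-! ### Existence of Jordan forms -/

section JordanExists

variable {E : Type*} [Field E]

open Submodule in
/-- The module `E[X] / (X - c) ^ m` has a basis that is a Jordan string for `X - c`. -/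
theorem exists_jordanString (c : E) (m : ℕ) :
    ∃ v : Basis (Fin m) E (E[X] ⧸ E[X] ∙ (X - C c) ^ m), ∀ j : Fin m,
      (X - C c) • v j = if h : (j : ℕ) = 0 then 0 else v ⟨j - 1, by omega⟩ := by
  set q : E[X] := X - C c
  have hq : (q ^ m).Monic := (monic_X_sub_C c).pow m
  let mk : E[X] →ₗ[E[X]] (E[X] ⧸ E[X] ∙ q ^ m) := mkQ _
  have hmk : ∀ i, m ≤ i → mk (q ^ i) = 0 := by
    intro i hi
    refine (Submodule.Quotient.mk_eq_zero _).2 (mem_span_singleton.2 ⟨q ^ (i - m), ?_⟩)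
    rw [smul_eq_mul, ← pow_add, Nat.sub_add_cancel hi]
  -- The powers of X - c are taken in descending order, so that X - c lowers the index and the ones
  -- land above the diagonal.
  let v : Fin m → (E[X] ⧸ E[X] ∙ q ^ m) := fun j => mk (q ^ (m - 1 - j))
  have hfr : finrank E (E[X] ⧸ E[X] ∙ q ^ m) = m := by
    have h1 := (AdjoinRoot.powerBasis' hq).finrank
    rw [AdjoinRoot.powerBasis'_dim, natDegree_pow, natDegree_X_sub_C, mul_one] at h1
    exact h1
  have hspan : ⊤ ≤ span E (Set.range v) := by
    rintro x -
    obtain ⟨f, rfl⟩ := mkQ_surjective _ x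
    -- The Taylor expansion at c writes every class as a combination of powers of X - c.
    rw [← sum_taylor_eq f c, Polynomial.sum, map_sum]
    refine sum_mem fun i _ => ?_
    rw [← smul_eq_C_mul]
    change mk ((taylor c f).coeff i • q ^ i) ∈ _
    rw [LinearMap.map_smul_of_tower]
    refine smul_mem _ _ ?_
    by_cases hi : m ≤ i
    · rw [hmk i hi]
      exact zero_mem _
    · refine subset_span ⟨⟨m - 1 - i, by omega⟩, ?_⟩
      simp only [v]
      congr 2
      omega
  refine ⟨basisOfTopLeSpanOfCardEqFinrank v hspan (by rw [hfr, Fintype.card_fin]), fun j => ?_⟩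
  rw [coe_basisOfTopLeSpanOfCardEqFinrank]
  simp only [v]
  rw [← map_smul, smul_eq_mul, ← pow_succ']
  split_ifs with h
  · exact hmk _ (by omega)
  · congr 2
    have := j.2
    omega

/-- The characteristic polynomial kills the module by Cayley–Hamilton. An irreducible occurring with
positive exponent therefore divides it, and is linear since it splits. -/
theorem exists_span_eq_of_splits {V : Type*} [AddCommGroup V] [Module E V] [FiniteDimensional E V]
    (f : End E V) (hf : (LinearMap.charpoly f).Splits) {ι : Type*} [Fintype ι] (p : ι → E[X])
    (hp : ∀ i, Irreducible (p i)) (e : ι → ℕ)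
    (φ : AEval' f ≃ₗ[E[X]] DirectSum ι fun i => E[X] ⧸ Submodule.span E[X] {p i ^ e i}) (i : ι) :
    ∃ c, Submodule.span E[X] {p i ^ e i} = Submodule.span E[X] {(X - C c) ^ e i} := by
  classical
  by_cases he : e i = 0
  -- With exponent 0 the summand vanishes and any c will do.
  · exact ⟨0, by rw [he, pow_zero, pow_zero]⟩
  have hkill : ∀ x : AEval' f, LinearMap.charpoly f • x = 0 := by
    intro x
    obtain ⟨y, rfl⟩ := (AEval'.of f).surjective x
    change LinearMap.charpoly f • AEval.of E V f y = 0
    rw [← AEval.of_aeval_smul, LinearMap.aeval_self_charpoly, zero_smul, map_zero]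
  have hdvd : p i ∣ LinearMap.charpoly f := by
    have h1 := hkill (φ.symm (DirectSum.lof E[X] ι _ i (Submodule.Quotient.mk 1)))
    rw [← map_smul, φ.symm.map_eq_zero_iff, ← map_smul] at h1
    have h2 := DFinsupp.single_eq_zero.1 h1
    rw [← Submodule.Quotient.mk_smul, Submodule.Quotient.mk_eq_zero, smul_eq_mul, mul_one,
      Submodule.mem_span_singleton] at h2
    obtain ⟨r, hr⟩ := h2
    exact (dvd_pow_self _ he).trans ⟨r, by rw [← hr, smul_eq_mul, mul_comm]⟩
  have hdeg : (p i).degree = 1 :=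
    (hf.of_dvd (LinearMap.charpoly_monic f).ne_zero hdvd).degree_eq_one_of_irreducible (hp i)
  obtain ⟨c, hc⟩ := exists_root_of_degree_eq_one hdeg
  refine ⟨c, ?_⟩
  have hass : Associated (p i) (X - C c) :=
    ((irreducible_X_sub_C c).associated_of_dvd (hp i) (dvd_iff_isRoot.2 hc)).symm
  exact Ideal.span_singleton_eq_span_singleton.2 (hass.pow_pow)

/-- The structure theorem decomposes the E[X]-module defined by f into pieces E[X]/(X - c)^m, each
with a Jordan string. -/
theorem exists_jordanBasis {V : Type*} [AddCommGroup V] [Module E V] [FiniteDimensional E V]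
    (f : End E V) (hf : (LinearMap.charpoly f).Splits) :
    ∃ (d : ℕ) (m : Fin d → ℕ) (c : Fin d → E) (b : Basis (Σ i, Fin (m i)) E V),
      ∀ (i : Fin d) (j : Fin (m i)), f (b ⟨i, j⟩) = c i • b ⟨i, j⟩ +
        if h : (j : ℕ) = 0 then 0 else b ⟨i, ⟨j - 1, by omega⟩⟩ := by
  classical
  obtain ⟨ι, hι, p, hp, e, ⟨φ⟩⟩ := Module.equiv_directSum_of_isTorsion
    (AEval.isTorsion_of_finiteDimensional E V f)
  choose c hc using exists_span_eq_of_splits f hf p hp e φ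
  choose v hv using fun i => exists_jordanString (c i) (e i)
  let ε := (Fintype.equivFin ι).symm
  let φ' : AEval' f ≃ₗ[E[X]] ∀ i : Fin (Fintype.card ι),
      E[X] ⧸ Submodule.span E[X] {(X - C (c (ε i))) ^ e (ε i)} :=
    φ ≪≫ₗ DirectSum.linearEquivFunOnFintype E[X] ι _ ≪≫ₗ
      LinearEquiv.piCongrRight (fun i => Submodule.quotEquivOfEq _ _ (hc i)) ≪≫ₗ
      (LinearEquiv.piCongrLeft E[X] _ ε).symm
  let b := (Pi.basis fun i => v (ε i)).map ((φ'.symm.restrictScalars E) ≪≫ₗ (AEval'.of f).symm)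
  refine ⟨_, fun i => e (ε i), fun i => c (ε i), b, fun i j => ?_⟩
  have hb : ∀ ij, AEval'.of f (b ij) = φ'.symm (Pi.single ij.1 (v (ε ij.1) ij.2)) := fun ij => by
    simp [b]
  apply (AEval'.of f).injective
  have h1 : AEval'.of f (f (b ⟨i, j⟩)) = (X : E[X]) • AEval'.of f (b ⟨i, j⟩) :=
    (AEval'.X_smul_of f _).symm
  have h2 : (X : E[X]) • AEval'.of f (b ⟨i, j⟩) = c (ε i) • AEval'.of f (b ⟨i, j⟩) +
      (X - C (c (ε i))) • AEval'.of f (b ⟨i, j⟩) := by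
    rw [sub_smul, AEval.C_smul]
    abel
  rw [h1, h2, map_add, map_smul]
  congr 1
  rw [hb, ← map_smul, ← Pi.single_smul, hv]
  split_ifs with h
  · simp
  · rw [hb]

theorem exists_isJordanForm {n : ℕ} (A : Matrix (Fin n) (Fin n) E) (hA : A.charpoly.Splits) :
    ∃ (J : Matrix (Fin n) (Fin n) E) (a : Fin n → E) (g : GL (Fin n) E), IsJordanForm J a ∧
      A * (g : Matrix (Fin n) (Fin n) E) = (g : Matrix (Fin n) (Fin n) E) * J := by
  obtain ⟨d, m, c, b, hb⟩ := exists_jordanBasis (Matrix.toLin' A) (by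
    rwa [← LinearMap.charpoly_toMatrix _ (Pi.basisFun E (Fin n)), LinearMap.toMatrix_eq_toMatrix',
      LinearMap.toMatrix'_toLin'])
  have hn : ∑ i, m i = n := by
    have := finrank_eq_card_basis b
    simpa using this.symm
  -- The strings are laid end to end: neighbours in a string get consecutive indices, which is what
  -- places the ones on the superdiagonal.
  let φ : (Σ i, Fin (m i)) ≃ Fin n := finSigmaFinEquiv.trans (finCongr hn)
  have hφ : ∀ i (j : Fin (m i)) (h : (j : ℕ) ≠ 0),
      (φ ⟨i, j⟩ : ℕ) = φ ⟨i, ⟨j - 1, by omega⟩⟩ + 1 := by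
    intro i j h
    simp only [φ, Equiv.trans_apply, finCongr_apply, Fin.val_cast, finSigmaFinEquiv_apply]
    omega
  let b' := b.reindex φ
  let P := (Pi.basisFun E (Fin n)).toMatrix b'
  have hP : IsUnit P := by
    have := (Pi.basisFun E (Fin n)).invertibleToMatrix b'
    exact isUnit_of_invertible P
  let J := LinearMap.toMatrix b' b' (Matrix.toLin' A)
  have hJ : ∀ x i (j : Fin (m i)), J x (φ ⟨i, j⟩) = (if x = φ ⟨i, j⟩ then c i else 0) +
      if h : (j : ℕ) = 0 then 0 else if x = φ ⟨i, ⟨j - 1, by omega⟩⟩ then 1 else 0 := by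
    intro x i j
    obtain ⟨y, rfl⟩ := φ.surjective x
    simp only [J, b', LinearMap.toMatrix_apply, Basis.reindex_apply, Equiv.symm_apply_apply, hb,
      map_add, map_smul, Basis.repr_self, Basis.repr_reindex, Finsupp.mapDomain_equiv_apply,
      Finsupp.add_apply, Finsupp.smul_apply, Finsupp.single_apply, smul_eq_mul, mul_ite, mul_one,
      mul_zero, φ.injective.eq_iff]
    congr 1
    · simp only [eq_comm]
    · split_ifs with h1 h2
      · simp
      · rw [h2, Basis.repr_self, Finsupp.single_eq_same]
      · rw [Basis.repr_self, Finsupp.single_eq_of_ne h2]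
  refine ⟨J, fun x => c (φ.symm x).1, hP.unit, ⟨fun x => ?_, fun x y hxy => ?_, fun x y hxy hxy' => ?_⟩,
    ?_⟩
  · obtain ⟨⟨i, j⟩, rfl⟩ := φ.surjective x
    simp only [hJ, if_true, Equiv.symm_apply_apply]
    split_ifs with h1 h2
    · simp
    · have := hφ i j h1
      rw [← h2] at this
      omega
    · simp
  · obtain ⟨⟨i, j⟩, rfl⟩ := φ.surjective y
    rw [hJ, if_neg fun h => by rw [h] at hxy; omega, zero_add]
    split_ifs with h1 h2
    · exact Or.inl rfl
    · refine Or.inr ⟨rfl, ?_⟩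
      simp only [h2, Equiv.symm_apply_apply]
    · exact Or.inl rfl
  · obtain ⟨⟨i, j⟩, rfl⟩ := φ.surjective y
    rw [hJ, if_neg hxy.symm, zero_add]
    split_ifs with h1 h2
    · rfl
    · exact absurd (by rw [h2]; exact hφ i j h1) hxy'
    · rfl
  · have h1 := mul_basis_toMatrix (Pi.basisFun E (Fin n)) b' (Pi.basisFun E (Fin n)) A
    have h2 := basis_toMatrix_mul_linearMap_toMatrix (b' := b') (c := Pi.basisFun E (Fin n))
      (c' := b') (f := Matrix.toLin' A)
    rw [IsUnit.unit_spec, h1, h2]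
    rfl

variable {k : Type*} [Field k] [Finite k] {n : ℕ}

theorem nonempty_splitDatum {ψ : AddChar k ℂ} (A : Matrix (Fin n) (Fin n) k) :
    Nonempty (SplitDatum ψ A) := by
  let L := A.charpoly.SplittingField
  have : Finite L := Module.finite_of_finite k
  let E := Shrink.{0} L
  let ε : E ≃ₐ[k] L := Shrink.algEquiv.{0} k L
  have hsp : (A.map (algebraMap k E)).charpoly.Splits := by
    rw [Matrix.charpoly_map]
    have h1 := SplittingField.splits A.charpoly
    have h2 : algebraMap k E = (ε.symm : L →+* E).comp (algebraMap k L) := by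
      ext x
      simp
    rw [h2, ← Polynomial.map_map]
    exact h1.map _
  obtain ⟨J, a, g, hJ, hg⟩ := exists_isJordanForm _ hsp
  -- Composing ψ with a k-linear retraction E → k gives an additive character of E that extends ψ.
  obtain ⟨r, hr⟩ := (Algebra.linearMap k E).exists_leftInverse_of_injective
    (LinearMap.ker_eq_bot.2 (algebraMap k E).injective)
  exact ⟨{  E := E
            finite := inferInstance
            ψE := ψ.compAddMonoidHom r.toAddMonoidHom
            ψE_algebraMap := fun x => congrArg ψ (LinearMap.congr_fun hr x)
            J := J
            a := a
            isJordanForm := hJ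
            g := g
            map_mul_g := hg }⟩

end JordanExists

end

noncomputable section

open Matrix

/-! ### The canonical logarithm on a stabilizer -/

section StabLog

/-- The compositum inside an algebraic closure of E₁. -/
theorem exists_common_extension (k : Type*) [Field k] [Finite k] (E₁ E₂ : Type) [Field E₁]
    [Finite E₁] [Algebra k E₁] [Field E₂] [Finite E₂] [Algebra k E₂] :
    ∃ (Ω : Type) (_ : Field Ω) (_ : Finite Ω) (_ : Algebra k Ω),
      Nonempty (E₁ →ₐ[k] Ω) ∧ Nonempty (E₂ →ₐ[k] Ω) := by
  let i₁ : E₁ →ₐ[k] AlgebraicClosure E₁ := IsScalarTower.toAlgHom k E₁ (AlgebraicClosure E₁)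
  let i₂ : E₂ →ₐ[k] AlgebraicClosure E₁ := IsAlgClosed.lift
  have h₁ : FiniteDimensional k i₁.fieldRange := LinearMap.finiteDimensional_range i₁.toLinearMap
  have h₂ : FiniteDimensional k i₂.fieldRange := LinearMap.finiteDimensional_range i₂.toLinearMap
  let Ω : IntermediateField k (AlgebraicClosure E₁) := i₁.fieldRange ⊔ i₂.fieldRange
  have : FiniteDimensional k Ω := IntermediateField.finiteDimensional_sup _ _
  exact ⟨Ω, inferInstance, Module.finite_of_finite k, inferInstance,
    ⟨(IntermediateField.inclusion le_sup_left).comp i₁.rangeRestrict⟩,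
    ⟨(IntermediateField.inclusion le_sup_right).comp i₂.rangeRestrict⟩⟩

variable {R : Type*} {k : Type*} [CommRing R] [Field k] {n : ℕ} {π : R} {res : R →+* k}

theorem IsLengthTwo.exists_gl_lift {S E : Type*} [CommRing S] [Field E] {π : S} {res : S →+* E}
    (h : IsLengthTwo π res) (g : GL (Fin n) E) :
    ∃ y : GL (Fin n) S, GeneralLinearGroup.map res y = g := by
  choose l hl using h.surjective
  have hm : ((g : Matrix (Fin n) (Fin n) E).map l).map res = g := by
    ext i j
    simp [hl]
  have hu : IsUnit ((g : Matrix (Fin n) (Fin n) E).map l) := by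
    rw [h.matrix_isUnit_iff, hm]
    exact g.isUnit
  exact ⟨hu.unit, Units.ext hm⟩

theorem UnramifiedExt.map_resS_map_ι {E : Type} [Field E] [Algebra k E]
    (L : UnramifiedExt π res E) (y : GL (Fin n) R) :
    (GeneralLinearGroup.map L.resS (GeneralLinearGroup.map L.ι y) : Matrix (Fin n) (Fin n) E) =
      ((y : Matrix (Fin n) (Fin n) R).map res).map (algebraMap k E) := by
  ext i j
  simp [L.resS_ι]

theorem conj_mem_stab {A : Matrix (Fin n) (Fin n) k} {E : Type} [Field E] [Algebra k E]
    {L : UnramifiedExt π res E} {J : Matrix (Fin n) (Fin n) E} {g : GL (Fin n) E}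
    {h : GL (Fin n) L.S}
    (hg : A.map (algebraMap k E) * (g : Matrix (Fin n) (Fin n) E) = g * J)
    (hh : GeneralLinearGroup.map L.resS h = g) {t : GL (Fin n) R} (ht : t ∈ stab res A) :
    h⁻¹ * GeneralLinearGroup.map L.ι t * h ∈ stab L.resS J := by
  have ht' : (t : Matrix (Fin n) (Fin n) R).map res * A =
    A * (t : Matrix (Fin n) (Fin n) R).map res := ht
  have e1 : (GeneralLinearGroup.map L.resS (h⁻¹ * GeneralLinearGroup.map L.ι t * h) :
      Matrix (Fin n) (Fin n) E) = ((g⁻¹ : GL (Fin n) E) : Matrix (Fin n) (Fin n) E) *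
        ((t : Matrix (Fin n) (Fin n) R).map res).map (algebraMap k E) * g := by
    rw [← L.map_resS_map_ι, ← hh, ← map_inv, ← Units.val_mul, ← Units.val_mul, ← map_mul,
      ← map_mul]
  have e2 : J = ((g⁻¹ : GL (Fin n) E) : Matrix (Fin n) (Fin n) E) *
      A.map (algebraMap k E) * g := by
    rw [mul_assoc, hg, ← mul_assoc, ← Units.val_mul, inv_mul_cancel, Units.val_one, one_mul]
  have e3 : ∀ U V : Matrix (Fin n) (Fin n) E,
      ((g⁻¹ : GL (Fin n) E) : Matrix (Fin n) (Fin n) E) * U * g *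
        (((g⁻¹ : GL (Fin n) E) : Matrix (Fin n) (Fin n) E) * V * g) =
      ((g⁻¹ : GL (Fin n) E) : Matrix (Fin n) (Fin n) E) * (U * V) * g := fun U V => by
    simp only [mul_assoc]
    rw [Units.mul_inv_cancel_left]
  change (GeneralLinearGroup.map L.resS (h⁻¹ * GeneralLinearGroup.map L.ι t * h) :
      Matrix (Fin n) (Fin n) E) * J = J * (GeneralLinearGroup.map L.resS
        (h⁻¹ * GeneralLinearGroup.map L.ι t * h) : Matrix (Fin n) (Fin n) E)
  rw [e1, e2, e3, e3, ← Matrix.map_mul, ht', Matrix.map_mul]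

/-- Logarithms of conjugate elements, computed in different unramified extensions. -/
theorem jordanLog_compare (hR : IsLengthTwo π res) {E₁ E₂ : Type} [Field E₁] [Finite E₁]
    [Algebra k E₁] [Field E₂] [Finite E₂] [Algebra k E₂] (L₁ : UnramifiedExt π res E₁)
    (L₂ : UnramifiedExt π res E₂) (τ : E₁ →ₐ[k] E₂) {J₁ : Matrix (Fin n) (Fin n) E₁}
    {J₂ : Matrix (Fin n) (Fin n) E₂} {a₁ : Fin n → E₁} {a₂ : Fin n → E₂}
    (hJ₁ : IsJordanForm J₁ a₁) (hJ₂ : IsJordanForm J₂ a₂) {A₁ A₂ : Matrix (Fin n) (Fin n) k}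
    {g₁ : GL (Fin n) E₁} {g₂ : GL (Fin n) E₂}
    (hg₁ : A₁.map (algebraMap k E₁) * (g₁ : Matrix (Fin n) (Fin n) E₁) = g₁ * J₁)
    (hg₂ : A₂.map (algebraMap k E₂) * (g₂ : Matrix (Fin n) (Fin n) E₂) = g₂ * J₂)
    {h₁ : GL (Fin n) L₁.S} {h₂ : GL (Fin n) L₂.S}
    (hh₁ : GeneralLinearGroup.map L₁.resS h₁ = g₁) (hh₂ : GeneralLinearGroup.map L₂.resS h₂ = g₂)
    {b : k} (hb : b ≠ 0) {x t : GL (Fin n) R}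
    (hx : A₂ * (x : Matrix (Fin n) (Fin n) R).map res =
      b • ((x : Matrix (Fin n) (Fin n) R).map res * A₁))
    (ht : t ∈ stab res A₁) :
    jordanLog (L₂.ι π) L₂.resS L₂.s J₂ a₂
        (h₂⁻¹ * GeneralLinearGroup.map L₂.ι (x * t * x⁻¹) * h₂ : GL (Fin n) L₂.S) =
      algebraMap k E₂ b * τ (jordanLog (L₁.ι π) L₁.resS L₁.s J₁ a₁
        (h₁⁻¹ * GeneralLinearGroup.map L₁.ι t * h₁ : GL (Fin n) L₁.S)) := by
  -- Transport along the lift θ of τ moves everything into the second extension, where only a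
  -- conjugation remains.
  obtain ⟨θ, hθι, hθres, hθs⟩ := hR.exists_lift L₁.isLengthTwo L₂.isLengthTwo L₁.resS_s L₂.resS_s
    L₁.resS_ι L₂.resS_ι τ
  have hι : ∀ y : GL (Fin n) R, GeneralLinearGroup.map θ (GeneralLinearGroup.map L₁.ι y) =
      GeneralLinearGroup.map L₂.ι y := fun y => by
    ext i j
    simp [hθι]
  have hθπ : θ (L₁.ι π) = L₂.ι π := hθι π
  have hlen : IsLengthTwo (θ (L₁.ι π)) L₂.resS := hθπ ▸ L₂.isLengthTwo
  set t₁ := h₁⁻¹ * GeneralLinearGroup.map L₁.ι t * h₁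
  have ht₁ : (t₁ : Matrix (Fin n) (Fin n) L₁.S).map L₁.resS * J₁ =
      J₁ * (t₁ : Matrix (Fin n) (Fin n) L₁.S).map L₁.resS := conj_mem_stab hg₁ hh₁ ht
  have key := jordanLog_map L₁.isLengthTwo hlen L₁.resS_s L₂.resS_s (τ := (τ : E₁ →+* E₂))
    hθres hθs hJ₁ t₁.isUnit ht₁
  rw [AlgHom.coe_toRingHom, hθπ] at key
  rw [← key]
  have ht₂ : ((t₁ : Matrix (Fin n) (Fin n) L₁.S).map θ).map L₂.resS * J₁.map τ =
      J₁.map τ * ((t₁ : Matrix (Fin n) (Fin n) L₁.S).map θ).map L₂.resS := by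
    have e1 : ((t₁ : Matrix (Fin n) (Fin n) L₁.S).map θ).map L₂.resS =
        ((t₁ : Matrix (Fin n) (Fin n) L₁.S).map L₁.resS).map τ := by
      ext i j
      simp [hθres]
    rw [e1, ← Matrix.map_mul, ht₁, Matrix.map_mul]
  -- The composite of h₁, x and h₂⁻¹ modulo π intertwines τ(J₁) and J₂ up to the scalar b, so
  -- `jordanLog_conj` applies to it.
  let v : GL (Fin n) L₂.S := h₂⁻¹ * GeneralLinearGroup.map L₂.ι x * GeneralLinearGroup.map θ h₁
  have hv : J₂ * (v : Matrix (Fin n) (Fin n) L₂.S).map L₂.resS =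
      algebraMap k E₂ b • ((v : Matrix (Fin n) (Fin n) L₂.S).map L₂.resS * J₁.map τ) := by
    have e1 : (v : Matrix (Fin n) (Fin n) L₂.S).map L₂.resS =
        ((g₂⁻¹ : GL (Fin n) E₂) : Matrix (Fin n) (Fin n) E₂) *
          ((x : Matrix (Fin n) (Fin n) R).map res).map (algebraMap k E₂) *
          (g₁ : Matrix (Fin n) (Fin n) E₁).map τ := by
      have e2 : (g₁ : Matrix (Fin n) (Fin n) E₁).map τ =
          GeneralLinearGroup.map L₂.resS (GeneralLinearGroup.map θ h₁) := by
        ext i j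
        simp [← hh₁, hθres]
      rw [← L₂.map_resS_map_ι, e2, ← hh₂, ← map_inv, ← Units.val_mul, ← Units.val_mul, ← map_mul, ← map_mul]
      rfl
    have e2 : J₂ * ((g₂⁻¹ : GL (Fin n) E₂) : Matrix (Fin n) (Fin n) E₂) =
        ((g₂⁻¹ : GL (Fin n) E₂) : Matrix (Fin n) (Fin n) E₂) * A₂.map (algebraMap k E₂) := by
      rw [Units.mul_inv_eq_iff_eq_mul, mul_assoc, hg₂, Units.inv_mul_cancel_left]
    have e3 : A₂.map (algebraMap k E₂) *
        ((x : Matrix (Fin n) (Fin n) R).map res).map (algebraMap k E₂) =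
        algebraMap k E₂ b • (((x : Matrix (Fin n) (Fin n) R).map res).map (algebraMap k E₂) *
          A₁.map (algebraMap k E₂)) := by
      rw [← Matrix.map_mul, hx, ← Matrix.map_mul]
      ext i j
      exact map_mul (algebraMap k E₂) _ _
    have e4 : A₁.map (algebraMap k E₂) * (g₁ : Matrix (Fin n) (Fin n) E₁).map τ =
        (g₁ : Matrix (Fin n) (Fin n) E₁).map τ * J₁.map τ := by
      have : A₁.map (algebraMap k E₂) = (A₁.map (algebraMap k E₁)).map τ := by
        ext i j
        simp
      rw [this, ← Matrix.map_mul, hg₁, Matrix.map_mul]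
    rw [e1, ← mul_assoc, ← mul_assoc, e2, mul_assoc (_ * _) (_) (J₁.map τ), ← e4,
      mul_assoc _ (A₂.map _), e3]
    simp only [mul_assoc, mul_smul_comm, smul_mul_assoc]
  have hconj : ((h₂⁻¹ * GeneralLinearGroup.map L₂.ι (x * t * x⁻¹) * h₂ : GL (Fin n) L₂.S) :
      Matrix (Fin n) (Fin n) L₂.S) = (v : Matrix (Fin n) (Fin n) L₂.S) *
        (t₁ : Matrix (Fin n) (Fin n) L₁.S).map θ *
        ((v⁻¹ : GL (Fin n) L₂.S) : Matrix (Fin n) (Fin n) L₂.S) := by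
    have : h₂⁻¹ * GeneralLinearGroup.map L₂.ι (x * t * x⁻¹) * h₂ =
        v * GeneralLinearGroup.map θ t₁ * v⁻¹ := by
      simp only [v, t₁, map_mul, map_inv, hι]
      group
    rw [this]
    rfl
  rw [hconj]
  exact jordanLog_conj L₂.isLengthTwo L₂.resS_s (hJ₁.map (τ : E₁ →+* E₂)) hJ₂
    (by simpa using hb) hv (by rw [← Units.val_mul, mul_inv_cancel, Units.val_one])
    (by simpa using t₁.isUnit.map θ.mapMatrix) ht₂

variable [Finite R]

/-- The logarithm on `T(ψ_A)`, computed with a Jordan form of `A` over some unramified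
extension, does not depend on the choices. -/
theorem IsLengthTwo.exists_stabLog (hR : IsLengthTwo π res) (A : Matrix (Fin n) (Fin n) k)
    (t : stab res A) :
    ∃ y : k, ∀ (E : Type) [Field E] [Finite E] [Algebra k E] (L : UnramifiedExt π res E)
      (J : Matrix (Fin n) (Fin n) E) (a : Fin n → E) (g : GL (Fin n) E) (h : GL (Fin n) L.S),
      IsJordanForm J a → A.map (algebraMap k E) * (g : Matrix (Fin n) (Fin n) E) = g * J →
      GeneralLinearGroup.map L.resS h = g →
      jordanLog (L.ι π) L.resS L.s J a
        (h⁻¹ * GeneralLinearGroup.map L.ι (t : GL (Fin n) R) * h : GL (Fin n) L.S) =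
        algebraMap k E y := by
  have : Finite k := Finite.of_surjective _ hR.surjective
  have hcmp := fun {E₁ E₂ : Type} [Field E₁] [Finite E₁] [Algebra k E₁] [Field E₂] [Finite E₂]
    [Algebra k E₂] (L₁ : UnramifiedExt π res E₁)
    (L₂ : UnramifiedExt π res E₂) (τ : E₁ →ₐ[k] E₂) {J₁ : Matrix (Fin n) (Fin n) E₁}
    {J₂ : Matrix (Fin n) (Fin n) E₂} {a₁ : Fin n → E₁} {a₂ : Fin n → E₂}
    (hJ₁ : IsJordanForm J₁ a₁) (hJ₂ : IsJordanForm J₂ a₂)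
    {g₁ : GL (Fin n) E₁} {g₂ : GL (Fin n) E₂}
    (hg₁ : A.map (algebraMap k E₁) * (g₁ : Matrix (Fin n) (Fin n) E₁) = g₁ * J₁)
    (hg₂ : A.map (algebraMap k E₂) * (g₂ : Matrix (Fin n) (Fin n) E₂) = g₂ * J₂)
    {h₁ : GL (Fin n) L₁.S} {h₂ : GL (Fin n) L₂.S}
    (hh₁ : GeneralLinearGroup.map L₁.resS h₁ = g₁)
    (hh₂ : GeneralLinearGroup.map L₂.resS h₂ = g₂) => by
      have := jordanLog_compare hR L₁ L₂ τ hJ₁ hJ₂ hg₁ hg₂ hh₁ hh₂ (b := 1) one_ne_zero (x := 1)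
        (t := t) (by simp) t.2
      rwa [one_mul, inv_one, mul_one, map_one, one_mul] at this
  obtain ⟨D⟩ := nonempty_splitDatum (ψ := 1) A
  obtain ⟨L₀⟩ := hR.nonempty_unramifiedExt D.E
  obtain ⟨h₀, hh₀⟩ := L₀.isLengthTwo.exists_gl_lift D.g
  -- Comparing the chosen splitting with itself along a Galois automorphism shows that the value is
  -- fixed, hence lies in k.
  obtain ⟨y, hy⟩ := (IsGalois.mem_range_algebraMap_iff_fixed (F := k)
    (jordanLog (L₀.ι π) L₀.resS L₀.s D.J D.a
      (h₀⁻¹ * GeneralLinearGroup.map L₀.ι (t : GL (Fin n) R) * h₀ : GL (Fin n) L₀.S))).2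
    fun σ => (hcmp L₀ L₀ σ.toAlgHom D.isJordanForm D.isJordanForm D.map_mul_g D.map_mul_g
      hh₀ hh₀).symm
  refine ⟨y, fun E _ _ _ L J a g h hJ hg hh => ?_⟩
  -- Any other splitting is compared with the chosen one over a common extension field.
  obtain ⟨Ω, _, _, _, ⟨τ⟩, ⟨τ₀⟩⟩ := exists_common_extension k E D.E
  obtain ⟨LΩ⟩ := hR.nonempty_unramifiedExt Ω
  obtain ⟨hΩ, hhΩ⟩ := LΩ.isLengthTwo.exists_gl_lift (GeneralLinearGroup.map (τ : E →+* Ω) g)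
  have hgΩ : A.map (algebraMap k Ω) *
      (GeneralLinearGroup.map (τ : E →+* Ω) g : Matrix (Fin n) (Fin n) Ω) =
      (GeneralLinearGroup.map (τ : E →+* Ω) g : Matrix (Fin n) (Fin n) Ω) * J.map τ := by
    have : A.map (algebraMap k Ω) = (A.map (algebraMap k E)).map τ := by
      ext i j
      simp
    change A.map (algebraMap k Ω) * (g : Matrix (Fin n) (Fin n) E).map τ =
      (g : Matrix (Fin n) (Fin n) E).map τ * J.map τ
    rw [this, ← Matrix.map_mul, hg, Matrix.map_mul]
  have e1 := hcmp L LΩ τ hJ (hJ.map (τ : E →+* Ω)) hg hgΩ hh hhΩ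
  have e2 := hcmp L₀ LΩ τ₀ D.isJordanForm (hJ.map (τ : E →+* Ω)) D.map_mul_g hgΩ hh₀ hhΩ
  apply (τ : E →+* Ω).injective
  rw [AlgHom.coe_toRingHom, ← e1, e2, ← hy, τ₀.commutes, τ.commutes]

/-- The canonical logarithm on `T(ψ_A)`. -/
def IsLengthTwo.stabLog (hR : IsLengthTwo π res) (A : Matrix (Fin n) (Fin n) k)
    (t : stab res A) : k :=
  (hR.exists_stabLog A t).choose

variable (hR : IsLengthTwo π res) {A : Matrix (Fin n) (Fin n) k}

theorem IsLengthTwo.jordanLog_eq_stabLog (t : stab res A) {E : Type} [Field E] [Finite E]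
    [Algebra k E] {L : UnramifiedExt π res E}
    {J : Matrix (Fin n) (Fin n) E} {a : Fin n → E} {g : GL (Fin n) E} {h : GL (Fin n) L.S}
    (hJ : IsJordanForm J a)
    (hg : A.map (algebraMap k E) * (g : Matrix (Fin n) (Fin n) E) = g * J)
    (hh : GeneralLinearGroup.map L.resS h = g) :
    jordanLog (L.ι π) L.resS L.s J a
      (h⁻¹ * GeneralLinearGroup.map L.ι (t : GL (Fin n) R) * h : GL (Fin n) L.S) =
      algebraMap k E (hR.stabLog A t) :=
  (hR.exists_stabLog A t).choose_spec E L J a g h hJ hg hh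

end StabLog

end

/-! ### Canonical extensions of ψ_A and constructed extensions. -/

noncomputable section

open Matrix

section CanonicalExtension

variable {R : Type*} {k : Type*} [CommRing R] [Field k] {n : ℕ} {π : R} {res : R →+* k}

theorem map_sum_addChar {G ι : Type*} [AddCommMonoid G] (ψ : AddChar G ℂ) (s : Finset ι) (f : ι → G) :
    ψ (∑ i ∈ s, f i) = ∏ i ∈ s, ψ (f i) := by
  classical
  induction s using Finset.induction_on with
  | empty => simp
  | insert i s hi ih => rw [Finset.sum_insert hi, Finset.prod_insert hi, AddChar.map_add_eq_mul, ih]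

namespace IsLengthTwo

theorem stabRed_surjective (hR : IsLengthTwo π res) (A : Matrix (Fin n) (Fin n) k) :
    Function.Surjective (stabRed res A) := by
  rintro ⟨g, hg⟩
  obtain ⟨y, rfl⟩ := hR.exists_gl_lift g
  exact ⟨⟨y, hg⟩, rfl⟩

/-- A character of `T(ψ_A)` that is trivial on the kernel of reduction is inflated from the
centralizer. -/
theorem exists_comp_stabRed (hR : IsLengthTwo π res) {A : Matrix (Fin n) (Fin n) k}
    (χ : stab res A →* ℂˣ) (hχ : ∀ t, stabRed res A t = 1 → χ t = 1) :
    ∃ μ : matCentralizer A →* ℂˣ, χ = μ.comp (stabRed res A) :=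
  ⟨(stabRed res A).liftOfSurjective (hR.stabRed_surjective A) ⟨χ, fun t ht => hχ t ht⟩,
    ((stabRed res A).liftOfRightInverse_comp _ (Function.rightInverse_surjInv _)
      ⟨χ, fun t ht => hχ t ht⟩).symm⟩

theorem exists_eq_one_add_of_stabRed_eq_one (hR : IsLengthTwo π res)
    {A : Matrix (Fin n) (Fin n) k} {t : stab res A} (ht : stabRed res A t = 1) :
    ∃ X, ((t : GL (Fin n) R) : Matrix (Fin n) (Fin n) R) = 1 + π • X := by
  refine hR.matrix_exists_eq_add ?_
  rw [Matrix.map_one _ (map_zero res) (map_one res)]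
  exact congrArg (fun g : matCentralizer A => ((g : GL (Fin n) k) : Matrix (Fin n) (Fin n) k)) ht

/-- Two extensions of `ψ_A` differ by a character of the centralizer. -/
theorem exists_eq_mul_of_isExtension (hR : IsLengthTwo π res) {ψ : AddChar k ℂ}
    {A : Matrix (Fin n) (Fin n) k} {χ₁ χ₂ : stab res A →* ℂˣ}
    (h₁ : IsExtension π res ψ A χ₁) (h₂ : IsExtension π res ψ A χ₂) :
    ∃ μ : matCentralizer A →* ℂˣ, χ₂ = χ₁ * μ.comp (stabRed res A) := by
  obtain ⟨μ, hμ⟩ := hR.exists_comp_stabRed (χ₁⁻¹ * χ₂) fun t ht => by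
    obtain ⟨X, hX⟩ := hR.exists_eq_one_add_of_stabRed_eq_one ht
    rw [MonoidHom.mul_apply, MonoidHom.inv_apply, inv_mul_eq_one]
    exact Units.ext ((h₁ t X hX).trans (h₂ t X hX).symm)
  exact ⟨μ, by
    rw [← hμ]
    ext t
    simp⟩

theorem isExtension_mul (hR : IsLengthTwo π res) {ψ : AddChar k ℂ}
    {A : Matrix (Fin n) (Fin n) k} {χ : stab res A →* ℂˣ} (h : IsExtension π res ψ A χ)
    (μ : matCentralizer A →* ℂˣ) : IsExtension π res ψ A (χ * μ.comp (stabRed res A)) := by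
  intro t X hX
  have : stabRed res A t = 1 := Subtype.ext (Units.ext (by
    change ((t : GL (Fin n) R) : Matrix (Fin n) (Fin n) R).map res = 1
    rw [hX, hR.map_one_add]))
  simp [this, h t X hX]

variable [Finite R] (hR : IsLengthTwo π res) {A : Matrix (Fin n) (Fin n) k}

/-- A splitting field of the characteristic polynomial of `A`, with a Jordan form over it. -/
theorem exists_split (hR : IsLengthTwo π res) (ψ : AddChar k ℂ) (A : Matrix (Fin n) (Fin n) k) :
    ∃ (D : SplitDatum ψ A) (L : UnramifiedExt π res D.E) (h : GL (Fin n) L.S),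
      GeneralLinearGroup.map L.resS h = D.g := by
  have : Finite k := Finite.of_surjective _ hR.surjective
  obtain ⟨D⟩ := nonempty_splitDatum (ψ := ψ) A
  obtain ⟨L⟩ := hR.nonempty_unramifiedExt D.E
  obtain ⟨h, hh⟩ := L.isLengthTwo.exists_gl_lift D.g
  exact ⟨D, L, h, hh⟩

theorem stabLog_mul (t₁ t₂ : stab res A) :
    hR.stabLog A (t₁ * t₂) = hR.stabLog A t₁ + hR.stabLog A t₂ := by
  obtain ⟨D, L, h, hh⟩ := hR.exists_split 1 A
  apply (algebraMap k D.E).injective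
  rw [map_add, ← hR.jordanLog_eq_stabLog _ D.isJordanForm D.map_mul_g hh,
    ← hR.jordanLog_eq_stabLog _ D.isJordanForm D.map_mul_g hh,
    ← hR.jordanLog_eq_stabLog _ D.isJordanForm D.map_mul_g hh,
    ← L.isLengthTwo.jordanLog_mul L.resS_s D.isJordanForm (Units.isUnit _) (Units.isUnit _)
      (conj_mem_stab D.map_mul_g hh t₁.2) (conj_mem_stab D.map_mul_g hh t₂.2), ← Units.val_mul]
  congr 2
  rw [Subgroup.coe_mul, map_mul]
  group

/-- Over a splitting field the value is Tr(J g⁻¹ X̄ g), which is Tr(A X̄) because g J = A g. -/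
theorem stabLog_one_add {t : stab res A} {X : Matrix (Fin n) (Fin n) R}
    (ht : ((t : GL (Fin n) R) : Matrix (Fin n) (Fin n) R) = 1 + π • X) :
    hR.stabLog A t = trace (A * X.map res) := by
  obtain ⟨D, L, h, hh⟩ := hR.exists_split 1 A
  apply (algebraMap k D.E).injective
  rw [← hR.jordanLog_eq_stabLog _ D.isJordanForm D.map_mul_g hh]
  have e1 : ((h⁻¹ * GeneralLinearGroup.map L.ι (t : GL (Fin n) R) * h : GL (Fin n) L.S) :
      Matrix (Fin n) (Fin n) L.S) = 1 + L.ι π •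
        (((h⁻¹ : GL (Fin n) L.S) : Matrix (Fin n) (Fin n) L.S) * X.map L.ι * h) := by
    have e2 : (GeneralLinearGroup.map L.ι (t : GL (Fin n) R) : Matrix (Fin n) (Fin n) L.S) =
        1 + L.ι π • X.map L.ι := by
      change ((t : GL (Fin n) R) : Matrix (Fin n) (Fin n) R).map L.ι = _
      rw [ht, Matrix.map_add _ (map_add L.ι), Matrix.map_one _ (map_zero L.ι) (map_one L.ι)]
      congr 1
      ext i j
      exact map_mul L.ι _ _
    rw [Units.val_mul, Units.val_mul, e2, mul_add, mul_one, add_mul, Units.inv_mul, mul_smul_comm,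
      smul_mul_assoc]
  have e3 : (h : Matrix (Fin n) (Fin n) L.S).map L.resS = D.g := by
    rw [← hh]
    rfl
  have e4 : ((h⁻¹ : GL (Fin n) L.S) : Matrix (Fin n) (Fin n) L.S).map L.resS =
      ((D.g⁻¹ : GL (Fin n) D.E) : Matrix (Fin n) (Fin n) D.E) := by
    rw [← hh, ← map_inv]
    rfl
  have e5 : (X.map L.ι).map L.resS = (X.map res).map (algebraMap k D.E) := by
    ext i j
    simp [L.resS_ι]
  rw [e1, L.isLengthTwo.jordanLog_one_add L.resS_s D.isJordanForm, Matrix.map_mul, Matrix.map_mul,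
    e3, e4, e5, trace_mul_comm, mul_assoc, ← D.map_mul_g, ← mul_assoc, trace_mul_comm, ← mul_assoc,
    ← mul_assoc, Units.mul_inv, one_mul, ← Matrix.map_mul, trace_mul_comm A,
    ← AddMonoidHom.coe_coe (algebraMap k D.E), AddMonoidHom.map_trace]

/-- The scalar b is what later absorbs a change of ψ: replacing ψ₀ by x ↦ ψ₀(bx) amounts to
replacing A by a conjugate of bA. -/
theorem stabLog_conj {A₁ A₂ : Matrix (Fin n) (Fin n) k} {b : k} (hb : b ≠ 0) {x : GL (Fin n) R}
    (hx : A₂ * (x : Matrix (Fin n) (Fin n) R).map res =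
      b • ((x : Matrix (Fin n) (Fin n) R).map res * A₁)) (t₁ : stab res A₁) (t₂ : stab res A₂)
    (ht : (t₂ : GL (Fin n) R) = x * t₁ * x⁻¹) :
    hR.stabLog A₂ t₂ = b * hR.stabLog A₁ t₁ := by
  have : Finite k := Finite.of_surjective _ hR.surjective
  obtain ⟨D₁, L₁, h₁, hh₁⟩ := hR.exists_split 1 A₁
  obtain ⟨D₂, L₂, h₂, hh₂⟩ := hR.exists_split 1 A₂
  obtain ⟨Ω, _, _, _, ⟨τ₁⟩, ⟨τ₂⟩⟩ := exists_common_extension k D₁.E D₂.E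
  obtain ⟨L⟩ := hR.nonempty_unramifiedExt Ω
  obtain ⟨h, hh⟩ := L.isLengthTwo.exists_gl_lift (GeneralLinearGroup.map (τ₂ : D₂.E →+* Ω) D₂.g)
  have hg : A₂.map (algebraMap k Ω) *
      (GeneralLinearGroup.map (τ₂ : D₂.E →+* Ω) D₂.g : Matrix (Fin n) (Fin n) Ω) =
      (GeneralLinearGroup.map (τ₂ : D₂.E →+* Ω) D₂.g : Matrix (Fin n) (Fin n) Ω) *
        D₂.J.map τ₂ := by
    have : A₂.map (algebraMap k Ω) = (A₂.map (algebraMap k D₂.E)).map τ₂ := by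
      ext i j
      simp
    change A₂.map (algebraMap k Ω) * (D₂.g : Matrix (Fin n) (Fin n) D₂.E).map τ₂ =
      (D₂.g : Matrix (Fin n) (Fin n) D₂.E).map τ₂ * D₂.J.map τ₂
    rw [this, ← Matrix.map_mul, D₂.map_mul_g, Matrix.map_mul]
  have hJ := D₂.isJordanForm.map (τ₂ : D₂.E →+* Ω)
  apply (algebraMap k Ω).injective
  have key := jordanLog_compare hR L₁ L τ₁ D₁.isJordanForm hJ D₁.map_mul_g hg hh₁ hh hb hx t₁.2
  rw [← hR.jordanLog_eq_stabLog t₂ hJ hg hh, ht, key, hR.jordanLog_eq_stabLog t₁ D₁.isJordanForm D₁.map_mul_g hh₁, τ₁.commutes, map_mul]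

/-- The canonical extension `ψ ∘ stabLog` of `ψ_A` to `T(ψ_A)`. -/
def canonExt (ψ : AddChar k ℂ) (A : Matrix (Fin n) (Fin n) k) : stab res A →* ℂˣ :=
  MonoidHom.toHomUnits (MonoidHom.mk' (M := stab res A) (G := Multiplicative k)
    (fun t => Multiplicative.ofAdd (hR.stabLog A t)) (fun t₁ t₂ => by
      rw [hR.stabLog_mul, ofAdd_add]) |> ψ.toMonoidHom.comp)

theorem canonExt_apply (ψ : AddChar k ℂ) (t : stab res A) :
    (hR.canonExt ψ A t : ℂ) = ψ (hR.stabLog A t) := rfl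

theorem isExtension_canonExt (ψ : AddChar k ℂ) (A : Matrix (Fin n) (Fin n) k) :
    IsExtension π res ψ A (hR.canonExt ψ A) := fun t X ht => by
  rw [canonExt_apply, hR.stabLog_one_add ht]

/-- A constructed extension is the canonical extension times an explicit character of the
centralizer. -/
theorem apply_eq_of_isConstructed {ψ : AddChar k ℂ} {D : SplitDatum ψ A}
    {L : UnramifiedExt π res D.E} {η : D.E → MulChar L.S ℂ}
    (hη : ∀ e x, η e (1 + L.ι π * x) = D.ψE (e * L.resS x)) {χ : stab res A →* ℂˣ}
    (hχ : IsConstructed π res D L η χ) (t : stab res A) :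
    (χ t : ℂ) = hR.canonExt ψ A t * ∏ e ∈ (open Classical in Finset.univ.image D.a), η e (L.s
      (blockDet D.a e (((D.g⁻¹ : GL (Fin n) D.E) : Matrix (Fin n) (Fin n) D.E) *
        (((t : GL (Fin n) R) : Matrix (Fin n) (Fin n) R).map res).map (algebraMap k D.E) *
        D.g))) := by
  classical
  obtain ⟨χS, h1, h2, h3⟩ := hχ
  have hL := L.isLengthTwo
  obtain ⟨h, hh⟩ := hL.exists_gl_lift D.g
  let z : stab L.resS D.J := ⟨_, conj_mem_stab D.map_mul_g hh t.2⟩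
  have hz : ((z : GL (Fin n) L.S) : Matrix (Fin n) (Fin n) L.S).map L.resS * D.J =
    D.J * ((z : GL (Fin n) L.S) : Matrix (Fin n) (Fin n) L.S).map L.resS := z.2
  have hzr : ((z : GL (Fin n) L.S) : Matrix (Fin n) (Fin n) L.S).map L.resS =
      ((D.g⁻¹ : GL (Fin n) D.E) : Matrix (Fin n) (Fin n) D.E) *
        (((t : GL (Fin n) R) : Matrix (Fin n) (Fin n) R).map res).map (algebraMap k D.E) * D.g := by
    rw [← L.map_resS_map_ι, ← hh, ← map_inv, ← Units.val_mul, ← Units.val_mul, ← map_mul,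
      ← map_mul]
    rfl
  -- In z = z₀(1 + πX), the two defining properties of χS evaluate it on z₀ and on 1 + πX
  -- respectively.
  obtain ⟨hu, hc, X, hX⟩ := hL.exists_eq_mul_of_comm L.resS_s D.isJordanForm
    (Units.isUnit (z : GL (Fin n) L.S)) hz
  rw [h3 t h z hh (by simp [z, mul_assoc]), ← hzr, canonExt_apply, ← D.ψE_algebraMap,
    ← hR.jordanLog_eq_stabLog t D.isJordanForm D.map_mul_g hh]
  change (χS z : ℂ) = D.ψE (jordanLog (L.ι π) L.resS L.s D.J D.a
    ((z : GL (Fin n) L.S) : Matrix (Fin n) (Fin n) L.S)) * _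
  have hz₀r : ((((z : GL (Fin n) L.S) : Matrix (Fin n) (Fin n) L.S).map L.resS).map L.s).map L.resS =
    ((z : GL (Fin n) L.S) : Matrix (Fin n) (Fin n) L.S).map L.resS := map_section_map L.resS_s _
  let z₀ : stab L.resS D.J := ⟨hu.unit, by
    change (((z : GL (Fin n) L.S) : Matrix (Fin n) (Fin n) L.S).map L.resS |>.map L.s).map L.resS *
      D.J = D.J * (((z : GL (Fin n) L.S) : Matrix (Fin n) (Fin n) L.S).map L.resS |>.map L.s).map L.resS
    rw [hz₀r]
    exact hz⟩
  let y : stab L.resS D.J := ⟨(hL.isUnit_one_add X).unit, by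
    change (1 + L.ι π • X).map L.resS * D.J = D.J * (1 + L.ι π • X).map L.resS
    rw [hL.map_one_add, one_mul, mul_one]⟩
  have hzy : z = z₀ * y := Subtype.ext (Units.ext hX)
  have hzu : ∀ e, L.resS (blockDet D.a e ((z₀ : GL (Fin n) L.S) : Matrix (Fin n) (Fin n) L.S)) =
      blockDet D.a e (((z : GL (Fin n) L.S) : Matrix (Fin n) (Fin n) L.S).map L.resS) := fun e => by
    rw [← blockDet_map]
    congr 1
  rw [hzy, map_mul, Units.val_mul, h1 y X rfl, h2 z₀ hc]
  have e1 : jordanLog (L.ι π) L.resS L.s D.J D.a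
      ((z₀ * y : stab L.resS D.J) : GL (Fin n) L.S) = trace (D.J * X.map L.resS) +
        blockLog (L.ι π) L.resS L.s D.a ((z₀ : GL (Fin n) L.S) : Matrix (Fin n) (Fin n) L.S) :=
    hL.jordanLog_eq L.resS_s D.isJordanForm hu hc X
  rw [e1, AddChar.map_add_eq_mul, mul_assoc, mul_comm, ← hzy]
  congr 1
  -- Each block determinant is s(u)(1 + πw). The factor 1 + πw accounts for the canonical extension
  -- and s(u) for the correction.
  rw [blockLog, map_sum_addChar, ← Finset.prod_mul_distrib]
  refine Finset.prod_congr rfl fun e _ => ?_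
  rw [← blockDet_eq_det_toSquareBlock (z := ((z₀ : GL (Fin n) L.S) : Matrix (Fin n) (Fin n) L.S))
    (hL.eigProj_comm L.resS_s D.isJordanForm hc e), ← hzu]
  have hne : L.resS (blockDet D.a e ((z₀ : GL (Fin n) L.S) : Matrix (Fin n) (Fin n) L.S)) ≠ 0 :=
    hL.res_blockDet_ne_zero L.resS_s D.isJordanForm hu hc e
  obtain ⟨w, hw⟩ := hL.exists_eq_section_mul L.resS_s hne
  have e2 := hL.unitLog_section_mul L.resS_s hne w
  rw [← hw] at e2
  rw [e2, ← hη, mul_comm, ← map_mul, ← hw]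

/-- The character of the units of `S` with `s u * (1 + π x) ↦ ψ (e * x)`. -/
def logMulChar {S E : Type*} [CommRing S] [Field E] {π : S} {res : S →+* E}
    (h : IsLengthTwo π res) {s : E →*₀ S} (hs : ∀ x, res (s x) = x) (ψ : AddChar E ℂ) (e : E) :
    MulChar S ℂ :=
  MulChar.ofUnitHom (MonoidHom.toHomUnits
    { toFun := fun u => ψ (e * unitLog π res s (u : S))
      map_one' := by
        rw [Units.val_one, ← map_one s, h.unitLog_section hs, mul_zero, AddChar.map_zero_eq_one]
      map_mul' := fun u v => by
        rw [Units.val_mul, h.unitLog_mul hs ((h.isUnit_iff _).1 u.isUnit)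
          ((h.isUnit_iff _).1 v.isUnit), mul_add, AddChar.map_add_eq_mul] })

theorem logMulChar_apply {S E : Type*} [CommRing S] [Field E] {π : S} {res : S →+* E}
    (h : IsLengthTwo π res) {s : E →*₀ S} (hs : ∀ x, res (s x) = x) (ψ : AddChar E ℂ) (e : E)
    {y : S} (hy : res y ≠ 0) : h.logMulChar hs ψ e y = ψ (e * unitLog π res s y) := by
  obtain ⟨u, rfl⟩ := (h.isUnit_iff y).2 hy
  exact MulChar.ofUnitHom_coe _ u

/-- The canonical extension arises from the characters η_e that are trivial on the values of s at
nonzero elements. -/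
theorem isConstructed_canonExt {ψ : AddChar k ℂ} (D : SplitDatum ψ A)
    (L : UnramifiedExt π res D.E) :
    IsConstructed π res D L (L.isLengthTwo.logMulChar L.resS_s D.ψE) (hR.canonExt ψ A) := by
  classical
  have hL := L.isLengthTwo
  have hmem : ∀ z : stab L.resS D.J, ((z : GL (Fin n) L.S) : Matrix (Fin n) (Fin n) L.S).map L.resS *
    D.J = D.J * ((z : GL (Fin n) L.S) : Matrix (Fin n) (Fin n) L.S).map L.resS := fun z => z.2
  let χS : stab L.resS D.J →* ℂˣ := MonoidHom.toHomUnits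
    { toFun := fun z => D.ψE (jordanLog (L.ι π) L.resS L.s D.J D.a
        ((z : GL (Fin n) L.S) : Matrix (Fin n) (Fin n) L.S))
      map_one' := by
        have := hL.jordanLog_one_add L.resS_s D.isJordanForm 0
        simp only [smul_zero, add_zero] at this
        rw [Subgroup.coe_one, Units.val_one, this]
        simp
      map_mul' := fun z₁ z₂ => by
        rw [Subgroup.coe_mul, Units.val_mul, hL.jordanLog_mul L.resS_s D.isJordanForm
          (Units.isUnit _) (Units.isUnit _) (hmem z₁) (hmem z₂), AddChar.map_add_eq_mul] }
  have hχS : ∀ z, (χS z : ℂ) = D.ψE (jordanLog (L.ι π) L.resS L.s D.J D.a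
        ((z : GL (Fin n) L.S) : Matrix (Fin n) (Fin n) L.S)) := fun z => rfl
  refine ⟨χS, fun z X hz => ?_, fun z hz => ?_, fun t h z hh hz => Units.ext ?_⟩
  · rw [hχS, hz, hL.jordanLog_one_add L.resS_s D.isJordanForm]
  · rw [hχS, hL.jordanLog_of_comm L.resS_s D.isJordanForm (Units.isUnit _) hz, blockLog,
      map_sum_addChar]
    refine Finset.prod_congr rfl fun e _ => ?_
    rw [← blockDet_eq_det_toSquareBlock (hL.eigProj_comm L.resS_s D.isJordanForm hz e),
      logMulChar_apply _ _ _ _ (hL.res_blockDet_ne_zero L.resS_s D.isJordanForm (Units.isUnit _) hz e)]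
  · rw [hχS, hR.canonExt_apply, ← D.ψE_algebraMap,
      ← hR.jordanLog_eq_stabLog t D.isJordanForm D.map_mul_g hh]
    congr 3
    rw [mul_assoc, hz, inv_mul_cancel_left]

/-! ### Matched extensions -/

variable {R' : Type*} [CommRing R'] [Finite R'] {π' : R'} {res' : R' →+* k}
  (hR' : IsLengthTwo π' res')

/-- The characters s(u)(1 + πx) ↦ ψ_E(e x̄) on the two sides correspond, as they depend on x̄ alone.
-/
theorem isBasicMatch_canonExt (ψ : AddChar k ℂ) (A : Matrix (Fin n) (Fin n) k) :
    IsBasicMatch π res π' res' ψ A (hR.canonExt ψ A) (hR'.canonExt ψ A) := by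
  obtain ⟨D, L, -⟩ := hR.exists_split ψ A
  obtain ⟨L'⟩ := hR'.nonempty_unramifiedExt D.E
  have hL := L.isLengthTwo
  have hL' := L'.isLengthTwo
  refine ⟨D, L, L', _, _, fun e x => ?_, fun e u x x' hx => ?_, hR.isConstructed_canonExt D L,
    hR'.isConstructed_canonExt D L'⟩
  · rw [logMulChar_apply _ _ _ _ (by simp [hL.res_unif]), hL.unitLog_one_add L.resS_s]
  -- The matching condition ranges over all u; at u = 0 both characters are evaluated at 0 and
  -- vanish.
  · by_cases hu : u = 0
    · have : Nontrivial L.S := hL.surjective.nontrivial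
      have : Nontrivial L'.S := hL'.surjective.nontrivial
      rw [hu, map_zero, map_zero, zero_mul, zero_mul, MulChar.map_nonunit _ not_isUnit_zero,
        MulChar.map_nonunit _ not_isUnit_zero]
    · rw [logMulChar_apply _ _ _ _ (by simp [hL.res_unif, L.resS_s, hu]),
        logMulChar_apply _ _ _ _ (by simp [hL'.res_unif, L'.resS_s, hu]),
        hL.unitLog_section_mul L.resS_s hu, hL'.unitLog_section_mul L'.resS_s hu, hx]

/-- By `apply_eq_of_isConstructed` the quotient by the canonical extension depends on t̄ and the
values η_e(s(u)) only, and those equal η'_e(s'(u)). -/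
theorem exists_eq_mul_of_isBasicMatch {ψ : AddChar k ℂ} {A : Matrix (Fin n) (Fin n) k}
    {χ : stab res A →* ℂˣ} {χ' : stab res' A →* ℂˣ}
    (h : IsBasicMatch π res π' res' ψ A χ χ') :
    ∃ μ : matCentralizer A →* ℂˣ, χ = hR.canonExt ψ A * μ.comp (stabRed res A) ∧
      χ' = hR'.canonExt ψ A * μ.comp (stabRed res' A) := by
  classical
  obtain ⟨D, L, L', η, η', hη, hηη', hχ, hχ'⟩ := h
  have hη' : ∀ e x, η' e (1 + L'.ι π' * x) = D.ψE (e * L'.resS x) := by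
    intro e x
    obtain ⟨y, hy⟩ := L.isLengthTwo.surjective (L'.resS x)
    have := hηη' e 1 y x hy
    rw [map_one, map_one, one_mul, one_mul] at this
    rw [← this, hη, hy]
  have hs : ∀ e u, η e (L.s u) = η' e (L'.s u) := by
    intro e u
    simpa using hηη' e u 0 0 (by simp)
  have key := hR.apply_eq_of_isConstructed hη hχ
  have key' := hR'.apply_eq_of_isConstructed hη' hχ'
  obtain ⟨μ, hμ⟩ := hR.exists_comp_stabRed ((hR.canonExt ψ A)⁻¹ * χ) fun t ht => by
    obtain ⟨X, hX⟩ := hR.exists_eq_one_add_of_stabRed_eq_one ht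
    rw [MonoidHom.mul_apply, MonoidHom.inv_apply, inv_mul_eq_one]
    refine Units.ext ?_
    rw [key, hX, hR.map_one_add, Matrix.map_one _ (map_zero _) (map_one _), mul_one,
      Units.inv_mul]
    simp [blockDet_one]
  have hχμ : χ = hR.canonExt ψ A * μ.comp (stabRed res A) := by
    rw [← hμ]
    ext t
    simp
  refine ⟨μ, hχμ, ?_⟩
  ext t'
  obtain ⟨t, ht⟩ := hR.stabRed_surjective A (stabRed res' A t')
  have htt' : ((t : GL (Fin n) R) : Matrix (Fin n) (Fin n) R).map res =
      ((t' : GL (Fin n) R') : Matrix (Fin n) (Fin n) R').map res' :=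
    congrArg (fun g : matCentralizer A => ((g : GL (Fin n) k) : Matrix (Fin n) (Fin n) k)) ht
  have e1 := key t
  rw [hχμ, MonoidHom.mul_apply, Units.val_mul] at e1
  rw [key', MonoidHom.mul_apply, Units.val_mul, MonoidHom.comp_apply, ← ht]
  congr 1
  rw [← MonoidHom.comp_apply, mul_left_cancel₀ (Units.ne_zero _) e1, ← htt']
  exact Finset.prod_congr rfl fun e _ => (hs e _).symm

/-- Two extensions are matched if and only if they differ from the canonical extensions by the
same character. -/
theorem isMatched_iff {ψ : AddChar k ℂ} {A : Matrix (Fin n) (Fin n) k}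
    {χ : stab res A →* ℂˣ} {χ' : stab res' A →* ℂˣ} :
    IsMatched π res π' res' ψ A χ χ' ↔
      ∃ μ : matCentralizer A →* ℂˣ, χ = hR.canonExt ψ A * μ.comp (stabRed res A) ∧
        χ' = hR'.canonExt ψ A * μ.comp (stabRed res' A) := by
  constructor
  · rintro ⟨χ₀, χ₀', μ, h, rfl, rfl⟩
    obtain ⟨ν, rfl, rfl⟩ := exists_eq_mul_of_isBasicMatch hR hR' h
    exact ⟨ν * μ, MonoidHom.ext fun t => mul_assoc _ _ _, MonoidHom.ext fun t => mul_assoc _ _ _⟩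
  · rintro ⟨μ, h, h'⟩
    exact ⟨_, _, μ, isBasicMatch_canonExt hR hR' ψ A, h, h'⟩

include hR hR' in
/-- Every extension is matched with exactly one character. -/
theorem exists_unique_isMatched {ψ : AddChar k ℂ} {A : Matrix (Fin n) (Fin n) k}
    {χ : stab res A →* ℂˣ} (hχ : IsExtension π res ψ A χ) :
    ∃ χ' : stab res' A →* ℂˣ, IsExtension π' res' ψ A χ' ∧ IsMatched π res π' res' ψ A χ χ' ∧
      ∀ χ'' : stab res' A →* ℂˣ, IsMatched π res π' res' ψ A χ χ'' → χ'' = χ' := by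
  obtain ⟨μ, hμ⟩ := hR.exists_eq_mul_of_isExtension (hR.isExtension_canonExt ψ A) hχ
  refine ⟨_, hR'.isExtension_mul (hR'.isExtension_canonExt ψ A) μ,
    (isMatched_iff hR hR').2 ⟨μ, hμ, rfl⟩, fun χ'' h => ?_⟩
  -- χ determines its quotient by the canonical extension, and this determines the character of
  -- Z(A), because T(A) maps onto Z(A).
  obtain ⟨ν, h1, rfl⟩ := (isMatched_iff hR hR').1 h
  rw [hμ, mul_right_inj] at h1
  rw [(MonoidHom.cancel_right (hR.stabRed_surjective A)).1 h1]

end IsLengthTwo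

end CanonicalExtension

end

noncomputable section

/-! ### Irreducible and induced representations -/

namespace Representation

section Irreducible

variable {G V W : Type*} [Group G] [AddCommGroup V] [Module ℂ V] [AddCommGroup W] [Module ℂ W]
  {ρ : Representation ℂ G V} {σ : Representation ℂ G W}

theorem isIrreducible_iff_forall_submodule : ρ.IsIrreducible ↔ Nontrivial V ∧
    ∀ U : Submodule ℂ V, (∀ g, ∀ u ∈ U, ρ g u ∈ U) → U = ⊥ ∨ U = ⊤ := by
  constructor
  · intro h
    refine ⟨?_, fun U hU => ?_⟩
    · obtain ⟨x, y, hxy⟩ := exists_pair_ne (Subrepresentation ρ)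
      by_contra hV
      rw [not_nontrivial_iff_subsingleton] at hV
      exact hxy (Subrepresentation.toSubmodule_injective (Subsingleton.elim _ _))
    · exact (IsSimpleOrder.eq_bot_or_eq_top (⟨U, hU⟩ : Subrepresentation ρ)).imp
        (congrArg Subrepresentation.toSubmodule) (congrArg Subrepresentation.toSubmodule)
  · rintro ⟨hV, h⟩
    refine { exists_pair_ne := ⟨⊥, ⊤, fun hbt => ?_⟩, eq_bot_or_eq_top := fun U => ?_ }
    · exact bot_ne_top (α := Submodule ℂ V) (congrArg Subrepresentation.toSubmodule hbt)
    · exact (h U.toSubmodule fun g u hu => U.apply_mem_toSubmodule g hu).imp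
        (fun e => Subrepresentation.toSubmodule_injective e)
        (fun e => Subrepresentation.toSubmodule_injective e)

theorem IsIrreducible.eq_top_of_ne_bot (h : ρ.IsIrreducible) {U : Submodule ℂ V}
    (hU : ∀ g, ∀ u ∈ U, ρ g u ∈ U) (h0 : U ≠ ⊥) : U = ⊤ :=
  ((isIrreducible_iff_forall_submodule.1 h).2 U hU).resolve_left h0

theorem IsIrreducible.nontrivial (h : ρ.IsIrreducible) : Nontrivial V :=
  (isIrreducible_iff_forall_submodule.1 h).1

/-- A linear map that commutes with the action on an irreducible representation is injective
or zero. -/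
theorem IsIrreducible.injective_of_ne_zero (h : ρ.IsIrreducible) {f : V →ₗ[ℂ] W}
    (hf : ∀ g v, f (ρ g v) = σ g (f v)) (h0 : f ≠ 0) : Function.Injective f := by
  have := h
  have := IsIrreducible.injective_or_eq_zero (ρ := ρ) (σ := σ) ⟨f, fun g => LinearMap.ext (hf g)⟩
  refine this.resolve_right fun e => h0 (LinearMap.ext fun v => ?_)
  exact congrArg (fun f : IntertwiningMap ρ σ => f v) e

/-- Schur's lemma. -/
theorem IsIrreducible.nonempty_equiv (hρ : ρ.IsIrreducible) (hσ : σ.IsIrreducible)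
    {f : V →ₗ[ℂ] W} (hf : ∀ g v, f (ρ g v) = σ g (f v)) (h0 : f ≠ 0) :
    Nonempty (ρ.Equiv σ) := by
  refine ⟨IntertwiningMap.ofBijective ⟨f, fun g => LinearMap.ext (hf g)⟩
    ⟨hρ.injective_of_ne_zero hf h0, LinearMap.range_eq_top.1 (hσ.eq_top_of_ne_bot ?_ ?_)⟩⟩
  · rintro g _ ⟨v, rfl⟩
    exact ⟨ρ g v, hf g v⟩
  · rwa [Ne, LinearMap.range_eq_bot]

theorem IsIrreducible.of_equiv (hρ : ρ.IsIrreducible) (e : ρ.Equiv σ) : σ.IsIrreducible := by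
  have hV := hρ.nontrivial
  refine isIrreducible_iff_forall_submodule.2 ⟨e.toLinearEquiv.symm.toEquiv.nontrivial,
    fun U hU => ?_⟩
  refine ((isIrreducible_iff_forall_submodule.1 hρ).2 (U.comap e.toLinearEquiv.toLinearMap)
    fun g u hu => ?_).imp (fun h => ?_) (fun h => ?_)
  · have : e (ρ g u) = σ g (e u) := IntertwiningMap.isIntertwining _ _ e.toIntertwiningMap g u
    change e (ρ g u) ∈ U
    rw [this]
    exact hU g _ hu
  · rw [← Submodule.map_comap_eq_of_surjective (f := e.toLinearEquiv.toLinearMap) e.toLinearEquiv.surjective U,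
      h, Submodule.map_bot]
  · rw [← Submodule.map_comap_eq_of_surjective (f := e.toLinearEquiv.toLinearMap) e.toLinearEquiv.surjective U,
      h, Submodule.map_top, LinearMap.range_eq_top]
    exact e.toLinearEquiv.surjective

theorem IsIrreducible.exists_irrRep [Module.Finite ℂ V] (hρ : ρ.IsIrreducible) :
    ∃ a : IrrRep G, Nonempty (a.ρ.Equiv ρ) := by
  let e : V ≃ₗ[ℂ] (Fin (Module.finrank ℂ V) → ℂ) := (Module.finBasis ℂ V).equivFun
  let τ : Representation ℂ G (Fin (Module.finrank ℂ V) → ℂ) :=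
    { toFun := fun g => e.toLinearMap ∘ₗ ρ g ∘ₗ e.symm.toLinearMap
      map_one' := by
        ext
        simp
      map_mul' := fun g h => by
        refine LinearMap.ext fun v => ?_
        simp }
  let f : ρ.Equiv τ := Representation.Equiv.mk e fun g => LinearMap.ext fun v => by simp [τ]
  exact ⟨⟨_, τ, hρ.of_equiv f⟩, ⟨f.symm⟩⟩

end Irreducible

section Induced

variable {G V W : Type*} [Group G] [AddCommGroup V] [Module ℂ V] [AddCommGroup W] [Module ℂ W]
  {H : Subgroup G} (ρ : Representation ℂ G V) (σ : Representation ℂ H W)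

/-- `ind` is a space of coinvariants of ℂ[G] ⊗ W; this is the relation that they impose. -/
theorem IndV.mk_mul (h : H) (g : G) (w : W) :
    IndV.mk H.subtype σ (h * g) (σ h w) = IndV.mk H.subtype σ g w := by
  have := Coinvariants.mk_self_apply (Representation.tprod ((leftRegular ℂ G).comp H.subtype) σ) h
    (TensorProduct.tmul ℂ (MonoidAlgebra.single g 1) w)
  rw [← LinearMap.comp_apply]
  simpa using this

theorem IndV.mk_one_apply (h : H) (w : W) :
    IndV.mk H.subtype σ 1 (σ h w) = ind H.subtype σ h (IndV.mk H.subtype σ 1 w) := by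
  have := IndV.mk_mul σ h (h : G)⁻¹ w
  rw [ind_mk, one_mul, ← this, mul_inv_cancel]

/-- An invariant submodule of the induced representation that contains the inducing
representation is everything. -/
theorem ind_eq_top_of_range_le {U : Submodule ℂ (IndV H.subtype σ)}
    (hU : ∀ g, ∀ u ∈ U, ind H.subtype σ g u ∈ U)
    (h : LinearMap.range (IndV.mk H.subtype σ 1) ≤ U) : U = ⊤ := by
  rw [← Submodule.ker_mkQ U, LinearMap.ker_eq_top]
  refine IndV.hom_ext _ _ fun g => LinearMap.ext fun w => ?_
  rw [LinearMap.comp_apply, LinearMap.zero_comp, LinearMap.zero_apply]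
  refine (Submodule.Quotient.mk_eq_zero U).2 ?_
  have := hU g⁻¹ _ (h ⟨w, rfl⟩)
  rwa [ind_mk, one_mul, inv_inv] at this

variable {ρ σ}

/-- Frobenius reciprocity. -/
theorem exists_ind_hom {f : W →ₗ[ℂ] V} (hf : ∀ (h : H) w, f (σ h w) = ρ h (f w)) :
    ∃ F : IndV H.subtype σ →ₗ[ℂ] V, (∀ g u, F (ind H.subtype σ g u) = ρ g (F u)) ∧
      ∀ w, F (IndV.mk H.subtype σ 1 w) = f w := by
  -- The class of g ⊗ w must go to ρ(g⁻¹) f(w), since it is the translate by g⁻¹ of the class of 1 ⊗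
  -- w.
  let F₀ : TensorProduct ℂ (MonoidAlgebra ℂ G) W →ₗ[ℂ] V :=
    TensorProduct.lift ((Finsupp.lift _ _ _ fun g : G => ρ g⁻¹ ∘ₗ f) ∘ₗ
      (MonoidAlgebra.coeffLinearEquiv ℂ).toLinearMap)
  have hF₀ : ∀ g w, F₀ (TensorProduct.tmul ℂ (MonoidAlgebra.single g 1) w) = ρ g⁻¹ (f w) :=
    fun g w => by simp [F₀]
  have hF₁ : ∀ h : H,
      F₀ ∘ₗ (Representation.tprod ((leftRegular ℂ G).comp H.subtype) σ) h = F₀ := fun h => by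
    refine TensorProduct.ext (MonoidAlgebra.lhom_ext' fun g => LinearMap.ext_ring
      (LinearMap.ext fun w => ?_))
    have : (leftRegular ℂ G (h : G)) (MonoidAlgebra.single g 1) =
        MonoidAlgebra.single ((h : G) * g) (1 : ℂ) := by simp
    change F₀ (TensorProduct.tmul ℂ (leftRegular ℂ G (h : G) (MonoidAlgebra.single g 1)) (σ h w)) =
      F₀ (TensorProduct.tmul ℂ (MonoidAlgebra.single g 1) w)
    rw [this, hF₀, hF₀, hf, mul_inv_rev, map_mul, Module.End.mul_apply,
      ← Module.End.mul_apply (ρ (h : G)⁻¹), ← map_mul, inv_mul_cancel, map_one,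
      Module.End.one_apply]
  let F : IndV H.subtype σ →ₗ[ℂ] V := Coinvariants.lift _ F₀ hF₁
  have hF : ∀ g w, F (IndV.mk H.subtype σ g w) = ρ g⁻¹ (f w) := fun g w => hF₀ g w
  refine ⟨F, fun g u => ?_, fun w => by rw [hF, inv_one, map_one, Module.End.one_apply]⟩
  revert u
  refine LinearMap.congr_fun (f := F ∘ₗ ind H.subtype σ g) (g := ρ g ∘ₗ F)
    (IndV.hom_ext _ _ fun x => LinearMap.ext fun w => ?_)
  change F (ind H.subtype σ g (IndV.mk H.subtype σ x w)) = ρ g (F (IndV.mk H.subtype σ x w))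
  rw [ind_mk, hF, hF, mul_inv_rev, inv_inv, map_mul, Module.End.mul_apply]

/-- Frobenius reciprocity maps the induced representation to functions G → W under right
translation. The class of 1 ⊗ w becomes a function supported on H with value w at 1. -/
theorem IndV.mk_one_injective : Function.Injective (IndV.mk H.subtype σ 1) := by
  classical
  let ρ : Representation ℂ G (G → W) :=
    { toFun := fun g => LinearMap.funLeft ℂ W (· * g)
      map_one' := by
        ext
        simp [LinearMap.funLeft]
      map_mul' := fun g h => by
        ext
        simp [LinearMap.funLeft, mul_assoc] }
  let f : W →ₗ[ℂ] G → W := LinearMap.pi fun g => if hg : g ∈ H then σ ⟨g, hg⟩ else 0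
  obtain ⟨F, -, hF⟩ := exists_ind_hom (ρ := ρ) (σ := σ) (f := f) fun h w => by
    ext g
    change f (σ h w) g = f w (g * h)
    by_cases hg : g ∈ H
    · simp only [f, LinearMap.pi_apply, dif_pos hg, dif_pos (H.mul_mem hg h.2)]
      rw [← Module.End.mul_apply, ← map_mul]
      rfl
    · simp only [f, LinearMap.pi_apply, dif_neg hg, dif_neg (mt (H.mul_mem_cancel_right h.2).1 hg)]
      rfl
  refine Function.Injective.of_comp (f := F) fun w w' hw => ?_
  have := congrFun ((hF w).symm.trans (hw.trans (hF w'))) 1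
  simp only [f, LinearMap.pi_apply, dif_pos H.one_mem] at this
  have h1 : σ ⟨1, H.one_mem⟩ = 1 := map_one σ
  simpa [h1] using this

end Induced

end Representation

end

noncomputable section

open Matrix

/-! ### Isotypic components for the kernel of reduction -/

section Isotypic

variable {R : Type*} {k : Type*} [CommRing R] [Field k] {n : ℕ} {π : R} {res : R →+* k}

theorem sum_addChar_trace [Fintype k] {ψ : AddChar k ℂ} (hψ : ψ ≠ 1)
    {A : Matrix (Fin n) (Fin n) k} (hA : A ≠ 0) : ∑ Y, ψ (trace (A * Y)) = 0 := by
  classical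
  let θ : AddChar (Matrix (Fin n) (Fin n) k) ℂ := ψ.compAddMonoidHom
    ((traceAddMonoidHom (Fin n) k).comp (AddMonoidHom.mulLeft A))
  refine AddChar.sum_eq_zero_of_ne_one (ψ := θ) fun hθ => ?_
  obtain ⟨Y, hY⟩ : ∃ Y, trace (A * Y) ≠ 0 := by
    by_contra! h
    exact hA (Matrix.ext_iff_trace_mul_right.2 fun Y => by rw [h, zero_mul, trace_zero])
  refine hψ (DFunLike.ext _ _ fun c => ?_)
  -- Scaling Y gives Tr(AY) any prescribed value c, so triviality of θ would force ψ = 1.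
  have : θ ((c / trace (A * Y)) • Y) = 1 := by
    rw [hθ, AddChar.one_apply]
  have h2 : θ ((c / trace (A * Y)) • Y) = ψ (trace (A * ((c / trace (A * Y)) • Y))) := rfl
  rw [h2, mul_smul_comm, trace_smul, smul_eq_mul, div_mul_cancel₀ _ hY] at this
  rw [this, AddChar.one_apply]

namespace IsLengthTwo

variable (hR : IsLengthTwo π res)

/-- The element `1 + π X` of the kernel of reduction, where `Y` is the residue of `X`. -/
def kerElt (Y : Matrix (Fin n) (Fin n) k) : GL (Fin n) R :=
  (hR.isUnit_one_add (Y.map (Function.surjInv hR.surjective))).unit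

/-- The lift chosen in `kerElt` is immaterial, since πX depends on X̄ only. -/
theorem coe_kerElt (X : Matrix (Fin n) (Fin n) R) :
    (hR.kerElt (X.map res) : Matrix (Fin n) (Fin n) R) = 1 + π • X := by
  change 1 + π • _ = _
  rw [add_right_inj, hR.smul_matrix_eq_iff]
  ext i j
  simp [Function.surjInv_eq hR.surjective]

include hR in
theorem exists_map_eq (Y : Matrix (Fin n) (Fin n) k) :
    ∃ X : Matrix (Fin n) (Fin n) R, X.map res = Y :=
  ⟨Y.map (Function.surjInv hR.surjective), by
    ext i j
    simp [Function.surjInv_eq hR.surjective]⟩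

theorem kerElt_add (Y Z : Matrix (Fin n) (Fin n) k) :
    hR.kerElt (Y + Z) = hR.kerElt Y * hR.kerElt Z := by
  obtain ⟨X, rfl⟩ := hR.exists_map_eq Y
  obtain ⟨X', rfl⟩ := hR.exists_map_eq Z
  refine Units.ext ?_
  rw [← Matrix.map_add res (map_add res), coe_kerElt, Units.val_mul, coe_kerElt, coe_kerElt,
    hR.one_add_mul_one_add]

theorem map_kerElt (Y : Matrix (Fin n) (Fin n) k) :
    GeneralLinearGroup.map res (hR.kerElt Y) = 1 := by
  obtain ⟨X, rfl⟩ := hR.exists_map_eq Y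
  refine Units.ext ?_
  change (hR.kerElt (X.map res) : Matrix (Fin n) (Fin n) R).map res = 1
  rw [coe_kerElt, hR.map_one_add]

theorem mul_kerElt (g : GL (Fin n) R) (Y : Matrix (Fin n) (Fin n) k) :
    g * hR.kerElt Y = hR.kerElt ((g : Matrix (Fin n) (Fin n) R).map res * Y *
      ((g⁻¹ : GL (Fin n) R) : Matrix (Fin n) (Fin n) R).map res) * g := by
  obtain ⟨X, rfl⟩ := hR.exists_map_eq Y
  refine Units.ext ?_
  rw [← Matrix.map_mul, ← Matrix.map_mul, Units.val_mul, Units.val_mul, coe_kerElt, coe_kerElt,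
    mul_add, add_mul, mul_one, one_mul, smul_mul_assoc, Units.inv_mul_cancel_right, mul_smul_comm]

theorem kerElt_mem_stab (A Y : Matrix (Fin n) (Fin n) k) : hR.kerElt Y ∈ stab res A := by
  change GeneralLinearGroup.map res (hR.kerElt Y) ∈ matCentralizer A
  rw [map_kerElt]
  exact one_mem _

theorem stabRed_kerElt (A Y : Matrix (Fin n) (Fin n) k) :
    stabRed res A ⟨hR.kerElt Y, hR.kerElt_mem_stab A Y⟩ = 1 :=
  Subtype.ext (hR.map_kerElt Y)

theorem exists_eq_kerElt {A : Matrix (Fin n) (Fin n) k} {t : stab res A}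
    (ht : stabRed res A t = 1) : ∃ Y, t = ⟨hR.kerElt Y, hR.kerElt_mem_stab A Y⟩ := by
  obtain ⟨X, hX⟩ := hR.exists_eq_one_add_of_stabRed_eq_one ht
  exact ⟨X.map res, Subtype.ext (Units.ext (by rw [hX, coe_kerElt]))⟩

theorem apply_kerElt_of_isExtension {ψ : AddChar k ℂ} {A : Matrix (Fin n) (Fin n) k}
    {χ : stab res A →* ℂˣ} (hχ : IsExtension π res ψ A χ) (Y : Matrix (Fin n) (Fin n) k) :
    (χ ⟨hR.kerElt Y, hR.kerElt_mem_stab A Y⟩ : ℂ) = ψ (trace (A * Y)) := by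
  obtain ⟨X, rfl⟩ := hR.exists_map_eq Y
  exact hχ _ X (hR.coe_kerElt X)

section Proj

variable (ψ : AddChar k ℂ) {V : Type*} [AddCommGroup V] [Module ℂ V]
  (ρ : Representation ℂ (GL (Fin n) R) V)

/-- The kernel of reduction acts on `v` through `ψ_A`. -/
def IsIsotypic (A : Matrix (Fin n) (Fin n) k) (v : V) : Prop :=
  ∀ Y, ρ (hR.kerElt Y) v = ψ (trace (A * Y)) • v

variable [Fintype k]

/-- The projection onto the vectors on which the kernel of reduction acts through `ψ_A`. -/
def isotypicProj (A : Matrix (Fin n) (Fin n) k) : V →ₗ[ℂ] V :=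
  (Fintype.card (Matrix (Fin n) (Fin n) k) : ℂ)⁻¹ •
    ∑ Y, ψ (-trace (A * Y)) • ρ (hR.kerElt Y)

theorem isotypicProj_apply (A : Matrix (Fin n) (Fin n) k) (v : V) :
    hR.isotypicProj ψ ρ A v = (Fintype.card (Matrix (Fin n) (Fin n) k) : ℂ)⁻¹ •
      ∑ Y, ψ (-trace (A * Y)) • ρ (hR.kerElt Y) v := by
  simp only [isotypicProj, LinearMap.smul_apply, LinearMap.sum_apply]

theorem isIsotypic_isotypicProj (A : Matrix (Fin n) (Fin n) k) (v : V) :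
    hR.IsIsotypic ψ ρ A (hR.isotypicProj ψ ρ A v) := fun Z => by
  rw [isotypicProj_apply, map_smul, map_sum, smul_comm (ψ _), Finset.smul_sum (r := ψ _)]
  congr 1
  refine Fintype.sum_equiv (Equiv.addLeft Z) _ _ fun Y => ?_
  rw [map_smul, Equiv.coe_addLeft, kerElt_add, map_mul, Module.End.mul_apply, smul_smul,
    ← AddChar.map_add_eq_mul, mul_add, trace_add, neg_add, add_neg_cancel_left]

variable {ψ ρ}

theorem isotypicProj_eq_self {A : Matrix (Fin n) (Fin n) k} {v : V}
    (h : hR.IsIsotypic ψ ρ A v) : hR.isotypicProj ψ ρ A v = v := by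
  have : (Fintype.card (Matrix (Fin n) (Fin n) k) : ℂ) ≠ 0 := Nat.cast_ne_zero.2 Fintype.card_ne_zero
  rw [isotypicProj_apply, Finset.sum_congr rfl fun Y _ => by
    rw [h Y, smul_smul, ← AddChar.map_add_eq_mul, neg_add_cancel, AddChar.map_zero_eq_one,
      one_smul], Finset.sum_const, Finset.card_univ, ← Nat.cast_smul_eq_nsmul ℂ,
    inv_smul_smul₀ this]

/-- Orthogonality of the distinct characters ψ_A and ψ_B of the kernel of reduction. -/
theorem isotypicProj_eq_zero (hψ : ψ ≠ 1) {A B : Matrix (Fin n) (Fin n) k} (hAB : A ≠ B) {v : V}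
    (h : hR.IsIsotypic ψ ρ A v) : hR.isotypicProj ψ ρ B v = 0 := by
  rw [isotypicProj_apply, Finset.sum_congr rfl fun Y _ => by
    rw [h Y, smul_smul, ← AddChar.map_add_eq_mul, neg_add_eq_sub, ← trace_sub, ← sub_mul],
    ← Finset.sum_smul, sum_addChar_trace hψ (sub_ne_zero.2 hAB), zero_smul, smul_zero]

variable (ρ)

/-- After interchanging the sums, Σ_A ψ(-Tr(AY)) vanishes unless Y = 0. So every vector is the sum
of its isotypic components. -/
theorem sum_isotypicProj (hψ : ψ ≠ 1) : ∑ A, hR.isotypicProj ψ ρ A = 1 := by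
  have hc : (Fintype.card (Matrix (Fin n) (Fin n) k) : ℂ) ≠ 0 := Nat.cast_ne_zero.2 Fintype.card_ne_zero
  have h0 : hR.kerElt (0 : Matrix (Fin n) (Fin n) k) = 1 := by
    have := hR.kerElt_add (0 : Matrix (Fin n) (Fin n) k) 0
    rwa [add_zero, right_eq_mul] at this
  simp only [isotypicProj]
  rw [← Finset.smul_sum, Finset.sum_comm, Finset.sum_eq_single 0]
  · simp only [mul_zero, trace_zero, neg_zero, AddChar.map_zero_eq_one, one_smul, h0, map_one,
      Finset.sum_const, Finset.card_univ]
    rw [← Nat.cast_smul_eq_nsmul ℂ, inv_smul_smul₀ hc]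
  · intro Y _ hY
    rw [← Finset.sum_smul, Finset.sum_congr rfl fun A _ => by rw [trace_mul_comm, ← trace_neg, ← neg_mul],
      sum_addChar_trace hψ (neg_ne_zero.2 hY), zero_smul]
  · simp

variable (ψ)

/-- Conjugation by g on the kernel of reduction permutes the projectors; the sum over Y is reindexed
along Y ↦ ḡYḡ⁻¹. -/
theorem apply_isotypicProj (g : GL (Fin n) R) (A : Matrix (Fin n) (Fin n) k) (v : V) :
    ρ g (hR.isotypicProj ψ ρ A v) =
      hR.isotypicProj ψ ρ ((g : Matrix (Fin n) (Fin n) R).map res * A *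
        ((g⁻¹ : GL (Fin n) R) : Matrix (Fin n) (Fin n) R).map res) (ρ g v) := by
  have e1 : ((g⁻¹ : GL (Fin n) R) : Matrix (Fin n) (Fin n) R).map res *
      (g : Matrix (Fin n) (Fin n) R).map res = 1 := by
    rw [← Matrix.map_mul, ← Units.val_mul, inv_mul_cancel, Units.val_one,
      Matrix.map_one _ (map_zero _) (map_one _)]
  have e2 : (g : Matrix (Fin n) (Fin n) R).map res *
      ((g⁻¹ : GL (Fin n) R) : Matrix (Fin n) (Fin n) R).map res = 1 := by
    rw [← Matrix.map_mul, ← Units.val_mul, mul_inv_cancel, Units.val_one,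
      Matrix.map_one _ (map_zero _) (map_one _)]
  set a := (g : Matrix (Fin n) (Fin n) R).map res with ha
  set b := ((g⁻¹ : GL (Fin n) R) : Matrix (Fin n) (Fin n) R).map res with hb
  rw [isotypicProj_apply, isotypicProj_apply, map_smul, map_sum]
  congr 1
  let e : Matrix (Fin n) (Fin n) k ≃ Matrix (Fin n) (Fin n) k :=
    { toFun := fun Y => a * Y * b
      invFun := fun Y => b * Y * a
      left_inv := fun Y => by
        change b * (a * Y * b) * a = Y
        rw [mul_assoc a, ← mul_assoc b, e1, one_mul, mul_assoc, e1, mul_one]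
      right_inv := fun Y => by
        change a * (b * Y * a) * b = Y
        rw [mul_assoc b, ← mul_assoc a, e2, one_mul, mul_assoc, e2, mul_one] }
  refine Fintype.sum_equiv e _ _ fun Y => ?_
  have e3 : a * A * b * (a * Y * b) = a * (A * Y) * b := by
    rw [mul_assoc a Y b, mul_assoc (a * A), ← mul_assoc b a, e1, one_mul]
    simp only [mul_assoc]
  change _ = ψ (-trace (a * A * b * (a * Y * b))) • ρ (hR.kerElt (a * Y * b)) (ρ g v)
  rw [e3, trace_mul_cycle, e1, one_mul, map_smul, ← Module.End.mul_apply, ← Module.End.mul_apply,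
    ← map_mul, ← map_mul, mul_kerElt]

end Proj

end IsLengthTwo

end Isotypic

end

noncomputable section

open Matrix

/-! ### Clifford theory -/

section Conj

variable {R : Type*} {k : Type*} [CommRing R] [Field k] {n : ℕ} {π : R} {res : R →+* k}

/-- The conjugation action of `GL_n(R)` on matrices over the residue field. -/
def resConj (res : R →+* k) (g : GL (Fin n) R) (A : Matrix (Fin n) (Fin n) k) :
    Matrix (Fin n) (Fin n) k :=
  (g : Matrix (Fin n) (Fin n) R).map res * A *
    ((g⁻¹ : GL (Fin n) R) : Matrix (Fin n) (Fin n) R).map res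

theorem resConj_eq (g : GL (Fin n) R) (A : Matrix (Fin n) (Fin n) k) :
    resConj res g A = (GeneralLinearGroup.map res g : Matrix (Fin n) (Fin n) k) * A *
      ((GeneralLinearGroup.map res g)⁻¹ : GL (Fin n) k) := rfl

theorem resConj_eq_iff {g : GL (Fin n) R} {A B : Matrix (Fin n) (Fin n) k} :
    resConj res g A = B ↔ (g : Matrix (Fin n) (Fin n) R).map res * A =
      B * (g : Matrix (Fin n) (Fin n) R).map res := by
  rw [resConj_eq, Units.mul_inv_eq_iff_eq_mul]
  rfl

theorem resConj_eq_self_iff {g : GL (Fin n) R} {A : Matrix (Fin n) (Fin n) k} :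
    resConj res g A = A ↔ g ∈ stab res A :=
  resConj_eq_iff

theorem isConj_resConj (g : GL (Fin n) R) (A : Matrix (Fin n) (Fin n) k) :
    IsConj A (resConj res g A) :=
  ⟨GeneralLinearGroup.map res g, resConj_eq_iff.1 rfl⟩

theorem IsLengthTwo.exists_resConj_eq (hR : IsLengthTwo π res) {A B : Matrix (Fin n) (Fin n) k}
    (h : IsConj A B) : ∃ g : GL (Fin n) R, resConj res g A = B := by
  obtain ⟨c, hc⟩ := h
  obtain ⟨g, rfl⟩ := hR.exists_gl_lift c
  exact ⟨g, resConj_eq_iff.2 hc⟩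

/-- Orbit and stabilizer for the conjugation action of GL_n(k). -/
theorem ncard_isConj (A : Matrix (Fin n) (Fin n) k) :
    {B | IsConj A B}.ncard = (matCentralizer A).index := by
  have hs : ∀ (g : ConjAct (GL (Fin n) k)) (B : Matrix (Fin n) (Fin n) k),
    g • B = ((ConjAct.ofConjAct g : GL (Fin n) k) : Matrix (Fin n) (Fin n) k) * B *
      ((ConjAct.ofConjAct g)⁻¹ : GL (Fin n) k) := fun g B => rfl
  have h1 : MulAction.stabilizer (ConjAct (GL (Fin n) k)) A =
      (matCentralizer A).comap (ConjAct.ofConjAct (G := GL (Fin n) k)).toMonoidHom := by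
    ext g
    rw [MulAction.mem_stabilizer_iff, hs, Units.mul_inv_eq_iff_eq_mul]
    rfl
  have h2 : MulAction.orbit (ConjAct (GL (Fin n) k)) A = {B | IsConj A B} := by
    ext B
    rw [MulAction.mem_orbit_iff]
    simp only [hs, Units.mul_inv_eq_iff_eq_mul]
    exact Iff.rfl
  rw [← h2, ← MulAction.index_stabilizer, h1, Subgroup.index_comap_of_surjective]
  exact (ConjAct.ofConjAct (G := GL (Fin n) k)).surjective

end Conj

section Clifford

variable {R : Type*} {k : Type*} [CommRing R] [Field k] {n : ℕ} {π : R} {res : R →+* k}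

namespace IsLengthTwo

variable (hR : IsLengthTwo π res) [Fintype k] {ψ : AddChar k ℂ} {V : Type*} [AddCommGroup V]
  [Module ℂ V] {ρ : Representation ℂ (GL (Fin n) R) V} {A : Matrix (Fin n) (Fin n) k}
  {U : Submodule ℂ V}

theorem isIsotypic_apply {v : V} (h : hR.IsIsotypic ψ ρ A v) (g : GL (Fin n) R) :
    hR.IsIsotypic ψ ρ (resConj res g A) (ρ g v) := by
  rw [← hR.isotypicProj_eq_self h, apply_isotypicProj]
  exact hR.isIsotypic_isotypicProj ψ ρ _ _

/-- If g stabilizes ψ_A it preserves U; otherwise gU is isotypic for a different character and is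
projected to 0. -/
theorem isotypicProj_apply_mem (hψ : ψ ≠ 1) (hU : ∀ t ∈ stab res A, ∀ u ∈ U, ρ t u ∈ U)
    (hi : ∀ u ∈ U, hR.IsIsotypic ψ ρ A u) (g : GL (Fin n) R) {u : V} (hu : u ∈ U) :
    hR.isotypicProj ψ ρ A (ρ g u) ∈ U := by
  by_cases hg : g ∈ stab res A
  · rw [hR.isotypicProj_eq_self (hi _ (hU g hg u hu))]
    exact hU g hg u hu
  · rw [hR.isotypicProj_eq_zero hψ (mt resConj_eq_self_iff.1 hg) (hR.isIsotypic_apply (hi u hu) g)]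
    exact zero_mem _

/-- If an isotypic subspace generates the representation, it is the whole isotypic component. -/
theorem isotypicProj_mem (hψ : ψ ≠ 1) (hU : ∀ t ∈ stab res A, ∀ u ∈ U, ρ t u ∈ U)
    (hi : ∀ u ∈ U, hR.IsIsotypic ψ ρ A u)
    (hs : ∀ U' : Submodule ℂ V, (∀ g, ∀ u ∈ U', ρ g u ∈ U') → U ≤ U' → U' = ⊤) (v : V) :
    hR.isotypicProj ψ ρ A v ∈ U := by
  -- The vectors all of whose translates are projected into U form an invariant subspace containing
  -- U, which is everything.
  have key := hs (⨅ g, U.comap (hR.isotypicProj ψ ρ A ∘ₗ ρ g)) (fun g u hu => ?_) fun u hu => ?_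
  · have : v ∈ ⨅ g, U.comap (hR.isotypicProj ψ ρ A ∘ₗ ρ g) := key ▸ Submodule.mem_top
    have h1 : hR.isotypicProj ψ ρ A (ρ 1 v) ∈ U := (Submodule.mem_iInf _).1 this 1
    rwa [map_one] at h1
  · refine (Submodule.mem_iInf _).2 fun x => ?_
    have h1 : hR.isotypicProj ψ ρ A (ρ (x * g) u) ∈ U := (Submodule.mem_iInf _).1 hu (x * g)
    rwa [map_mul] at h1
  · exact (Submodule.mem_iInf _).2 fun g => hR.isotypicProj_apply_mem hψ hU hi g hu

/-- For B not similar to A, the vectors all of whose translates are killed by the B-projector form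
an invariant subspace containing U. -/
theorem isConj_of_isotypicProj_ne_zero (hψ : ψ ≠ 1) (hi : ∀ u ∈ U, hR.IsIsotypic ψ ρ A u)
    (hs : ∀ U' : Submodule ℂ V, (∀ g, ∀ u ∈ U', ρ g u ∈ U') → U ≤ U' → U' = ⊤)
    {B : Matrix (Fin n) (Fin n) k} {v : V} (hv : hR.isotypicProj ψ ρ B v ≠ 0) : IsConj A B := by
  by_contra hAB
  have key := hs (⨅ g, LinearMap.ker (hR.isotypicProj ψ ρ B ∘ₗ ρ g)) (fun g u hu => ?_)
    fun u hu => ?_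
  · have : v ∈ ⨅ g, LinearMap.ker (hR.isotypicProj ψ ρ B ∘ₗ ρ g) := key ▸ Submodule.mem_top
    have h1 : hR.isotypicProj ψ ρ B (ρ 1 v) = 0 := (Submodule.mem_iInf _).1 this 1
    rw [map_one] at h1
    exact hv h1
  · refine (Submodule.mem_iInf _).2 fun x => ?_
    have h1 : hR.isotypicProj ψ ρ B (ρ (x * g) u) = 0 := (Submodule.mem_iInf _).1 hu (x * g)
    rwa [map_mul] at h1
  · refine (Submodule.mem_iInf _).2 fun g => hR.isotypicProj_eq_zero hψ ?_
      (hR.isIsotypic_apply (hi u hu) g)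
    rintro rfl
    exact hAB (isConj_resConj g A)

theorem exists_isotypicProj_ne_zero (hψ : ψ ≠ 1) {v : V} (hv : v ≠ 0) :
    ∃ B, hR.isotypicProj ψ ρ B v ≠ 0 := by
  by_contra! h
  refine hv ?_
  have := LinearMap.congr_fun (hR.sum_isotypicProj ρ hψ) v
  rw [LinearMap.sum_apply, Finset.sum_eq_zero fun B _ => h B] at this
  exact this.symm

theorem isotypicProj_mem_of_invariant (hU : ∀ g, ∀ u ∈ U, ρ g u ∈ U)
    (B : Matrix (Fin n) (Fin n) k) {u : V} (hu : u ∈ U) : hR.isotypicProj ψ ρ B u ∈ U := by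
  rw [isotypicProj_apply]
  exact U.smul_mem _ (U.sum_mem fun Y _ => U.smul_mem _ (hU _ _ hu))

theorem exists_isotypicProj_apply_ne_zero {B : Matrix (Fin n) (Fin n) k} (h : IsConj A B) {v : V}
    (hv : hR.isotypicProj ψ ρ B v ≠ 0) : ∃ g, hR.isotypicProj ψ ρ A (ρ g v) ≠ 0 := by
  obtain ⟨g, rfl⟩ := hR.exists_resConj_eq h
  refine ⟨g⁻¹, fun h0 => hv ?_⟩
  have := hR.apply_isotypicProj ψ ρ g A (ρ g⁻¹ v)
  rw [h0, map_zero, ← Module.End.mul_apply (ρ g), ← map_mul, mul_inv_cancel, map_one,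
    Module.End.one_apply] at this
  exact this.symm

/-- Clifford's criterion for irreducibility. -/
theorem isIrreducible_of_isIsotypic (hψ : ψ ≠ 1) (hU : ∀ t ∈ stab res A, ∀ u ∈ U, ρ t u ∈ U)
    (hi : ∀ u ∈ U, hR.IsIsotypic ψ ρ A u)
    (hs : ∀ U' : Submodule ℂ V, (∀ g, ∀ u ∈ U', ρ g u ∈ U') → U ≤ U' → U' = ⊤) (h0 : U ≠ ⊥)
    (hmin : ∀ U' ≤ U, (∀ t ∈ stab res A, ∀ u ∈ U', ρ t u ∈ U') → U' = ⊥ ∨ U' = U) :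
    ρ.IsIrreducible := by
  obtain ⟨u, -, hu0⟩ := U.ne_bot_iff.1 h0
  refine Representation.isIrreducible_iff_forall_submodule.2 ⟨⟨u, 0, hu0⟩, fun U' hU' => ?_⟩
  refine or_iff_not_imp_left.2 fun hne => hs U' hU' ?_
  obtain ⟨v, hv, hv0⟩ := U'.ne_bot_iff.1 hne
  obtain ⟨B, hB⟩ := hR.exists_isotypicProj_ne_zero (ρ := ρ) hψ hv0
  obtain ⟨g, hg⟩ := hR.exists_isotypicProj_apply_ne_zero
    (hR.isConj_of_isotypicProj_ne_zero hψ hi hs hB) hB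
  -- A nonzero isotypic component of v is moved by g to the A-component, which lies in U ∩ U'. So
  -- this intersection is not 0 and by minimality is U.
  have := (hmin (U ⊓ U') inf_le_left fun t ht w hw => ⟨hU t ht w hw.1, hU' t w hw.2⟩).resolve_left
    fun hbot => hg ((Submodule.mem_bot ℂ).1 (hbot ▸ ⟨hR.isotypicProj_mem hψ hU hi hs _,
      hR.isotypicProj_mem_of_invariant hU' A (hU' g v hv)⟩))
  exact inf_eq_left.1 this

end IsLengthTwo

end Clifford

/-! ### Representations induced from stabilizers -/

section Twist

variable {R : Type*} {k : Type*} [CommRing R] [Field k] {n : ℕ} {π : R} {res : R →+* k}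
  {A : Matrix (Fin n) (Fin n) k}

namespace IsLengthTwo

variable (hR : IsLengthTwo π res) {χ : stab res A →* ℂˣ} {W : Type*} [AddCommGroup W] [Module ℂ W]
  {σ : Representation ℂ (matCentralizer A) W}

include hR in
theorem isIrreducible_twistRep (h : σ.IsIrreducible) : (twistRep res A χ σ).IsIrreducible := by
  refine Representation.isIrreducible_iff_forall_submodule.2 ⟨h.nontrivial, fun U hU => ?_⟩
  refine (Representation.isIrreducible_iff_forall_submodule.1 h).2 U fun z u hu => ?_
  obtain ⟨t, rfl⟩ := hR.stabRed_surjective A z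
  have : (χ t : ℂ) • σ (stabRed res A t) u ∈ U := hU t u hu
  rwa [U.smul_mem_iff (Units.ne_zero _)] at this

variable {ψ : AddChar k ℂ} {V : Type*} [AddCommGroup V] [Module ℂ V]
  {ρ : Representation ℂ (GL (Fin n) R) V} {f : W →ₗ[ℂ] V}

theorem isIsotypic_of_mem_range (hχ : IsExtension π res ψ A χ)
    (hf : ∀ t w, f (twistRep res A χ σ t w) = ρ t (f w)) {v : V} (hv : v ∈ LinearMap.range f) :
    hR.IsIsotypic ψ ρ A v := by
  obtain ⟨w, rfl⟩ := hv
  intro Y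
  have : twistRep res A χ σ ⟨hR.kerElt Y, hR.kerElt_mem_stab A Y⟩ w =
      (χ ⟨hR.kerElt Y, hR.kerElt_mem_stab A Y⟩ : ℂ) • σ (stabRed res A _) w := rfl
  rw [← hf ⟨hR.kerElt Y, hR.kerElt_mem_stab A Y⟩ w, this, hR.apply_kerElt_of_isExtension hχ,
    stabRed_kerElt, map_one, Module.End.one_apply, map_smul]

-- Clifford's criterion for the copy of χ ⊗ σ spanned by the classes of 1 ⊗ w, which is isotypic,
-- generates, and is minimal because χ ⊗ σ is irreducible.
include hR in
theorem isIrreducible_ind [Finite k] (hψ : ψ ≠ 1) (hχ : IsExtension π res ψ A χ) (h : σ.IsIrreducible) :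
    (Representation.ind (stab res A).subtype (twistRep res A χ σ)).IsIrreducible := by
  have := Fintype.ofFinite k
  have hirr := hR.isIrreducible_twistRep (χ := χ) h
  have hf := Representation.IndV.mk_one_apply (twistRep res A χ σ)
  have hinj := Representation.IndV.mk_one_injective (σ := twistRep res A χ σ)
  refine hR.isIrreducible_of_isIsotypic (ψ := ψ) (A := A)
    (U := LinearMap.range (Representation.IndV.mk (stab res A).subtype (twistRep res A χ σ) 1)) hψ
    ?_ (fun u hu => hR.isIsotypic_of_mem_range hχ hf hu)
    (fun U' hU' hle => Representation.ind_eq_top_of_range_le _ hU' hle) ?_ fun U' hle hU' => ?_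
  · rintro t ht _ ⟨w, rfl⟩
    exact ⟨_, hf ⟨t, ht⟩ w⟩
  · have := h.nontrivial
    obtain ⟨w, hw⟩ := exists_ne (0 : W)
    exact Submodule.ne_bot_iff _ |>.2 ⟨_, ⟨w, rfl⟩, fun e => hw (hinj (e.trans (map_zero _).symm))⟩
  · rw [← Submodule.map_comap_eq_of_le hle]
    refine ((Representation.isIrreducible_iff_forall_submodule.1 hirr).2
      (U'.comap (Representation.IndV.mk (stab res A).subtype (twistRep res A χ σ) 1))
      fun t w hw => ?_).imp (fun e => by rw [e, Submodule.map_bot])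
      (fun e => by rw [e, Submodule.map_top])
    change Representation.IndV.mk (stab res A).subtype (twistRep res A χ σ) 1 _ ∈ U'
    rw [hf]
    exact hU' t t.2 _ hw

include hR in
/-- An irreducible representation is induced from `χ ⊗ σ` if and only if `χ ⊗ σ` embeds into it. -/
theorem isInduced_mk_iff [Finite k] (hψ : ψ ≠ 1) (hχ : IsExtension π res ψ A χ)
    (a : IrrRep (matCentralizer A)) (v : IrrRep (GL (Fin n) R)) :
    IsInduced res A χ (Quotient.mk (IrrRep.setoid _) a) (Quotient.mk (IrrRep.setoid _) v) ↔
      ∃ f : (Fin a.dim → ℂ) →ₗ[ℂ] (Fin v.dim → ℂ), f ≠ 0 ∧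
        ∀ t w, f (twistRep res A χ a.ρ t w) = v.ρ t (f w) := by
  constructor
  · rintro ⟨a', ha, b, hb, ⟨e⟩⟩
    obtain ⟨e₁⟩ := Quotient.exact ha
    obtain ⟨e₂⟩ := Quotient.exact hb
    have h1 := (e₁.symm).toIntertwiningMap.isIntertwining
    have h2 := (e.symm.trans e₂).toIntertwiningMap.isIntertwining
    have hf := Representation.IndV.mk_one_apply (twistRep res A χ a'.ρ)
    have hinj := Representation.IndV.mk_one_injective (σ := twistRep res A χ a'.ρ)
    refine ⟨(e.symm.trans e₂).toLinearEquiv.toLinearMap ∘ₗ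
      Representation.IndV.mk (stab res A).subtype (twistRep res A χ a'.ρ) 1 ∘ₗ
      e₁.symm.toLinearEquiv.toLinearMap, fun h0 => ?_, fun t w => ?_⟩
    · have := a.irreducible.nontrivial
      obtain ⟨w, hw⟩ := exists_ne (0 : Fin a.dim → ℂ)
      refine hw (e₁.symm.toLinearEquiv.injective (hinj ((e.symm.trans e₂).toLinearEquiv.injective
        ((LinearMap.congr_fun h0 w).trans ?_))))
      simp
    · have h3 : e₁.symm (twistRep res A χ a.ρ t w) = twistRep res A χ a'.ρ t (e₁.symm w) := by
        change e₁.symm ((χ t : ℂ) • a.ρ (stabRed res A t) w) =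
          (χ t : ℂ) • a'.ρ (stabRed res A t) (e₁.symm w)
        rw [map_smul]
        exact congrArg _ (h1 _ _)
      change (e.symm.trans e₂) (Representation.IndV.mk _ _ 1 (e₁.symm _)) = v.ρ t
        ((e.symm.trans e₂) (Representation.IndV.mk _ _ 1 (e₁.symm w)))
      rw [h3, hf]
      exact h2 _ _
  · rintro ⟨f, h0, hf⟩
    -- The embedding extends to the induced representation, which is irreducible, and Schur's lemma
    -- makes the extension an isomorphism.
    obtain ⟨F, hF, hFf⟩ := Representation.exists_ind_hom hf
    obtain ⟨e⟩ := (hR.isIrreducible_ind hψ hχ a.irreducible).nonempty_equiv v.irreducible hF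
      fun e => h0 (LinearMap.ext fun w => by rw [← hFf, e]; rfl)
    exact ⟨a, rfl, v, rfl, ⟨e.symm⟩⟩

end IsLengthTwo

end Twist

end

/-! ### Parametrisation by similarity classes and representations of centralizers. -/

noncomputable section

open Matrix

section Parametrization

variable {R : Type*} {k : Type*} [CommRing R] [Field k] {n : ℕ} {π : R} {res : R →+* k}
  {A : Matrix (Fin n) (Fin n) k}

/-- Values on a group are units, so factoring through a quotient can be done in the unit group. Used
with endomorphism monoids as targets. -/
theorem MonoidHom.exists_eq_comp_of_surjective {G H M : Type*} [Group G] [Group H] [Monoid M]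
    {f : G →* H} (hf : Function.Surjective f) (τ : G →* M) (hτ : ∀ g, f g = 1 → τ g = 1) :
    ∃ σ : H →* M, ∀ g, σ (f g) = τ g := by
  let s := f.liftOfSurjective hf ⟨τ.toHomUnits, fun g hg => Units.ext (hτ g hg)⟩
  refine ⟨(Units.coeHom M).comp s, fun g => ?_⟩
  exact congrArg Units.val (f.liftOfRightInverse_comp_apply _ (Function.rightInverse_surjInv hf)
    ⟨τ.toHomUnits, fun g hg => Units.ext (hτ g hg)⟩ g)

namespace IsLengthTwo

variable (hR : IsLengthTwo π res) {ψ : AddChar k ℂ} {χ : stab res A →* ℂˣ}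

section

variable {V W : Type*} [AddCommGroup V] [Module ℂ V] [AddCommGroup W] [Module ℂ W]
  {ρ : Representation ℂ (GL (Fin n) R) V} {σ : Representation ℂ (matCentralizer A) W}
  {f : W →ₗ[ℂ] V}

/-- A nonzero copy of χ ⊗ σ in an irreducible representation generates it and hence fills the
isotypic subspace. So that subspace determines σ. -/
theorem mem_range_iff_isIsotypic [Finite k] (hψ : ψ ≠ 1) (hχ : IsExtension π res ψ A χ)
    (hf : ∀ t w, f (twistRep res A χ σ t w) = ρ t (f w)) (h0 : f ≠ 0) (hρ : ρ.IsIrreducible)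
    {v : V} : v ∈ LinearMap.range f ↔ hR.IsIsotypic ψ ρ A v := by
  have := Fintype.ofFinite k
  refine ⟨hR.isIsotypic_of_mem_range hχ hf, fun hv => ?_⟩
  rw [← hR.isotypicProj_eq_self hv]
  refine hR.isotypicProj_mem hψ ?_ (fun u hu => hR.isIsotypic_of_mem_range hχ hf hu)
    (fun U' hU' hle => hρ.eq_top_of_ne_bot hU' fun h => h0 ?_) v
  · rintro t ht _ ⟨w, rfl⟩
    exact ⟨_, hf ⟨t, ht⟩ w⟩
  · rwa [h, le_bot_iff, LinearMap.range_eq_bot] at hle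

/-- An isotypic subspace that is stable under `T(ψ_A)` is of the form `χ ⊗ σ`. -/
theorem exists_twistRep_eq {U : Submodule ℂ V} (hχ : IsExtension π res ψ A χ)
    (hU : ∀ t ∈ stab res A, ∀ u ∈ U, ρ t u ∈ U) (hi : ∀ u ∈ U, hR.IsIsotypic ψ ρ A u) :
    ∃ σ : Representation ℂ (matCentralizer A) U,
      ∀ t u, (twistRep res A χ σ t u : V) = ρ t (u : V) := by
  -- Dividing by χ makes the kernel of reduction act trivially, so the action factors through Z(A).
  let τ : stab res A →* Module.End ℂ U :=
    { toFun := fun t => ((χ t)⁻¹ : ℂˣ) • (ρ t).restrict (hU t t.2)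
      map_one' := by
        ext u
        simp [LinearMap.restrict_apply]
      map_mul' := fun s t => by
        refine LinearMap.ext fun u => Subtype.ext ?_
        change (χ (s * t))⁻¹ • ρ (s * t) (u : V) = (χ s)⁻¹ • ρ s ((χ t)⁻¹ • ρ t (u : V))
        rw [map_mul, map_mul, mul_inv, Module.End.mul_apply, mul_smul, Units.smul_def (χ t)⁻¹,
          Units.smul_def (χ t)⁻¹, map_smul] }
  have hτ : ∀ t u, (τ t u : V) = ((χ t)⁻¹ : ℂˣ) • ρ t (u : V) := fun t u => rfl
  obtain ⟨σ, hσ⟩ := MonoidHom.exists_eq_comp_of_surjective (hR.stabRed_surjective A) τ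
    fun t ht => by
      obtain ⟨Y, rfl⟩ := hR.exists_eq_kerElt ht
      refine LinearMap.ext fun u => Subtype.ext ?_
      rw [hτ, hi u u.2 Y, ← hR.apply_kerElt_of_isExtension hχ, ← Units.smul_def, inv_smul_smul]
      rfl
  refine ⟨σ, fun t u => ?_⟩
  change (((χ t : ℂ) • σ (stabRed res A t) u : U) : V) = _
  rw [hσ, Submodule.coe_smul, hτ, ← Units.smul_def, smul_inv_smul]

end

section Induced

variable {σ σ' : Irr (matCentralizer A)} {c c' : Irr (GL (Fin n) R)}

include hR in
theorem exists_isInduced [Finite R] (hψ : ψ ≠ 1) (hχ : IsExtension π res ψ A χ)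
    (σ : Irr (matCentralizer A)) : ∃ c, IsInduced res A χ σ c := by
  have : Finite k := Finite.of_surjective _ hR.surjective
  obtain ⟨a, rfl⟩ := Quotient.exists_rep σ
  obtain ⟨b, hb⟩ := (hR.isIrreducible_ind hψ hχ a.irreducible).exists_irrRep
  exact ⟨Quotient.mk _ b, a, rfl, b, rfl, hb⟩

variable [Finite k]

include hR in
theorem eq_of_isInduced (hψ : ψ ≠ 1) (hχ : IsExtension π res ψ A χ)
    (h : IsInduced res A χ σ c) (h' : IsInduced res A χ σ c') : c = c' := by
  obtain ⟨a, rfl⟩ := Quotient.exists_rep σ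
  obtain ⟨v, rfl⟩ := Quotient.exists_rep c
  obtain ⟨v', rfl⟩ := Quotient.exists_rep c'
  obtain ⟨f, h0, hf⟩ := (hR.isInduced_mk_iff hψ hχ a v).1 h
  obtain ⟨f', h0', hf'⟩ := (hR.isInduced_mk_iff hψ hχ a v').1 h'
  have hirr := hR.isIrreducible_ind hψ hχ a.irreducible
  obtain ⟨F, hF, hFf⟩ := Representation.exists_ind_hom hf
  obtain ⟨F', hF', hFf'⟩ := Representation.exists_ind_hom hf'
  obtain ⟨e⟩ := hirr.nonempty_equiv v.irreducible hF
    fun e => h0 (LinearMap.ext fun w => by rw [← hFf, e]; rfl)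
  obtain ⟨e'⟩ := hirr.nonempty_equiv v'.irreducible hF'
    fun e => h0' (LinearMap.ext fun w => by rw [← hFf', e]; rfl)
  exact Quotient.sound ⟨e.symm.trans e'⟩

-- Both χ ⊗ σ and χ ⊗ σ' have the isotypic subspace as image, so one embedding factors through the
-- other. Removing the common factor χ leaves a nonzero intertwiner from σ to σ'.
include hR in
theorem eq_of_isInduced_of_isInduced (hψ : ψ ≠ 1) (hχ : IsExtension π res ψ A χ)
    (h : IsInduced res A χ σ c) (h' : IsInduced res A χ σ' c) : σ = σ' := by
  obtain ⟨a, rfl⟩ := Quotient.exists_rep σ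
  obtain ⟨a', rfl⟩ := Quotient.exists_rep σ'
  obtain ⟨v, rfl⟩ := Quotient.exists_rep c
  obtain ⟨f, h0, hf⟩ := (hR.isInduced_mk_iff hψ hχ a v).1 h
  obtain ⟨f', h0', hf'⟩ := (hR.isInduced_mk_iff hψ hχ a' v).1 h'
  have hinj := (hR.isIrreducible_twistRep (χ := χ) a'.irreducible).injective_of_ne_zero
    (σ := v.ρ.comp (stab res A).subtype) hf' h0'
  have hr : ∀ w, f w ∈ LinearMap.range f' := fun w =>
    (hR.mem_range_iff_isIsotypic hψ hχ hf' h0' v.irreducible).2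
      (hR.isIsotypic_of_mem_range hχ hf ⟨w, rfl⟩)
  let g : (Fin a.dim → ℂ) →ₗ[ℂ] (Fin a'.dim → ℂ) :=
    (LinearEquiv.ofInjective f' hinj).symm.toLinearMap ∘ₗ f.codRestrict (LinearMap.range f') hr
  have hg : ∀ w, f' (g w) = f w := fun w =>
    congrArg Subtype.val ((LinearEquiv.ofInjective f' hinj).apply_symm_apply ⟨f w, hr w⟩)
  have hgz : ∀ z w, g (a.ρ z w) = a'.ρ z (g w) := fun z w => hinj <| by
    obtain ⟨t, rfl⟩ := hR.stabRed_surjective A z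
    refine smul_right_injective _ (Units.ne_zero (χ t)) ?_
    change (χ t : ℂ) • f' (g (a.ρ (stabRed res A t) w)) =
      (χ t : ℂ) • f' (a'.ρ (stabRed res A t) (g w))
    rw [hg]
    exact (map_smul f _ _).symm.trans (((hf t w).trans ((congrArg _ (hg w).symm).trans
      (hf' t (g w)).symm)).trans (map_smul f' _ _))
  obtain ⟨e⟩ := a.irreducible.nonempty_equiv a'.irreducible hgz
    fun e => h0 (LinearMap.ext fun w => by rw [← hg, e]; exact map_zero f')
  exact Quotient.sound ⟨e⟩

include hR in
theorem isConj_of_isInduced {B : Matrix (Fin n) (Fin n) k} {χ' : stab res B →* ℂˣ}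
    {σ' : Irr (matCentralizer B)} (hψ : ψ ≠ 1) (hχ : IsExtension π res ψ A χ)
    (hχ' : IsExtension π res ψ B χ') (h : IsInduced res A χ σ c)
    (h' : IsInduced res B χ' σ' c) : IsConj A B := by
  have := Fintype.ofFinite k
  obtain ⟨a, rfl⟩ := Quotient.exists_rep σ
  obtain ⟨a', rfl⟩ := Quotient.exists_rep σ'
  obtain ⟨v, rfl⟩ := Quotient.exists_rep c
  obtain ⟨f, h0, hf⟩ := (hR.isInduced_mk_iff hψ hχ a v).1 h
  obtain ⟨f', h0', hf'⟩ := (hR.isInduced_mk_iff hψ hχ' a' v).1 h'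
  obtain ⟨w, hw⟩ : ∃ w, f' w ≠ 0 := by
    by_contra! e
    exact h0' (LinearMap.ext e)
  refine hR.isConj_of_isotypicProj_ne_zero (ρ := v.ρ) (U := LinearMap.range f) (v := f' w) hψ
    (fun u hu => hR.isIsotypic_of_mem_range hχ hf hu)
    (fun U' hU' hle => v.irreducible.eq_top_of_ne_bot hU' fun e => h0 ?_) ?_
  · rwa [e, le_bot_iff, LinearMap.range_eq_bot] at hle
  · rwa [hR.isotypicProj_eq_self (hR.isIsotypic_of_mem_range hχ' hf' ⟨w, rfl⟩)]

-- Surjectivity of the parametrisation. Some projector is nonzero on the representation; for every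
-- similar A the isotypic subspace is then nonzero and stable under T(A), of the form χ ⊗ σ. A
-- Z(A)-invariant subspace of it generates the representation, so σ is irreducible.
include hR in
theorem exists_forall_isInduced (hψ : ψ ≠ 1) (c : Irr (GL (Fin n) R)) :
    ∃ B : Matrix (Fin n) (Fin n) k, ∀ A, IsConj A B → ∀ χ : stab res A →* ℂˣ,
      IsExtension π res ψ A χ → ∃ σ, IsInduced res A χ σ c := by
  have := Fintype.ofFinite k
  obtain ⟨v, rfl⟩ := Quotient.exists_rep c
  have := v.irreducible.nontrivial
  obtain ⟨x, hx⟩ := exists_ne (0 : Fin v.dim → ℂ)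
  obtain ⟨B, hB⟩ := hR.exists_isotypicProj_ne_zero (ρ := v.ρ) hψ hx
  refine ⟨B, fun A hA χ hχ => ?_⟩
  obtain ⟨g, hg⟩ := hR.exists_isotypicProj_apply_ne_zero hA hB
  let U := LinearMap.range (hR.isotypicProj ψ v.ρ A)
  have hi : ∀ u ∈ U, hR.IsIsotypic ψ v.ρ A u := by
    rintro _ ⟨y, rfl⟩
    exact hR.isIsotypic_isotypicProj ψ v.ρ A y
  have hU : ∀ t ∈ stab res A, ∀ u ∈ U, v.ρ t u ∈ U := by
    rintro t ht _ ⟨y, rfl⟩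
    refine ⟨v.ρ t y, ?_⟩
    rw [apply_isotypicProj]
    exact congrArg (fun B => hR.isotypicProj ψ v.ρ B (v.ρ t y)) (resConj_eq_self_iff.2 ht).symm
  obtain ⟨σ, hσ⟩ := hR.exists_twistRep_eq hχ hU hi
  have hσirr : σ.IsIrreducible := by
    refine Representation.isIrreducible_iff_forall_submodule.2
      ⟨⟨⟨_, ⟨_, rfl⟩⟩, 0, fun e => hg (congrArg Subtype.val e)⟩, fun U' hU' =>
        or_iff_not_imp_left.2 fun hne => eq_top_iff.2 fun u _ => ?_⟩
    have hle : U'.map U.subtype ≤ U := Submodule.map_subtype_le U U'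
    have hu := hR.isotypicProj_mem (ρ := v.ρ) (U := U'.map U.subtype) hψ ?_
      (fun u hu => hi u (hle hu)) (fun U'' hU'' hle' => v.irreducible.eq_top_of_ne_bot hU''
        fun e => hne ?_) (u : Fin v.dim → ℂ)
    · rw [hR.isotypicProj_eq_self (hi u u.2)] at hu
      obtain ⟨w, hw, hwu⟩ := hu
      rwa [← Subtype.ext hwu]
    · rintro t ht _ ⟨w, hw, rfl⟩
      refine ⟨twistRep res A χ σ ⟨t, ht⟩ w, U'.smul_mem _ (hU' _ _ hw), hσ ⟨t, ht⟩ w⟩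
    · rw [e, le_bot_iff] at hle'
      exact Submodule.map_injective_of_injective U.injective_subtype (hle'.trans (Submodule.map_bot _).symm)
  obtain ⟨a, ⟨e⟩⟩ := hσirr.exists_irrRep
  refine ⟨Quotient.mk _ a, (hR.isInduced_mk_iff hψ hχ a v).2
    ⟨U.subtype ∘ₗ e.toLinearEquiv.toLinearMap, fun h0 => ?_, fun t w => ?_⟩⟩
  · obtain ⟨w, hw⟩ := e.toLinearEquiv.surjective ⟨_, ⟨v.ρ g x, rfl⟩⟩
    have := LinearMap.congr_fun h0 w
    exact hg ((congrArg Subtype.val hw).symm.trans this)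
  · change ((e ((χ t : ℂ) • a.ρ (stabRed res A t) w) : U) : Fin v.dim → ℂ) = v.ρ t (e w : U)
    rw [← hσ, map_smul]
    exact congrArg (fun u : U => (((χ t : ℂ) • u : U) : Fin v.dim → ℂ))
      (Representation.IntertwiningMap.isIntertwining _ _ e.toIntertwiningMap _ _)

include hR in
/-- Induction multiplies dimensions by the index of the centralizer. -/
theorem dim_of_isInduced (hψ : ψ ≠ 1) (hχ : IsExtension π res ψ A χ)
    (h : IsInduced res A χ σ c) : c.dim = (matCentralizer A).index * σ.dim := by
  classical
  have := Fintype.ofFinite k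
  obtain ⟨a, rfl⟩ := Quotient.exists_rep σ
  obtain ⟨v, rfl⟩ := Quotient.exists_rep c
  obtain ⟨f, h0, hf⟩ := (hR.isInduced_mk_iff hψ hχ a v).1 h
  have hinj := (hR.isIrreducible_twistRep (χ := χ) a.irreducible).injective_of_ne_zero
    (σ := v.ρ.comp (stab res A).subtype) hf h0
  have hp : LinearMap.IsProj (LinearMap.range f) (hR.isotypicProj ψ v.ρ A) :=
    ⟨fun x => (hR.mem_range_iff_isIsotypic hψ hχ hf h0 v.irreducible).2
      (hR.isIsotypic_isotypicProj ψ v.ρ A x), fun x hx => hR.isotypicProj_eq_self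
      (hR.isIsotypic_of_mem_range hχ hf hx)⟩
  have htr : LinearMap.trace ℂ _ (hR.isotypicProj ψ v.ρ A) = a.dim := by
    rw [hp.trace, LinearMap.finrank_range_of_inj hinj, Module.finrank_fin_fun]
  have htr' : ∀ B, LinearMap.trace ℂ _ (hR.isotypicProj ψ v.ρ B) =
      if IsConj A B then (a.dim : ℂ) else 0 := fun B => by
    split_ifs with hB
    · obtain ⟨g, rfl⟩ := hR.exists_resConj_eq hB
      have : hR.isotypicProj ψ v.ρ (resConj res g A) =
          v.ρ g * (hR.isotypicProj ψ v.ρ A * v.ρ g⁻¹) := LinearMap.ext fun x => by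
        have := hR.apply_isotypicProj ψ v.ρ g A (v.ρ g⁻¹ x)
        rw [← Module.End.mul_apply (v.ρ g) (v.ρ g⁻¹), ← map_mul, mul_inv_cancel, map_one,
          Module.End.one_apply] at this
        exact this.symm
      rw [this, LinearMap.trace_mul_comm, mul_assoc, ← map_mul, inv_mul_cancel, map_one, mul_one,
        htr]
    · have : hR.isotypicProj ψ v.ρ B = 0 := LinearMap.ext fun x => by
        by_contra hx
        refine hB (hR.isConj_of_isotypicProj_ne_zero (U := LinearMap.range f) hψ
          (fun u hu => hR.isIsotypic_of_mem_range hχ hf hu)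
          (fun U' hU' hle => v.irreducible.eq_top_of_ne_bot hU' fun e => h0 ?_) hx)
        rwa [e, le_bot_iff, LinearMap.range_eq_bot] at hle
      rw [this, map_zero]
  -- The projectors sum to 1. Each of those similar to A has trace dim σ, the others vanish, and the
  -- size of the similarity class is the index of Z(A).
  have key := congrArg (LinearMap.trace ℂ _) (hR.sum_isotypicProj v.ρ hψ)
  rw [map_sum, Finset.sum_congr rfl fun B _ => htr' B, ← Finset.sum_filter, Finset.sum_const,
    LinearMap.trace_one, Module.finrank_fin_fun, nsmul_eq_mul] at key
  change v.dim = (matCentralizer A).index * a.dim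
  rw [← ncard_isConj, Set.ncard_eq_toFinset_card', Set.toFinset_ofPred]
  exact_mod_cast key.symm

include hR in
/-- The irreducible representations of `GL_n(R)` are parametrised by similarity classes and
irreducible representations of centralizers. -/
theorem exists_equiv_irr [Finite R] (hψ : ψ ≠ 1)
    (r : ConjClasses (Matrix (Fin n) (Fin n) k) → Matrix (Fin n) (Fin n) k)
    (χ : ∀ C, stab res (r C) →* ℂˣ) (hr : ∀ C, ConjClasses.mk (r C) = C)
    (hχ : ∀ C, IsExtension π res ψ (r C) (χ C)) :
    ∃ P : (Σ C, Irr (matCentralizer (r C))) ≃ Irr (GL (Fin n) R),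
      ∀ C σ, IsInduced res (r C) (χ C) σ (P ⟨C, σ⟩) ∧
        (P ⟨C, σ⟩).dim = (matCentralizer (r C)).index * σ.dim := by
  choose p hp using fun x : Σ C, Irr (matCentralizer (r C)) =>
    hR.exists_isInduced hψ (hχ x.1) x.2
  refine ⟨Equiv.ofBijective p ⟨?_, fun c => ?_⟩, fun C σ =>
    ⟨hp ⟨C, σ⟩, hR.dim_of_isInduced hψ (hχ C) (hp ⟨C, σ⟩)⟩⟩
  · rintro ⟨C, σ⟩ ⟨C', σ'⟩ h
    have h1 := hp ⟨C, σ⟩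
    have h2 := hp ⟨C', σ'⟩
    rw [← h] at h2
    obtain rfl : C = C' := by
      rw [← hr C, ← hr C', ConjClasses.mk_eq_mk_iff_isConj]
      exact hR.isConj_of_isInduced hψ (hχ C) (hχ C') h1 h2
    exact congrArg (Sigma.mk C) (hR.eq_of_isInduced_of_isInduced hψ (hχ C) h1 h2)
  · obtain ⟨B, hB⟩ := hR.exists_forall_isInduced hψ c
    obtain ⟨σ, hσ⟩ := hB (r (ConjClasses.mk B))
      (ConjClasses.mk_eq_mk_iff_isConj.1 (hr (ConjClasses.mk B))) _ (hχ _)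
    exact ⟨⟨_, σ⟩, hR.eq_of_isInduced hψ (hχ _) (hp ⟨_, σ⟩) hσ⟩

end Induced

end IsLengthTwo

end Parametrization

end

noncomputable section

open Matrix

/-! ### The canonical bijection -/

section Canonical

variable {k : Type*} [Field k] {n : ℕ}

/-- The shifts of ψ₀ are distinct and as numerous as the additive characters of k. -/
theorem AddChar.exists_eq_mulShift [Finite k] {ψ₀ : AddChar k ℂ} (h₀ : ψ₀ ≠ 1) (ψ : AddChar k ℂ) :
    ∃ b, ψ = ψ₀.mulShift b := by
  have := Fintype.ofFinite k
  have hinj := AddChar.to_mulShift_inj_of_isPrimitive (AddChar.IsPrimitive.of_ne_one h₀)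
  obtain ⟨b, hb⟩ := ((Fintype.bijective_iff_injective_and_card _).2
    ⟨hinj, AddChar.card_eq.symm⟩).2 ψ
  exact ⟨b, hb.symm⟩

theorem AddChar.exists_ne_one (k : Type*) [Field k] [Finite k] : ∃ ψ : AddChar k ℂ, ψ ≠ 1 := by
  obtain ⟨ψ, hψ⟩ := (AddChar.exists_apply_ne_zero (a := (1 : k))).2 one_ne_zero
  exact ⟨ψ, fun h => hψ (by rw [h, AddChar.one_apply])⟩

/-- The twist of a representation by a character, pulled back along an isomorphism. -/
def IrrRep.twist {G H : Type*} [Group G] [Group H] (a : IrrRep G) (l : G →* ℂˣ) (e : H ≃* G) :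
    IrrRep H where
  dim := a.dim
  ρ :=
    { toFun := fun h => (l (e h) : ℂ) • a.ρ (e h)
      map_one' := by simp
      map_mul' := fun g h => by
        simp only [map_mul, Units.val_mul, smul_mul_smul_comm] }
  irreducible := by
    refine Representation.isIrreducible_iff_forall_submodule.2 ⟨a.irreducible.nontrivial,
      fun U hU => (Representation.isIrreducible_iff_forall_submodule.1 a.irreducible).2 U
        fun g u hu => ?_⟩
    have : (l (e (e.symm g)) : ℂ) • a.ρ (e (e.symm g)) u ∈ U := hU (e.symm g) u hu
    rwa [U.smul_mem_iff (Units.ne_zero _), MulEquiv.apply_symm_apply] at this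

/-- A nonzero scalar does not change the centralizer. -/
theorem map_conj_matCentralizer {A₁ A₂ : Matrix (Fin n) (Fin n) k} {b : k} (hb : b ≠ 0)
    {y : GL (Fin n) k} (hy : A₂ * (y : Matrix (Fin n) (Fin n) k) = b • (y * A₁)) :
    (matCentralizer A₁).map (MulAut.conj y).toMonoidHom = matCentralizer A₂ := by
  have h1 : A₂ = b • ((y : Matrix (Fin n) (Fin n) k) * A₁ * (y⁻¹ : GL (Fin n) k)) := by
    rw [← smul_mul_assoc, ← hy, Units.mul_inv_cancel_right]
  ext z
  obtain ⟨w, rfl⟩ := (MulAut.conj y).surjective z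
  rw [Subgroup.mem_map_equiv, MulEquiv.symm_apply_apply]
  change (w : Matrix (Fin n) (Fin n) k) * A₁ = A₁ * w ↔
    ((y * w * y⁻¹ : GL (Fin n) k) : Matrix (Fin n) (Fin n) k) * A₂ =
      A₂ * ((y * w * y⁻¹ : GL (Fin n) k) : Matrix (Fin n) (Fin n) k)
  have e1 : ∀ U V : Matrix (Fin n) (Fin n) k, (y : Matrix (Fin n) (Fin n) k) * U *
      ((y⁻¹ : GL (Fin n) k) : Matrix (Fin n) (Fin n) k) * (y * V * (y⁻¹ : GL (Fin n) k)) =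
      y * (U * V) * (y⁻¹ : GL (Fin n) k) := fun U V => by
    simp only [mul_assoc]
    rw [Units.inv_mul_cancel_left]
  rw [h1, Units.val_mul, Units.val_mul, mul_smul_comm, smul_mul_assoc, e1, e1,
    (smul_right_injective (Matrix (Fin n) (Fin n) k) hb).eq_iff, Units.mul_left_inj, Units.mul_right_inj]

/-- Conjugation by `y` as an isomorphism of centralizers. -/
def centralizerConj {A₁ A₂ : Matrix (Fin n) (Fin n) k} {b : k} (hb : b ≠ 0)
    {y : GL (Fin n) k} (hy : A₂ * (y : Matrix (Fin n) (Fin n) k) = b • (y * A₁)) :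
    matCentralizer A₁ ≃* matCentralizer A₂ :=
  ((MulAut.conj y).subgroupMap (matCentralizer A₁)).trans
    (MulEquiv.subgroupCongr (map_conj_matCentralizer hb hy))

variable {R : Type*} [CommRing R] {π : R} {res : R →+* k}

namespace IsLengthTwo

variable (hR : IsLengthTwo π res)

include hR in
/-- Transport of induced representations along conjugation. -/
theorem isInduced_twist [Finite k] {A₁ A₂ : Matrix (Fin n) (Fin n) k} {b : k} (hb : b ≠ 0)
    {y : GL (Fin n) k} (hy : A₂ * (y : Matrix (Fin n) (Fin n) k) = b • (y * A₁))
    {ψ₁ ψ₂ : AddChar k ℂ} (hψ₁ : ψ₁ ≠ 1) (hψ₂ : ψ₂ ≠ 1) {χ₁ : stab res A₁ →* ℂˣ}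
    {χ₂ : stab res A₂ →* ℂˣ} (hχ₁ : IsExtension π res ψ₁ A₁ χ₁)
    (hχ₂ : IsExtension π res ψ₂ A₂ χ₂) {x : GL (Fin n) R}
    (hx : GeneralLinearGroup.map res x = y) {l : matCentralizer A₁ →* ℂˣ}
    (hl : ∀ (t₁ : stab res A₁) (t₂ : stab res A₂), (t₂ : GL (Fin n) R) = x * t₁ * x⁻¹ →
      χ₁ t₁ = χ₂ t₂ * l (stabRed res A₁ t₁))
    {a : IrrRep (matCentralizer A₁)} {c : Irr (GL (Fin n) R)}
    (h : IsInduced res A₁ χ₁ (Quotient.mk _ a) c) :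
    IsInduced res A₂ χ₂ (Quotient.mk _ (a.twist l (centralizerConj hb hy).symm)) c := by
  obtain ⟨v, rfl⟩ := Quotient.exists_rep c
  obtain ⟨f, h0, hf⟩ := (hR.isInduced_mk_iff hψ₁ hχ₁ a v).1 h
  -- Translating the embedded copy by x moves the A₁-isotypic subspace to the A₂-isotypic one.
  refine (hR.isInduced_mk_iff hψ₂ hχ₂ _ v).2 ⟨v.ρ x ∘ₗ f, fun e => h0 (LinearMap.ext fun w => ?_),
    fun t₂ w => ?_⟩
  · have h1 : v.ρ x⁻¹ (v.ρ x (f w)) = v.ρ x⁻¹ 0 := congrArg _ (LinearMap.congr_fun e w)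
    rw [← Module.End.mul_apply, ← map_mul, inv_mul_cancel, map_one, map_zero] at h1
    exact h1
  · obtain ⟨t₁, ht₁⟩ : ∃ t₁ : stab res A₁, centralizerConj hb hy (stabRed res A₁ t₁) =
        stabRed res A₂ t₂ ∧ (t₂ : GL (Fin n) R) = x * t₁ * x⁻¹ := by
      obtain ⟨z, hz⟩ := (centralizerConj hb hy).surjective (stabRed res A₂ t₂)
      have hz' : y * (z : GL (Fin n) k) * y⁻¹ =
          GeneralLinearGroup.map res (t₂ : GL (Fin n) R) := congrArg Subtype.val hz
      have hm : GeneralLinearGroup.map res (x⁻¹ * (t₂ : GL (Fin n) R) * x) = (z : GL (Fin n) k) := by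
        rw [map_mul, map_mul, map_inv, hx, ← hz']
        group
      refine ⟨⟨x⁻¹ * t₂ * x, ?_⟩, ?_, by group⟩
      · change GeneralLinearGroup.map res (x⁻¹ * (t₂ : GL (Fin n) R) * x) ∈ matCentralizer A₁
        rw [hm]
        exact z.2
      · rw [← hz]
        exact congrArg _ (Subtype.ext hm)
    obtain ⟨h1, h2⟩ := ht₁
    have h3 : twistRep res A₂ χ₂ (a.twist l (centralizerConj hb hy).symm).ρ t₂ =
        twistRep res A₁ χ₁ a.ρ t₁ := by
      change (χ₂ t₂ : ℂ) • ((l ((centralizerConj hb hy).symm (stabRed res A₂ t₂)) : ℂ) •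
        a.ρ ((centralizerConj hb hy).symm (stabRed res A₂ t₂))) =
        (χ₁ t₁ : ℂ) • a.ρ (stabRed res A₁ t₁)
      rw [← h1, MulEquiv.symm_apply_apply, smul_smul, hl t₁ t₂ h2, Units.val_mul]
    rw [h3]
    have h4 : ∀ w, v.ρ x (f (twistRep res A₁ χ₁ a.ρ t₁ w)) = v.ρ t₂ (v.ρ x (f w)) := fun w => by
      rw [hf, h2, ← Module.End.mul_apply, ← Module.End.mul_apply, ← map_mul, ← map_mul,
        inv_mul_cancel_right]
    exact h4 w

/-- By `stabLog_conj`, the canonical extension for ψ₀(b·) and A is the conjugate of the one for ψ₀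
and B. The new representation of Z(B) depends only on σ, μ and y, all of them over k, so the same
change happens over both rings. -/
theorem isInduced_canonExt_of_mulShift [Finite R] {A B : Matrix (Fin n) (Fin n) k} {b : k}
    (hb : b ≠ 0) {y : GL (Fin n) k} (hy : B * (y : Matrix (Fin n) (Fin n) k) = b • (y * A))
    {ψ₀ : AddChar k ℂ} (h₀ : ψ₀ ≠ 1) (hψ : ψ₀.mulShift b ≠ 1) {μ : matCentralizer A →* ℂˣ}
    {a : IrrRep (matCentralizer A)} {c : Irr (GL (Fin n) R)}
    (h : IsInduced res A (hR.canonExt (ψ₀.mulShift b) A * μ.comp (stabRed res A))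
      (Quotient.mk _ a) c) :
    IsInduced res B (hR.canonExt ψ₀ B)
      (Quotient.mk _ (a.twist μ (centralizerConj hb hy).symm)) c := by
  have : Finite k := Finite.of_surjective _ hR.surjective
  obtain ⟨x, hx⟩ := hR.exists_gl_lift y
  refine hR.isInduced_twist hb hy hψ h₀ (hR.isExtension_mul (hR.isExtension_canonExt _ A) μ)
    (hR.isExtension_canonExt ψ₀ B) hx (fun t₁ t₂ ht => ?_) h
  have hx' : B * (x : Matrix (Fin n) (Fin n) R).map res =
      b • ((x : Matrix (Fin n) (Fin n) R).map res * A) := by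
    rw [← hx] at hy
    exact hy
  rw [MonoidHom.mul_apply, MonoidHom.comp_apply]
  congr 1
  refine Units.ext ?_
  rw [hR.canonExt_apply, hR.canonExt_apply, hR.stabLog_conj hb hx' t₁ t₂ ht,
    AddChar.mulShift_apply]

variable {R' : Type*} [CommRing R'] [Finite R] [Finite R'] {π' : R'} {res' : R' →+* k}
  (hR' : IsLengthTwo π' res')

-- One fixed ψ₀ with its canonical extensions parametrises both sides by the same pairs, which
-- defines Φ. Every matched pair for any ψ reduces to this case by `isInduced_canonExt_of_mulShift`,
-- and uniqueness holds because the canonical extensions are themselves matched.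
include hR hR' in
theorem exists_unique_isCanonical (n : ℕ) :
    ∃ Φ : Irr (GL (Fin n) R) ≃ Irr (GL (Fin n) R'),
      (∀ c, (Φ c).dim = c.dim) ∧ IsCanonical n π res π' res' Φ ∧
      ∀ Φ' : Irr (GL (Fin n) R) ≃ Irr (GL (Fin n) R'), IsCanonical n π res π' res' Φ' → Φ' = Φ := by
  have : Finite k := Finite.of_surjective _ hR.surjective
  obtain ⟨ψ₀, h₀⟩ := AddChar.exists_ne_one k
  choose r hr using ConjClasses.exists_rep (α := Matrix (Fin n) (Fin n) k)
  have hχ := fun C => hR.isExtension_canonExt ψ₀ (r C)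
  have hχ' := fun C => hR'.isExtension_canonExt ψ₀ (r C)
  obtain ⟨P, hP⟩ := hR.exists_equiv_irr h₀ r _ hr hχ
  obtain ⟨P', hP'⟩ := hR'.exists_equiv_irr h₀ r _ hr hχ'
  refine ⟨P.symm.trans P', fun c => ?_, fun ψ hψ A χ χ' hm σ c c' h h' => ?_, fun Φ' hΦ' => ?_⟩
  · obtain ⟨⟨C, σ⟩, rfl⟩ := P.surjective c
    rw [Equiv.trans_apply, Equiv.symm_apply_apply, (hP C σ).2, (hP' C σ).2]
  · obtain ⟨μ, rfl, rfl⟩ := (isMatched_iff hR hR').1 hm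
    obtain ⟨b, rfl⟩ := AddChar.exists_eq_mulShift h₀ ψ
    have hb : b ≠ 0 := by
      rintro rfl
      exact hψ (AddChar.mulShift_zero ψ₀)
    -- The pair (ψ₀(b·), A) is replaced by ψ₀ and the chosen representative of the class of bA, with
    -- the same y on both sides.
    obtain ⟨y, hy⟩ := ConjClasses.mk_eq_mk_iff_isConj.1 (hr (ConjClasses.mk (b • A))).symm
    set C := ConjClasses.mk (b • A)
    have hy' : r C * (y : Matrix (Fin n) (Fin n) k) = b • (y * A) := by
      rw [← mul_smul_comm]
      exact hy.eq.symm
    obtain ⟨a, rfl⟩ := Quotient.exists_rep σ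
    have h1 := hR.eq_of_isInduced h₀ (hχ C)
      (hR.isInduced_canonExt_of_mulShift hb hy' h₀ hψ h) (hP C _).1
    have h2 := hR'.eq_of_isInduced h₀ (hχ' C)
      (hR'.isInduced_canonExt_of_mulShift hb hy' h₀ hψ h') (hP' C _).1
    rw [h1, h2, Equiv.trans_apply, Equiv.symm_apply_apply]
  · refine Equiv.ext fun c => ?_
    obtain ⟨⟨C, σ⟩, rfl⟩ := P.surjective c
    rw [Equiv.trans_apply, Equiv.symm_apply_apply]
    exact hΦ' ψ₀ h₀ (r C) _ _ ((isMatched_iff hR hR').2 ⟨1, MonoidHom.ext fun t => (mul_one _).symm,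
      MonoidHom.ext fun t => (mul_one _).symm⟩) σ _ _ (hP C σ).1
      (hP' C σ).1

end IsLengthTwo

end Canonical

/-! ### Local fields -/

section LocalField

/-- Every element is l(u) + π l(v) for a set-theoretic lift l of the residue map. -/
theorem IsLengthTwo.finite {R k : Type*} [CommRing R] [Field k] {π : R} {res : R →+* k}
    (h : IsLengthTwo π res) [Finite k] : Finite R := by
  choose l hl using h.surjective
  refine Finite.of_surjective (fun p : k × k => l p.1 + π * l p.2) fun x => ?_
  obtain ⟨y, hy⟩ := (h.res_eq_zero_iff (x - l (res x))).1 (by rw [map_sub, hl, sub_self])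
  have hy' : π * (y - l (res y)) = 0 := (h.mul_eq_zero_iff _).2 (by rw [map_sub, hl, sub_self])
  refine ⟨(res x, res y), ?_⟩
  rw [mul_sub, sub_eq_zero] at hy'
  change l (res x) + π * l (res y) = x
  rw [← hy', ← hy, add_sub_cancel]

/-- Allows the second ring to be given the residue field of the first through φ. -/
theorem IsLengthTwo.comp_equiv {R k k' : Type*} [CommRing R] [Field k] [Field k'] {π : R}
    {res : R →+* k} (h : IsLengthTwo π res) (e : k ≃+* k') :
    IsLengthTwo π (e.toRingHom.comp res) := by
  have he : ∀ x, e.toRingHom.comp res x = 0 ↔ res x = 0 := fun x => e.map_eq_zero_iff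
  exact ⟨e.surjective.comp h.surjective, fun x => (he x).trans (h.res_eq_zero_iff x),
    fun x => (h.mul_eq_zero_iff x).trans (he x).symm⟩

/-- The maximal ideal is generated by ϖ, and cancelling ϖ in ϖ² ∣ ϖa computes the annihilator of the
uniformizer. -/
theorem O₂.isLengthTwo (F : Type*) [Field F] [ValuativeRel F] [TopologicalSpace F]
    [IsNonarchimedeanLocalField F] {ϖ : 𝒪[F]} (hϖ : Irreducible ϖ) :
    IsLengthTwo (Ideal.Quotient.mk (𝓂[F] ^ 2) ϖ) (O₂.res F) := by
  have hres : ∀ a : 𝒪[F], O₂.res F (Ideal.Quotient.mk (𝓂[F] ^ 2) a) = 0 ↔ ϖ ∣ a := fun a => by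
    rw [← Ideal.mem_span_singleton, ← hϖ.maximalIdeal_eq]
    exact IsLocalRing.residue_eq_zero_iff a
  have hϖ0 : O₂.res F (Ideal.Quotient.mk (𝓂[F] ^ 2) ϖ) = 0 := (hres ϖ).2 dvd_rfl
  refine ⟨fun y => ?_, fun x => ⟨fun hx => ?_, ?_⟩, fun x => ?_⟩
  · obtain ⟨a, rfl⟩ := IsLocalRing.residue_surjective y
    exact ⟨Ideal.Quotient.mk _ a, rfl⟩
  · obtain ⟨a, rfl⟩ := Ideal.Quotient.mk_surjective x
    obtain ⟨b, rfl⟩ := (hres a).1 hx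
    exact ⟨Ideal.Quotient.mk _ b, map_mul _ _ _⟩
  · rintro ⟨y, rfl⟩
    rw [map_mul, hϖ0, zero_mul]
  · obtain ⟨a, rfl⟩ := Ideal.Quotient.mk_surjective x
    rw [hres, ← map_mul, Ideal.Quotient.eq_zero_iff_mem, hϖ.maximalIdeal_eq,
      Ideal.span_singleton_pow, Ideal.mem_span_singleton, pow_two, mul_dvd_mul_iff_left hϖ.ne_zero]

end LocalField

end

/-! ### The theorem for local fields. -/

theorem theorem1p1 {F : Type*} {F' : Type*}
    [Field F] [ValuativeRel F] [TopologicalSpace F] [IsNonarchimedeanLocalField F]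
    [Field F'] [ValuativeRel F'] [TopologicalSpace F'] [IsNonarchimedeanLocalField F']
    (n : ℕ) (ϖ : 𝒪[F]) (hϖ : Irreducible ϖ) (ϖ' : 𝒪[F']) (hϖ' : Irreducible ϖ')
    (φ : 𝓀[F] ≃+* 𝓀[F']) :
    let π : O₂ F := Ideal.Quotient.mk (𝓂[F] ^ 2) ϖ
    let π' : O₂ F' := Ideal.Quotient.mk (𝓂[F'] ^ 2) ϖ'
    let res : O₂ F →+* 𝓀[F] := O₂.res F
    let res' : O₂ F' →+* 𝓀[F] := φ.symm.toRingHom.comp (O₂.res F')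
    -- the parametrisation of `Irr (GL_n(𝒪₂))`
    (∀ ψ : AddChar 𝓀[F] ℂ, ψ ≠ 1 →
      (∀ A : Matrix (Fin n) (Fin n) 𝓀[F],
        ∃ χ : stab res A →* ℂˣ, IsExtension π res ψ A χ) ∧
      (∀ (r : ConjClasses (Matrix (Fin n) (Fin n) 𝓀[F]) → Matrix (Fin n) (Fin n) 𝓀[F])
        (χ : ∀ C, stab res (r C) →* ℂˣ),
        (∀ C, ConjClasses.mk (r C) = C) → (∀ C, IsExtension π res ψ (r C) (χ C)) →
        ∃ P : (Σ C, Irr (matCentralizer (r C))) ≃ Irr (GL (Fin n) (O₂ F)),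
          ∀ C σ, IsInduced res (r C) (χ C) σ (P ⟨C, σ⟩) ∧
            (P ⟨C, σ⟩).dim = (matCentralizer (r C)).index * σ.dim)) ∧
    -- the canonical correspondence between extensions over the two rings
    (∀ ψ : AddChar 𝓀[F] ℂ, ψ ≠ 1 → ∀ (A : Matrix (Fin n) (Fin n) 𝓀[F])
      (χ : stab res A →* ℂˣ), IsExtension π res ψ A χ →
      ∃ χ' : stab res' A →* ℂˣ, IsExtension π' res' ψ A χ' ∧ IsMatched π res π' res' ψ A χ χ' ∧
        ∀ χ'' : stab res' A →* ℂˣ, IsMatched π res π' res' ψ A χ χ'' → χ'' = χ') ∧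
    -- the canonical bijection
    (∃ Φ : Irr (GL (Fin n) (O₂ F)) ≃ Irr (GL (Fin n) (O₂ F')),
      (∀ c, (Φ c).dim = c.dim) ∧ IsCanonical n π res π' res' Φ ∧
      ∀ Φ' : Irr (GL (Fin n) (O₂ F)) ≃ Irr (GL (Fin n) (O₂ F')),
        IsCanonical n π res π' res' Φ' → Φ' = Φ) := by
  have hR := O₂.isLengthTwo F hϖ
  have hR' := (O₂.isLengthTwo F' hϖ').comp_equiv φ.symm
  have := hR.finite
  have := hR'.finite
  exact ⟨fun ψ hψ => ⟨fun A => ⟨_, hR.isExtension_canonExt ψ A⟩,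
    fun r χ hr hχ => hR.exists_equiv_irr hψ r χ hr hχ⟩,
    fun ψ _ A χ hχ => IsLengthTwo.exists_unique_isMatched hR hR' hχ,
    IsLengthTwo.exists_unique_isCanonical hR hR' n⟩
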